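/- **Setting.** Identify $T^*S^3$ with $\{(x,p)\in\mathbb R^4\times\mathbb R^4 : |x|=1,\ p\cdot x=0\}$ and $\mathbb R^4\times\mathbb R^4$ with $\mathbb C^4$ by $z=x+ip$. Put $w_1=z_1+iz_2$, $w_2=-z_3+iz_4$, $w_3=z_3+iz_4$, $w_4=z_1-iz_2$. The resolved conifold is $$\widehat{\mathcal C}=\Big\{([u:v],z)\in\mathbb{CP}^1\times\mathbb C^4 : \begin{vmatrix}w_1&w_2\\u&v\end{vmatrix}=\begin{vmatrix}w_3&w_4\\u&v\end{vmatrix}=0\Big\},$$ with the complex structure induced from $\mathbb{CP}^1\times\mathbb C^4$ and the Kähler metric $\widehat g$ that is the restriction of the sum of the Fubini–Study metric $|d\zeta|^2/(1+|\zeta|^2)^2$ ($\zeta=u/v$) and the Euclidean metric $\sum_j|dz_j|^2$. Let $\pi_2:\widehat{\mathcal C}\to\mathbb C^4$ be the projection, and let $F(x,p)=(|p|x,p)$. The conifold transition of a subset $N\subset T^*S^3$ is $\mathrm{CT}(N)=\overline{\pi_2^{-1}(F(N)\setminus\{0\})}\subset\widehat{\mathcal C}$. Let $k:S^1\to S^3$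 be a smooth knot parametrised by arc length, let $\varepsilon>0$, and let $$N^*_{k,\varepsilon}=\{(x,p+\varepsilon\dot k(t)) : x=k(t),\ p\cdot k(t)=p\cdot\dot k(t)=0\},\qquad L=\mathrm{CT}(N^*_{k,\varepsilon}).$$ An open pseudoholomorphic curve ending on $L$ is a map $f:(\Sigma,\partial\Sigma)\to(\widehat{\mathcal C},L)$, where $\Sigma$ is a compact Riemann surface with boundary, $f$ is smooth up to the boundary, and $df\circ j=J\circ df$. Here $\Sigma$ need not be connected and $\partial\Sigma$ may be empty; in particular, $\Sigma$ may be the normalisation of a nodal curve. Its class is $f_*[\Sigma]\in H_2(\widehat{\mathcal C},L;\mathbb Z)$, and $\mathrm{Area}(f)$ is the area of $f$ with respect to $\widehat g$, counted with multiplicity. **Lemma (Area Bound).** For every $\beta\in H_2(\widehat{\mathcal C},L;\mathbb Z)$ there is a constant $A_\beta\in\mathbb R$ such that every open pseudoholomorphic curve $f:(\Sigma,\partial\Sigma)\to(\widehat{\mathcal C},L)$ with $f_*[\Sigma]=\beta$ satisfies $\mathrm{Area}(f)\le A_\beta$. -/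

import Mathlib

open Set Topology MeasureTheory
open scoped Manifold ContDiff ENNReal LinearAlgebra.Projectivization

noncomputable section

namespace Conifold

/-! ### The resolved conifold -/

/-- Real Euclidean four-space. -/
abbrev R4 : Type := EuclideanSpace ℝ (Fin 4)

/-- Complex Euclidean four-space. -/
abbrev C4 : Type := EuclideanSpace ℂ (Fin 4)

/-- The complex projective line. -/
abbrev CP1 : Type := ℙ ℂ (Fin 2 → ℂ)

/-- The complex projective line carries the quotient topology from `ℂ² ∖ {0}`. -/
instance : TopologicalSpace CP1 :=
  TopologicalSpace.coinduced
    (fun v : {v : Fin 2 → ℂ // v ≠ 0} => Projectivization.mk ℂ v.1 v.2) inferInstance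

/-- The homogeneous coordinate `u` of a representative of `[u : v]`. -/
def uCoord (l : CP1) : ℂ := l.rep 0

/-- The homogeneous coordinate `v` of a representative of `[u : v]`. -/
def vCoord (l : CP1) : ℂ := l.rep 1

/-- The affine coordinate `u / v`, a chart of the projective line where `v ≠ 0`. -/
def affU (l : CP1) : ℂ := uCoord l / vCoord l

/-- The affine coordinate `v / u`, a chart of the projective line where `u ≠ 0`. -/
def affV (l : CP1) : ℂ := vCoord l / uCoord l

/-- The linear coordinate `w₁ = z₁ + i z₂` on complex four-space. -/
def w1 (z : C4) : ℂ := z 0 + Complex.I * z 1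

/-- The linear coordinate `w₂ = -z₃ + i z₄` on complex four-space. -/
def w2 (z : C4) : ℂ := -z 2 + Complex.I * z 3

/-- The linear coordinate `w₃ = z₃ + i z₄` on complex four-space. -/
def w3 (z : C4) : ℂ := z 2 + Complex.I * z 3

/-- The linear coordinate `w₄ = z₁ - i z₂` on complex four-space. -/
def w4 (z : C4) : ℂ := z 0 - Complex.I * z 1

/-- The resolved conifold: all `([u : v], z)` in `ℂP¹ × ℂ⁴` for which both determinants
`|w₁ w₂; u v|` and `|w₃ w₄; u v|` vanish, with the subspace topology. -/
def Resolved : Type :=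
  {q : CP1 × C4 // w1 q.2 * vCoord q.1 - w2 q.2 * uCoord q.1 = 0 ∧
    w3 q.2 * vCoord q.1 - w4 q.2 * uCoord q.1 = 0}

instance : TopologicalSpace Resolved := inferInstanceAs (TopologicalSpace (Subtype _))

/-- The projection of the resolved conifold to the projective line. -/
def Resolved.base (q : Resolved) : CP1 := q.1.1

/-- The projection of the resolved conifold to complex four-space. -/
def Resolved.point (q : Resolved) : C4 := q.1.2

/-! ### Knots, shifted conormal bundles and their conifold transitions -/

/-- A smooth knot in the unit three-sphere, parametrised by arc length; it is given as a periodic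
map on the real line which is injective on a half-open period. -/
structure Knot where
  /-- The parametrisation. -/
  toFun : ℝ → R4
  /-- The period. -/
  length : ℝ
  length_pos : 0 < length
  smooth : ContDiff ℝ ∞ toFun
  periodic : Function.Periodic toFun length
  on_sphere : ∀ t, ‖toFun t‖ = 1
  unit_speed : ∀ t, ‖deriv toFun t‖ = 1
  injective : InjOn toFun (Ico 0 length)

/-- The cotangent bundle of the three-sphere, realised in `ℝ⁴ × ℝ⁴`. -/
def cotangentSphere : Set (R4 × R4) := {q | ‖q.1‖ = 1 ∧ inner ℝ q.2 q.1 = 0}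

/-- The perturbed conormal bundle of a knot: the conormal bundle, which consists of the covectors
`(k(t), p)` with `p ⟂ k'(t)`, shifted by `ε` times the unit tangent vector of the knot. -/
def shiftedConormal (k : Knot) (ε : ℝ) : Set (R4 × R4) :=
  {q | ∃ (t : ℝ) (p : R4), (k.toFun t, p) ∈ cotangentSphere ∧
    inner ℝ p (deriv k.toFun t) = 0 ∧ q = (k.toFun t, p + ε • deriv k.toFun t)}

/-- The identification `z = x + i p` of `ℝ⁴ × ℝ⁴` with `ℂ⁴`. -/
def toC4 (q : R4 × R4) : C4 := WithLp.toLp 2 fun j => (q.1 j : ℂ) + Complex.I * (q.2 j : ℂ)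

/-- The contraction `F (x, p) = (|p| x, p)` of the cotangent bundle onto the conifold. -/
def contraction (q : R4 × R4) : C4 := toC4 (‖q.2‖ • q.1, q.2)

/-- The conifold transition of a subset `N` of the cotangent bundle: the closure of the inverse
image of `F(N) ∖ {0}` in the resolved conifold. -/
def conifoldTransition (N : Set (R4 × R4)) : Set Resolved :=
  closure (Resolved.point ⁻¹' (contraction '' N \ {0}))

/-! ### Relative singular homology -/

/-- Integral singular `n`-chains of a space. -/
abbrev Chain (n : ℕ) (X : Type*) [TopologicalSpace X] : Type _ :=
  C(stdSimplex ℝ (Fin (n + 1)), X) →₀ ℤ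

/-- The inclusion of the `i`-th face of the standard simplex. -/
def face (n : ℕ) (i : Fin (n + 2)) :
    C(stdSimplex ℝ (Fin (n + 1)), stdSimplex ℝ (Fin (n + 2))) :=
  ⟨stdSimplex.map i.succAbove, stdSimplex.continuous_map _⟩

/-- The singular boundary operator. -/
def bdry (n : ℕ) (X : Type*) [TopologicalSpace X] : Chain (n + 1) X →+ Chain n X :=
  Finsupp.liftAddHom fun σ =>
    ∑ i : Fin (n + 2), (-1 : ℤ) ^ (i : ℕ) • Finsupp.singleAddHom (σ.comp (face n i))

/-- The singular chains of a space which lie in a subset `A`. -/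
def chainsIn (n : ℕ) {X : Type*} [TopologicalSpace X] (A : Set X) : AddSubgroup (Chain n X) :=
  AddSubgroup.closure {c | ∃ σ : C(stdSimplex ℝ (Fin (n + 1)), X),
    (∀ x, σ x ∈ A) ∧ c = Finsupp.single σ 1}

/-- The relative cycles of degree `n + 1` of the pair `(X, A)`. -/
def relCycles (n : ℕ) {X : Type*} [TopologicalSpace X] (A : Set X) :
    AddSubgroup (Chain (n + 1) X) :=
  (chainsIn n A).comap (bdry n X)

/-- The relative boundaries of degree `n + 1` of the pair `(X, A)`. -/
def relBoundaries (n : ℕ) {X : Type*} [TopologicalSpace X] (A : Set X) :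
    AddSubgroup (Chain (n + 1) X) :=
  (bdry (n + 1) X).range ⊔ chainsIn (n + 1) A

/-- The relative integral singular homology group of degree `n + 1` of the pair `(X, A)`. -/
abbrev RelHomologySucc (n : ℕ) {X : Type*} [TopologicalSpace X] (A : Set X) : Type _ :=
  relCycles n A ⧸ (relBoundaries n A).addSubgroupOf (relCycles n A)

/-- The relative homology group `H₂(X, A; ℤ)`. -/
abbrev H2 (X : Type*) [TopologicalSpace X] (A : Set X) : Type _ := RelHomologySucc 1 A

/-- The chain map induced by a continuous map. -/
def pushChain (n : ℕ) {X Y : Type*} [TopologicalSpace X] [TopologicalSpace Y] (f : C(X, Y)) :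
    Chain n X →+ Chain n Y :=
  Finsupp.liftAddHom fun σ => Finsupp.singleAddHom (f.comp σ)

theorem bdry_pushChain (n : ℕ) {X Y : Type*} [TopologicalSpace X] [TopologicalSpace Y]
    (f : C(X, Y)) (c : Chain (n + 1) X) :
    bdry n Y (pushChain (n + 1) f c) = pushChain n f (bdry n X c) := by
  have h : (bdry n Y).comp (pushChain (n + 1) f) = (pushChain n f).comp (bdry n X) := by
    ext σ : 2
    simp [bdry, pushChain, ContinuousMap.comp_assoc]
  exact DFunLike.congr_fun h c

theorem pushChain_mem_chainsIn (n : ℕ) {X Y : Type*} [TopologicalSpace X] [TopologicalSpace Y]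
    {A : Set X} {B : Set Y} (f : C(X, Y)) (h : MapsTo f A B) {c : Chain n X}
    (hc : c ∈ chainsIn n A) : pushChain n f c ∈ chainsIn n B := by
  have : chainsIn n A ≤ (chainsIn n B).comap (pushChain n f) := by
    refine (AddSubgroup.closure_le _).2 ?_
    rintro _ ⟨σ, hσ, rfl⟩
    refine AddSubgroup.subset_closure ⟨f.comp σ, fun x => h (hσ x), ?_⟩
    simp [pushChain]
  exact this hc

/-- The chain map induced by a map of pairs, on relative cycles. -/
def pushCycles (n : ℕ) {X Y : Type*} [TopologicalSpace X] [TopologicalSpace Y]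
    {A : Set X} {B : Set Y} (f : C(X, Y)) (h : MapsTo f A B) : relCycles n A →+ relCycles n B :=
  ((pushChain (n + 1) f).comp (relCycles n A).subtype).codRestrict (relCycles n B) fun c => by
    have := pushChain_mem_chainsIn n f h c.2
    rwa [← bdry_pushChain] at this

/-- The homomorphism `f_* : H₂(X, A; ℤ) → H₂(Y, B; ℤ)` induced by a map of pairs. -/
def H2.map {X Y : Type*} [TopologicalSpace X] [TopologicalSpace Y]
    {A : Set X} {B : Set Y} (f : C(X, Y)) (h : MapsTo f A B) : H2 X A →+ H2 Y B :=
  QuotientAddGroup.map _ _ (pushCycles 1 f h) <| by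
    intro c hc
    have hc' : (c : Chain 2 X) ∈ relBoundaries 1 A := hc
    obtain ⟨_, ⟨d, rfl⟩, a, ha, hda⟩ := AddSubgroup.mem_sup.1 hc'
    change pushChain 2 f c ∈ relBoundaries 1 B
    rw [← hda, map_add, ← bdry_pushChain]
    exact AddSubgroup.add_mem_sup ⟨_, rfl⟩ (pushChain_mem_chainsIn 2 f h ha)

/-! ### Compact Riemann surfaces with boundary -/

/-- The closed upper half-plane. -/
def HalfPlane : Type := {z : ℂ // 0 ≤ z.im}

instance : TopologicalSpace HalfPlane := inferInstanceAs (TopologicalSpace (Subtype _))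

/-- The inclusion of the closed half-plane in the plane, with the retraction
`x + i y ↦ x + i max(y, 0)` as its inverse. -/
def halfPlaneEquiv : PartialEquiv HalfPlane ℂ where
  toFun z := z.1
  invFun z := ⟨⟨z.re, max z.im 0⟩, le_max_right _ _⟩
  source := univ
  target := {z | 0 ≤ z.im}
  map_source' z _ := z.2
  map_target' _ _ := mem_univ _
  left_inv' z _ := Subtype.ext (Complex.ext rfl (max_eq_left z.2))
  right_inv' _ hz := Complex.ext rfl (max_eq_left hz)

theorem range_halfPlaneEquiv : range halfPlaneEquiv = {z : ℂ | 0 ≤ z.im} :=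
  Subtype.range_val

theorem continuous_halfPlaneEquiv : Continuous halfPlaneEquiv := continuous_subtype_val

theorem continuous_halfPlaneEquiv_symm : Continuous halfPlaneEquiv.symm :=
  Continuous.subtype_mk (Complex.equivRealProdCLM.symm.continuous.comp
    (Complex.continuous_re.prodMk (Complex.continuous_im.max continuous_const))) _

/-- The closed half-plane as a model with boundary over the complex numbers. Its smooth
manifolds are the Riemann surfaces with boundary: their transition maps are holomorphic in the
interior and smooth up to the boundary. -/
def cxModel : ModelWithCorners ℂ ℂ HalfPlane where
  toPartialEquiv := halfPlaneEquiv
  source_eq := rfl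
  convex_range' := by
    simp only [instIsRCLikeNormedField, ↓reduceDIte]
    apply Convex.convex_isRCLikeNormedField
    rw [range_halfPlaneEquiv]
    exact convex_halfSpace_im_ge 0
  nonempty_interior' := by
    rw [range_halfPlaneEquiv, Complex.interior_setOfPred_le_im]
    exact ⟨Complex.I, by simp⟩
  continuous_toFun := continuous_halfPlaneEquiv
  continuous_invFun := continuous_halfPlaneEquiv_symm

/-- The closed half-plane as a model with boundary over the real numbers. It describes the
underlying real surface of a Riemann surface with boundary. -/
def realModel : ModelWithCorners ℝ ℂ HalfPlane :=
  ModelWithCorners.ofConvexRange halfPlaneEquiv rfl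
    (convex_halfSpace_im_ge 0) continuous_halfPlaneEquiv continuous_halfPlaneEquiv_symm
    (by
      change (interior {z : ℂ | 0 ≤ z.im}).Nonempty
      rw [Complex.interior_setOfPred_le_im]
      exact ⟨Complex.I, by simp⟩)

/-- The closed triangle with vertices `(0, 0)`, `(1, 0)`, `(0, 1)`. -/
def closedTriangle : Set (ℝ × ℝ) := {y | 0 ≤ y.1 ∧ 0 ≤ y.2 ∧ y.1 + y.2 ≤ 1}

/-- The open triangle with vertices `(0, 0)`, `(1, 0)`, `(0, 1)`. -/
def openTriangle : Set (ℝ × ℝ) := {y | 0 < y.1 ∧ 0 < y.2 ∧ y.1 + y.2 < 1}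

section Surface

variable (S : Type*) [TopologicalSpace S] [ChartedSpace HalfPlane S]

/-- The partial derivative of a map from the plane to a Riemann surface, as a complex number in
the preferred chart at the image point. -/
def surfDeriv {S : Type*} [TopologicalSpace S] [ChartedSpace HalfPlane S]
    (g : ℝ × ℝ → S) (y a : ℝ × ℝ) : ℂ :=
  (mfderiv 𝓘(ℝ, ℝ × ℝ) realModel g y : ℝ × ℝ →L[ℝ] ℂ) a

/-- The Jacobian determinant of a map from the plane to a Riemann surface, in the preferred chart
at the image point. Its sign says whether the map preserves the orientation that the complex
structure gives to the surface. -/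
def surfJacobian {S : Type*} [TopologicalSpace S] [ChartedSpace HalfPlane S]
    (g : ℝ × ℝ → S) (y : ℝ × ℝ) : ℝ :=
  (starRingEnd ℂ (surfDeriv g y (1, 0)) * surfDeriv g y (0, 1)).im

/-- A finite smooth triangulation of a Riemann surface with boundary. The triangles are
parametrised by the standard triangle, smoothly up to its boundary and as diffeomorphisms in the
interior; they cover the surface without overlap; and with the signs which compare each
parametrisation with the orientation of the surface, their sum is a relative cycle modulo the
boundary of the surface. Every compact Riemann surface with boundary has one. -/
structure Triangulation where
  /-- The number of triangles. -/
  card : ℕ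
  /-- The parametrisations of the triangles; only their values on the closed triangle matter. -/
  param : Fin card → ℝ × ℝ → S
  /-- The same parametrisations as singular simplices. -/
  simplex : Fin card → C(stdSimplex ℝ (Fin 3), S)
  /-- The orientation signs. -/
  sign : Fin card → ℤˣ
  simplex_eq : ∀ i x, simplex i x = param i (x 1, x 2)
  smooth : ∀ i, ContMDiffOn 𝓘(ℝ, ℝ × ℝ) realModel ∞ (param i) closedTriangle
  injOn : ∀ i, InjOn (param i) openTriangle
  sign_jacobian : ∀ i, ∀ y ∈ openTriangle, 0 < ((sign i : ℤ) : ℝ) * surfJacobian (param i) y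
  disjoint : ∀ i j, i ≠ j → Disjoint (param i '' openTriangle) (param j '' openTriangle)
  cover : ⋃ i, param i '' closedTriangle = univ
  isRelCycle : ∑ i, Finsupp.single (simplex i) (sign i : ℤ) ∈ relCycles 1 (realModel.boundary S)

/-- The fundamental class `[Σ] ∈ H₂(Σ, ∂Σ; ℤ)` of a compact Riemann surface with boundary: the sum
of the positively oriented triangles of a triangulation. -/
def Triangulation.fundamentalClass {S : Type*} [TopologicalSpace S] [ChartedSpace HalfPlane S]
    (T : Triangulation S) : H2 S (realModel.boundary S) :=
  QuotientAddGroup.mk ⟨∑ i, Finsupp.single (T.simplex i) (T.sign i : ℤ), T.isRelCycle⟩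

end Surface

/-! ### Pseudoholomorphic curves and their area -/

/-- The real differential at `p` of a map from a Riemann surface with boundary to a complex vector
space; the tangent space at `p` is identified with `ℂ` through the preferred chart at `p`. -/
def curveDeriv {S : Type*} [TopologicalSpace S] [ChartedSpace HalfPlane S]
    {E : Type*} [NormedAddCommGroup E] [NormedSpace ℂ E] (F : S → E) (p : S) : ℂ →L[ℝ] E :=
  mfderiv realModel 𝓘(ℝ, E) F p

/-- A map `F` from a Riemann surface with boundary to a complex vector space is smooth near `p`
(up to the boundary) and its differential at `p` intertwines the complex structures. -/
def IsHolomorphicAt {S : Type*} [TopologicalSpace S] [ChartedSpace HalfPlane S]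
    {E : Type*} [NormedAddCommGroup E] [NormedSpace ℂ E] (F : S → E) (p : S) : Prop :=
  ContMDiffAt realModel 𝓘(ℝ, E) ∞ F p ∧
    ∀ a : ℂ, curveDeriv F p (Complex.I * a) = Complex.I • curveDeriv F p a

/-- A map from a Riemann surface with boundary to the resolved conifold is smooth and its
differential intertwines the complex structures. Since the resolved conifold is a complex
submanifold of `ℂP¹ × ℂ⁴`, this is a condition on the component in `ℂ⁴` and on the component in
`ℂP¹`, expressed in the two affine charts. -/
structure IsPseudoholomorphic {S : Type*} [TopologicalSpace S] [ChartedSpace HalfPlane S]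
    (f : S → Resolved) : Prop where
  point : ∀ p, IsHolomorphicAt (fun q => (f q).point) p
  base_u : ∀ p, vCoord (f p).base ≠ 0 → IsHolomorphicAt (fun q => affU (f q).base) p
  base_v : ∀ p, uCoord (f p).base ≠ 0 → IsHolomorphicAt (fun q => affV (f q).base) p

/-- The pull-back by `h` of the Fubini-Study metric `|dz|² / (1 + |z|²)²` of the projective line,
at the point `y` and on the vectors `a` and `b`; here `z` is an affine coordinate that is finite
at the point `h y`. -/
def fubiniStudyPullback (h : ℝ × ℝ → CP1) (y a b : ℝ × ℝ) : ℝ :=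
  open Classical in
  if vCoord (h y) ≠ 0 then
    (fderiv ℝ (affU ∘ h) y a * starRingEnd ℂ (fderiv ℝ (affU ∘ h) y b)).re /
      (1 + ‖affU (h y)‖ ^ 2) ^ 2
  else
    (fderiv ℝ (affV ∘ h) y a * starRingEnd ℂ (fderiv ℝ (affV ∘ h) y b)).re /
      (1 + ‖affV (h y)‖ ^ 2) ^ 2

/-- The pull-back by `h` of the standard Kähler metric of the resolved conifold, which is the
restriction of the sum of the Fubini-Study metric and the Euclidean metric of `ℂ⁴`. -/
def metricPullback (h : ℝ × ℝ → Resolved) (y a b : ℝ × ℝ) : ℝ :=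
  fubiniStudyPullback (fun x => (h x).base) y a b +
    (inner ℂ (fderiv ℝ (fun x => (h x).point) y a) (fderiv ℝ (fun x => (h x).point) y b)).re

/-- The area density `√(E G - F²)` of a parametrised surface in the resolved conifold. -/
def areaDensity (h : ℝ × ℝ → Resolved) (y : ℝ × ℝ) : ℝ :=
  Real.sqrt (metricPullback h y (1, 0) (1, 0) * metricPullback h y (0, 1) (0, 1) -
    metricPullback h y (1, 0) (0, 1) ^ 2)

/-- The area of a map from a compact Riemann surface to the resolved conifold, counted with
multiplicity: the sum of the areas of the images of the triangles of a triangulation. -/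
def area {S : Type*} [TopologicalSpace S] [ChartedSpace HalfPlane S]
    (f : S → Resolved) (T : Triangulation S) : ℝ≥0∞ :=
  ∑ i, ∫⁻ y in openTriangle, ENNReal.ofReal (areaDensity (f ∘ T.param i) y)

end Conifold

end

/-! The area of a holomorphic curve is the integral of the Kähler form `ω`, which is half the
curvature of the tautological line bundle over the projective line plus the differential of the
Liouville form `λ`. If `L` were compact and exact, Stokes' theorem would make this a function of the
class. Here `L` is not compact and `λ` is not closed on it: along a path in `L` over `x = k(t)` it
equals `-ε |p| dt` (`imForm_derivWithin`), which is unbounded. The remedy is to correct `ω` by an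
exact form which is adapted to `L`, and to pay for the correction with a second exact form whose
boundary integral is homological.

The correction is `d b`, with `b` the `boundaryForm`, a one-form on `ℂ⁴` that is cut off near the
origin. On `L` it restricts to `λ` plus half the connection form in a trivialisation of the
tautological bundle. This trivialisation, `lineSection`, exists because `L` is shifted: after
quaternionic translation to the identity, the line over `(x, p)` is the point `p / |p|` of the
two-sphere, and `p · k' = ε > 0` keeps it away from the antipode of `k'`. Projecting a unit vector
in the line of `k'` to the line of `p` therefore never gives zero
(`IsConormal.half_le_norm_lineSection`). Consequently the integral of `ω - d b` is half the relative
degree of the tautological bundle, with no further boundary term (`pathIntegral_boundaryForm`).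

The pieces of `b` are homogeneous at infinity, so `d b` decays like `1 / |z|`. The form `d (λ /
|z|)` is positive on complex lines and has exactly this size, so `d b` is at most a constant `C`
times it there (`exists_formDeriv_boundaryForm_le`). On `L` the form `λ / |z|` is `-(ε / √2) dt`,
which is closed, and its integral over the boundary counts how far the boundary travels along the
knot (`pathIntegral_coneForm`). Since the curve is holomorphic, its area is at most the integral of
`(ω - d b) + C d (λ / |z|)`.

Both terms are evaluated on singular chains. `windingCochain` is a cocycle vanishing on `L`, and
`angleCochain` composed with the boundary operator kills chains in `L`, so `topologicalArea`
vanishes on relative boundaries and its value depends only on `β`. Stokes' theorem is applied to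
each triangle of a triangulation. The edge terms are cochains depending on the edge alone; they
reduce to their values on `L` because the total boundary is a chain in `L`. -/

noncomputable section

namespace Conifold

/-! ### Lifts over compact convex sets -/

section Lifts

variable {V E : Type*} [NormedAddCommGroup V] [NormedSpace ℝ V] [NormedAddCommGroup E]

/-- A continuous function on a compact convex set varies little along each step of a fine enough
equidistant subdivision of the segments from a base point. -/
theorem exists_uniform_subdivision {D : Set V} (hD : IsCompact D) (hc : Convex ℝ D) {x₀ : V}
    (h₀ : x₀ ∈ D) {P : V → E} (hP : ContinuousOn P D) {δ : ℝ} (hδ : 0 < δ) :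
    ∃ N : ℕ, 0 < N ∧ ∀ x ∈ D, ∀ j < N,
      ‖P (AffineMap.lineMap x₀ x (((j + 1 : ℕ) : ℝ) / N)) -
        P (AffineMap.lineMap x₀ x ((j : ℝ) / N))‖ < δ := by
  obtain ⟨η, hη, hu⟩ := Metric.uniformContinuousOn_iff.1
    (hD.uniformContinuousOn_of_continuous hP) δ hδ
  obtain ⟨C, hC⟩ := hD.isBounded.exists_norm_le
  obtain ⟨N, hN⟩ := exists_nat_gt ((2 * C) / η)
  have hC0 : 0 ≤ C := (norm_nonneg _).trans (hC _ h₀)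
  have hN0 : (0 : ℝ) < N := lt_of_le_of_lt (by positivity) hN
  refine ⟨N, by exact_mod_cast hN0, fun x hx j hj => ?_⟩
  have hmem : ∀ i : ℕ, i ≤ N → AffineMap.lineMap x₀ x ((i : ℝ) / N) ∈ D := fun i hi =>
    hc.lineMap_mem h₀ hx ⟨by positivity, div_le_one_of_le₀ (by exact_mod_cast hi) hN0.le⟩
  rw [← dist_eq_norm]
  refine hu _ (hmem _ hj) _ (hmem _ hj.le) ?_
  rw [dist_lineMap_lineMap, Real.dist_eq, ← sub_div, dist_eq_norm]
  have h1 : |(((j + 1 : ℕ) : ℝ) - j) / N| = 1 / N := by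
    push_cast
    rw [add_sub_cancel_left, abs_of_pos (by positivity)]
  rw [h1]
  have h2 : ‖x₀ - x‖ ≤ 2 * C := (norm_sub_le _ _).trans (by linarith [hC _ h₀, hC _ hx])
  rw [div_lt_iff₀ hη] at hN
  rw [div_mul_eq_mul_div, div_lt_iff₀ hN0, one_mul]
  linarith

theorem lineMap_mem_of_le {D : Set V} (hc : Convex ℝ D) {x₀ x : V} (h₀ : x₀ ∈ D) (hx : x ∈ D)
    {N i : ℕ} (hi : i ≤ N) : AffineMap.lineMap x₀ x ((i : ℝ) / N) ∈ D :=
  hc.lineMap_mem h₀ hx ⟨by positivity, div_le_one_of_le₀ (by exact_mod_cast hi) (by positivity)⟩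

/-- A continuous family of projections over a compact convex set has a nowhere vanishing section
through a given nonzero vector; it is smooth if the family is smooth. -/
theorem exists_section [NormedSpace ℝ E] {D : Set V} (hD : IsCompact D) (hc : Convex ℝ D) {x₀ : V}
    (h₀ : x₀ ∈ D) {P : V → E →L[ℝ] E} (hP : ContinuousOn P D)
    (hPP : ∀ x ∈ D, ∀ v, P x (P x v) = P x v) {v₀ : E} (hv₀ : v₀ ≠ 0) (hPv : P x₀ v₀ = v₀) :
    ∃ s : V → E, ContinuousOn s D ∧ (∀ x ∈ D, s x ≠ 0) ∧ (∀ x ∈ D, P x (s x) = s x) ∧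
      (ContDiffOn ℝ ∞ P D → ContDiffOn ℝ ∞ s D) := by
  obtain ⟨N, hN0, hN⟩ := exists_uniform_subdivision hD hc h₀ hP one_pos
  have key : ∀ i ≤ N, ∃ s : V → E, ContinuousOn s D ∧ (∀ x ∈ D, s x ≠ 0) ∧
      (∀ x ∈ D, P (AffineMap.lineMap x₀ x ((i : ℝ) / N)) (s x) = s x) ∧
      (ContDiffOn ℝ ∞ P D → ContDiffOn ℝ ∞ s D) := by
    intro i
    induction i with
    | zero =>
      exact fun _ => ⟨fun _ => v₀, continuousOn_const, fun _ _ => hv₀, by simp [hPv],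
        fun _ => contDiffOn_const⟩
    | succ i ih =>
      intro hi
      obtain ⟨s, hs, hs0, hPs, hsm⟩ := ih (by omega)
      have hmaps : MapsTo (fun x => AffineMap.lineMap x₀ x (((i + 1 : ℕ) : ℝ) / N)) D D :=
        fun x hx => lineMap_mem_of_le hc h₀ hx hi
      have hsmooth : ContDiff ℝ ∞
          (fun x => AffineMap.lineMap (k := ℝ) x₀ x (((i + 1 : ℕ) : ℝ) / N)) := by
        simp only [AffineMap.lineMap_apply_module]
        fun_prop
      -- The section at the previous subdivision point is projected at the next one. It cannot die:
      -- if `P'` kills a vector fixed by `P`, then `P' - P` preserves its norm, while `‖P' - P‖ <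
      -- 1`.
      refine ⟨fun x => P (AffineMap.lineMap x₀ x (((i + 1 : ℕ) : ℝ) / N)) (s x), ?_, ?_, ?_, ?_⟩
      · exact (hP.comp hsmooth.continuous.continuousOn hmaps).clm_apply hs
      · intro x hx h
        beta_reduce at h
        have h1 := hN x hx i (by omega)
        have h2 := (P (AffineMap.lineMap x₀ x (((i + 1 : ℕ) : ℝ) / N)) -
          P (AffineMap.lineMap x₀ x ((i : ℝ) / N))).le_opNorm (s x)
        have h3 : (0 : ℝ) < ‖s x‖ := norm_pos_iff.2 (hs0 x hx)
        rw [sub_apply, h, hPs x hx, zero_sub, norm_neg] at h2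
        nlinarith
      · exact fun x hx => hPP _ (hmaps hx) _
      · exact fun h => (h.comp hsmooth.contDiffOn hmaps).clm_apply (hsm h)
  obtain ⟨s, h1, h2, h3, h4⟩ := key N le_rfl
  have hN' : (N : ℝ) ≠ 0 := by exact_mod_cast hN0.ne'
  exact ⟨s, h1, h2, fun x hx => by simpa [div_self hN'] using h3 x hx, h4⟩

/-- A nowhere vanishing continuous function on a compact convex set has a continuous logarithm. -/
theorem exists_continuousOn_log {D : Set V} (hD : IsCompact D) (hc : Convex ℝ D)
    (hne : D.Nonempty) {g : V → ℂ} (hg : ContinuousOn g D) (hg0 : ∀ x ∈ D, g x ≠ 0) :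
    ∃ G : V → ℂ, ContinuousOn G D ∧ ∀ x ∈ D, Complex.exp (G x) = g x := by
  obtain ⟨x₀, h₀⟩ := hne
  obtain ⟨y, hy, hmin⟩ := hD.exists_isMinOn ⟨x₀, h₀⟩ hg.norm
  -- The tolerance is the minimum of `‖g‖`. Quotients of consecutive values then lie in the unit
  -- ball around `1`, where the principal logarithm is continuous, and these logarithms are added
  -- up.
  obtain ⟨N, hN0, hN⟩ := exists_uniform_subdivision hD hc h₀ hg (norm_pos_iff.2 (hg0 y hy))
  have key : ∀ i ≤ N, ∃ G : V → ℂ, ContinuousOn G D ∧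
      ∀ x ∈ D, Complex.exp (G x) = g (AffineMap.lineMap x₀ x ((i : ℝ) / N)) := by
    intro i
    induction i with
    | zero =>
      exact fun _ => ⟨fun _ => Complex.log (g x₀), continuousOn_const, fun x _ => by
        simp [Complex.exp_log (hg0 x₀ h₀)]⟩
    | succ i ih =>
      intro hi
      obtain ⟨G, hG, hGe⟩ := ih (by omega)
      have hmaps : ∀ j ≤ N, MapsTo (fun x => AffineMap.lineMap x₀ x ((j : ℝ) / N)) D D :=
        fun j hj x hx => lineMap_mem_of_le hc h₀ hx hj
      have hcont : ∀ j ≤ N, ContinuousOn (fun x => g (AffineMap.lineMap x₀ x ((j : ℝ) / N))) D := by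
        intro j hj
        refine hg.comp (Continuous.continuousOn ?_) (hmaps j hj)
        simp only [AffineMap.lineMap_apply_module]
        fun_prop
      refine ⟨fun x => G x + Complex.log (g (AffineMap.lineMap x₀ x (((i + 1 : ℕ) : ℝ) / N)) /
        g (AffineMap.lineMap x₀ x ((i : ℝ) / N))), hG.add ?_, fun x hx => ?_⟩
      · refine ContinuousOn.clog ((hcont _ hi).div (hcont i (by omega))
          fun x hx => hg0 _ (hmaps i (by omega) hx)) fun x hx => ?_
        have h1 : g (AffineMap.lineMap x₀ x ((i : ℝ) / N)) ≠ 0 := hg0 _ (hmaps i (by omega) hx)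
        refine Complex.ball_one_subset_slitPlane ?_
        rw [mem_ball_iff_norm, div_sub_one h1, norm_div, div_lt_one (norm_pos_iff.2 h1)]
        exact (hN x hx i (by omega)).trans_le (hmin (hmaps i (by omega) hx))
      · have h1 := hg0 _ (hmaps i (by omega) hx)
        have h2 := hg0 _ (hmaps _ hi hx)
        simp only at h1 h2
        rw [Complex.exp_add, hGe x hx, Complex.exp_log (div_ne_zero h2 h1), mul_div_cancel₀ _ h1]
  obtain ⟨G, hG, hGe⟩ := key N le_rfl
  have hN' : (N : ℝ) ≠ 0 := by exact_mod_cast hN0.ne'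
  exact ⟨G, hG, fun x hx => by simpa [div_self hN'] using hGe x hx⟩

end Lifts

/-! ### The increment of the logarithm along a path -/

/-- The total increment of a continuous logarithm of a nowhere vanishing function on `[0, 1]`. -/
def logIncr (g : ℝ → ℂ) : ℂ :=
  open Classical in
  if h : ∃ G : ℝ → ℂ, ContinuousOn G (Icc 0 1) ∧ ∀ x ∈ Icc (0 : ℝ) 1, Complex.exp (G x) = g x then
    h.choose 1 - h.choose 0
  else 0

/-- The difference of two logarithms divided by `2πi` is continuous and integer-valued on a
connected interval. This makes `logIncr` independent of the chosen logarithm. -/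
theorem sub_const_of_exp_eq {G₁ G₂ : ℝ → ℂ} (h₁ : ContinuousOn G₁ (Icc 0 1))
    (h₂ : ContinuousOn G₂ (Icc 0 1))
    (h : ∀ x ∈ Icc (0 : ℝ) 1, Complex.exp (G₁ x) = Complex.exp (G₂ x)) :
    G₁ 1 - G₂ 1 = G₁ 0 - G₂ 0 := by
  have hd : IsDiscrete (range fun n : ℤ => (n : ℝ)) :=
    ⟨(Int.isClosedEmbedding_coe_real.isEmbedding.toHomeomorph).symm.isEmbedding.discreteTopology⟩
  choose! n hn using fun x hx => Complex.exp_eq_exp_iff_exists_int.1 (h x hx)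
  have hpi : (2 * Real.pi * Complex.I : ℂ) ≠ 0 := Complex.two_pi_I_ne_zero
  have hF : ContinuousOn (fun x => ((G₁ x - G₂ x) / (2 * Real.pi * Complex.I)).re) (Icc 0 1) :=
    Complex.continuous_re.comp_continuousOn ((h₁.sub h₂).div_const _)
  have hFn : ∀ x ∈ Icc (0 : ℝ) 1, (G₁ x - G₂ x) / (2 * Real.pi * Complex.I) = n x := by
    intro x hx
    rw [hn x hx, add_sub_cancel_left, mul_div_cancel_right₀ _ hpi]
  have := isPreconnected_Icc.constant_of_mapsTo hd hF
    (fun x hx => ⟨n x, by simp [hFn x hx]⟩) (right_mem_Icc.2 zero_le_one)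
    (left_mem_Icc.2 (zero_le_one (α := ℝ)))
  rw [hFn 1 (by simp), hFn 0 (by simp)] at this
  have h3 : n 1 = n 0 := by exact_mod_cast this
  rw [hn 1 (by simp), hn 0 (by simp), h3]
  ring

theorem logIncr_eq {g G : ℝ → ℂ} (hG : ContinuousOn G (Icc 0 1))
    (h : ∀ x ∈ Icc (0 : ℝ) 1, Complex.exp (G x) = g x) : logIncr g = G 1 - G 0 := by
  have hex : ∃ G : ℝ → ℂ, ContinuousOn G (Icc 0 1) ∧
    ∀ x ∈ Icc (0 : ℝ) 1, Complex.exp (G x) = g x := ⟨G, hG, h⟩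
  rw [logIncr, dif_pos hex]
  have := sub_const_of_exp_eq hex.choose_spec.1 hG
    fun x hx => (hex.choose_spec.2 x hx).trans (h x hx).symm
  linear_combination this

theorem logIncr_one {g : ℝ → ℂ} (h : ∀ x ∈ Icc (0 : ℝ) 1, g x = 1) : logIncr g = 0 := by
  rw [logIncr_eq (G := fun _ => 0) continuousOn_const fun x hx => by simp [h x hx], sub_self]

theorem logIncr_mul {g g₁ g₂ : ℝ → ℂ} (h₁ : ContinuousOn g₁ (Icc 0 1))
    (h₂ : ContinuousOn g₂ (Icc 0 1)) (h₁0 : ∀ x ∈ Icc (0 : ℝ) 1, g₁ x ≠ 0)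
    (h₂0 : ∀ x ∈ Icc (0 : ℝ) 1, g₂ x ≠ 0) (h : ∀ x ∈ Icc (0 : ℝ) 1, g x = g₁ x * g₂ x) :
    logIncr g = logIncr g₁ + logIncr g₂ := by
  have hne : (Icc (0 : ℝ) 1).Nonempty := nonempty_Icc.2 zero_le_one
  obtain ⟨G₁, hG₁, he₁⟩ := exists_continuousOn_log isCompact_Icc (convex_Icc _ _) hne h₁ h₁0
  obtain ⟨G₂, hG₂, he₂⟩ := exists_continuousOn_log isCompact_Icc (convex_Icc _ _) hne h₂ h₂0
  rw [logIncr_eq hG₁ he₁, logIncr_eq hG₂ he₂, logIncr_eq (hG₁.add hG₂)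
    fun x hx => by simp [Complex.exp_add, he₁ x hx, he₂ x hx, h x hx]]
  simp only [Pi.add_apply]
  ring

/-- The logarithmic increment of a differentiable function is the integral of its logarithmic
derivative. -/
theorem logIncr_eq_integral {g : ℝ → ℂ} (hg : ContDiffOn ℝ 1 g (Icc 0 1))
    (h0 : ∀ x ∈ Icc (0 : ℝ) 1, g x ≠ 0) :
    logIncr g = ∫ x in (0 : ℝ)..1, derivWithin g (Icc 0 1) x / g x := by
  have hne : (Icc (0 : ℝ) 1).Nonempty := nonempty_Icc.2 zero_le_one
  obtain ⟨G, hG, he⟩ := exists_continuousOn_log isCompact_Icc (convex_Icc _ _) hne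
    hg.continuousOn h0
  rw [logIncr_eq hG he]
  symm
  have hq : ContinuousOn (fun x => derivWithin g (Icc 0 1) x / g x) (Icc 0 1) :=
    (hg.continuousOn_derivWithin (uniqueDiffOn_Icc zero_lt_one) le_rfl).div hg.continuousOn h0
  refine intervalIntegral.integral_eq_sub_of_hasDerivAt_of_le zero_le_one hG (fun x hx => ?_)
    (hq.intervalIntegrable_of_Icc zero_le_one)
  have hx' := Ioo_subset_Icc_self hx
  have hnhds : Icc (0 : ℝ) 1 ∈ 𝓝 x := Icc_mem_nhds hx.1 hx.2
  have hgd : HasDerivAt g (derivWithin g (Icc 0 1) x) x := by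
    rw [derivWithin_of_mem_nhds hnhds]
    exact ((hg.differentiableOn one_ne_zero x hx').differentiableAt hnhds).hasDerivAt
  have hexp : HasFDerivAt (𝕜 := ℝ) Complex.exp
      (ContinuousLinearMap.mul ℝ ℂ (Complex.exp (G x))) (G x) := by
    refine ((Complex.hasDerivAt_exp (G x)).hasFDerivAt.restrictScalars ℝ).congr_fderiv ?_
    ext w
    simp [mul_comm]
  -- A logarithm that is merely continuous is automatically differentiable, because the derivative
  -- of the exponential is invertible.
  have h := HasFDerivAt.of_comp_of_leftInverse (f'symm := ContinuousLinearMap.mul ℝ ℂ (g x)⁻¹)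
    (hG.continuousAt hnhds) hexp hgd.hasFDerivAt
    (Filter.mem_of_superset hnhds fun y hy => he y hy) fun y => by
      simp [he x hx', h0 x hx']
  convert h.hasDerivAt using 1
  simp [div_eq_inv_mul]

/-! ### Stokes' theorem on the triangle -/

theorem openTriangle_subset_closedTriangle : openTriangle ⊆ closedTriangle :=
  fun _ h => ⟨h.1.le, h.2.1.le, h.2.2.le⟩

theorem isOpen_openTriangle : IsOpen openTriangle :=
  (isOpen_lt continuous_const continuous_fst).inter
    ((isOpen_lt continuous_const continuous_snd).inter
      (isOpen_lt (continuous_fst.add continuous_snd) continuous_const))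

theorem isCompact_closedTriangle : IsCompact closedTriangle := by
  have hcl : IsClosed closedTriangle :=
    (isClosed_le continuous_const continuous_fst).inter
      ((isClosed_le continuous_const continuous_snd).inter
        (isClosed_le (continuous_fst.add continuous_snd) continuous_const))
  refine (isCompact_Icc (a := ((0 : ℝ), (0 : ℝ))) (b := (1, 1))).of_isClosed_subset hcl ?_
  rintro ⟨x, y⟩ ⟨h1, h2, h3⟩
  simp only at h1 h2 h3
  exact ⟨⟨h1, h2⟩, ⟨by simp only; linarith, by simp only; linarith⟩⟩

theorem convex_closedTriangle : Convex ℝ closedTriangle := by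
  rintro ⟨x, y⟩ ⟨h1, h2, h3⟩ ⟨x', y'⟩ ⟨h1', h2', h3'⟩ a b ha hb hab
  simp only at h1 h2 h3 h1' h2' h3'
  simp only [closedTriangle, Prod.smul_mk, smul_eq_mul, Prod.mk_add_mk, mem_ofPred_eq]
  refine ⟨by positivity, by positivity, ?_⟩
  nlinarith

theorem mem_nhds_closedTriangle {y : ℝ × ℝ} (h : y ∈ openTriangle) : closedTriangle ∈ 𝓝 y :=
  Filter.mem_of_superset (isOpen_openTriangle.mem_nhds h) openTriangle_subset_closedTriangle

theorem uniqueDiffOn_closedTriangle : UniqueDiffOn ℝ closedTriangle := by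
  refine uniqueDiffOn_convex convex_closedTriangle ⟨(1 / 4, 1 / 4), ?_⟩
  refine mem_interior_iff_mem_nhds.2 (mem_nhds_closedTriangle ?_)
  norm_num [openTriangle]

theorem integrableOn_openTriangle {F : ℝ × ℝ → ℝ} (h : ContinuousOn F closedTriangle) :
    IntegrableOn F openTriangle :=
  (h.integrableOn_compact isCompact_closedTriangle).mono_set openTriangle_subset_closedTriangle

theorem integral_openTriangle {F : ℝ × ℝ → ℝ} (h : IntegrableOn F openTriangle) :
    ∫ y in openTriangle, F y = ∫ s in Ioo (0 : ℝ) 1, ∫ t in Ioo (0 : ℝ) (1 - s), F (s, t) := by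
  have hm := isOpen_openTriangle.measurableSet
  rw [← integral_indicator hm, Measure.volume_eq_prod, integral_prod _ (by
    rw [← Measure.volume_eq_prod]; exact h.integrable_indicator hm),
    ← integral_indicator measurableSet_Ioo]
  congr 1
  ext s
  by_cases hs : s ∈ Ioo (0 : ℝ) 1
  · rw [indicator_of_mem hs, ← integral_indicator measurableSet_Ioo]
    congr 1
    ext t
    have : (s, t) ∈ openTriangle ↔ t ∈ Ioo 0 (1 - s) := by
      simp only [openTriangle, mem_ofPred_eq, mem_Ioo, hs.1, true_and, lt_sub_iff_add_lt']
    by_cases ht : t ∈ Ioo 0 (1 - s)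
    · rw [indicator_of_mem ht, indicator_of_mem (this.2 ht)]
    · rw [indicator_of_notMem ht, indicator_of_notMem fun h => ht (this.1 h)]
  · rw [indicator_of_notMem hs]
    have : ∀ t, openTriangle.indicator F (s, t) = 0 := fun t =>
      indicator_of_notMem (fun h => hs ⟨h.1, by linarith [h.2.1, h.2.2]⟩) _
    simp [this]

/-- Fubini and the fundamental theorem of calculus on vertical segments. Integrability comes from
`fderivWithin`, which is continuous up to the boundary and agrees with `fderiv` inside. -/
theorem integral_fderiv_snd_openTriangle {a : ℝ × ℝ → ℝ} (ha : ContDiffOn ℝ 1 a closedTriangle) :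
    IntegrableOn (fun y => fderiv ℝ a y (0, 1)) openTriangle ∧
      ∫ y in openTriangle, fderiv ℝ a y (0, 1) =
        ∫ s in (0 : ℝ)..1, (a (s, 1 - s) - a (s, 0)) := by
  have hcont : ContinuousOn (fun y => fderivWithin ℝ a closedTriangle y (0, 1)) closedTriangle :=
    (ha.continuousOn_fderivWithin uniqueDiffOn_closedTriangle le_rfl).clm_apply continuousOn_const
  have heq : EqOn (fun y => fderivWithin ℝ a closedTriangle y (0, 1))
      (fun y => fderiv ℝ a y (0, 1)) openTriangle := fun y hy => by
    simp only [fderivWithin_of_mem_nhds (mem_nhds_closedTriangle hy)]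
  have hint := (integrableOn_openTriangle hcont).congr_fun heq isOpen_openTriangle.measurableSet
  refine ⟨hint, ?_⟩
  rw [integral_openTriangle hint, intervalIntegral.integral_of_le zero_le_one,
    integral_Ioc_eq_integral_Ioo]
  refine setIntegral_congr_fun measurableSet_Ioo fun s hs => ?_
  have hline : Continuous fun t : ℝ => (s, t) := by fun_prop
  have hmaps : MapsTo (fun t : ℝ => (s, t)) (Icc 0 (1 - s)) closedTriangle := fun t ht =>
    ⟨hs.1.le, ht.1, by simp only; linarith [ht.2]⟩
  have hmaps' : MapsTo (fun t : ℝ => (s, t)) (Ioo 0 (1 - s)) openTriangle := fun t ht =>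
    ⟨hs.1, ht.1, by simp only; linarith [ht.2]⟩
  have hle : (0 : ℝ) ≤ 1 - s := by linarith [hs.2]
  have hint' : IntervalIntegrable (fun t => fderivWithin ℝ a closedTriangle (s, t) (0, 1))
      volume 0 (1 - s) :=
    (hcont.comp hline.continuousOn hmaps).intervalIntegrable_of_Icc hle
  have hftc := intervalIntegral.integral_eq_sub_of_hasDerivAt_of_le hle
    (ha.continuousOn.comp hline.continuousOn hmaps) (f' := fun t =>
      fderivWithin ℝ a closedTriangle (s, t) (0, 1)) (fun t ht => by
        have h1 := hmaps' ht
        have h2 := ((ha.differentiableOn one_ne_zero _ (openTriangle_subset_closedTriangle h1)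
          ).differentiableAt (mem_nhds_closedTriangle h1)).hasFDerivAt
        rw [fderivWithin_of_mem_nhds (mem_nhds_closedTriangle h1)]
        exact h2.comp_hasDerivAt t ((hasDerivAt_const t s).prodMk (hasDerivAt_id t))) hint'
  simp only [Function.comp_def] at hftc
  rw [← hftc, intervalIntegral.integral_of_le hle, integral_Ioc_eq_integral_Ioo]
  exact setIntegral_congr_fun measurableSet_Ioo fun t ht => (heq (hmaps' ht)).symm

theorem swap_mem_closedTriangle {y : ℝ × ℝ} : y.swap ∈ closedTriangle ↔ y ∈ closedTriangle := by
  simp only [closedTriangle, mem_ofPred_eq, Prod.fst_swap, Prod.snd_swap, add_comm y.2]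
  tauto

theorem integral_fderiv_fst_openTriangle {a : ℝ × ℝ → ℝ} (ha : ContDiffOn ℝ 1 a closedTriangle) :
    IntegrableOn (fun y => fderiv ℝ a y (1, 0)) openTriangle ∧
      ∫ y in openTriangle, fderiv ℝ a y (1, 0) =
        ∫ t in (0 : ℝ)..1, (a (1 - t, t) - a (0, t)) := by
  let e : (ℝ × ℝ) ≃L[ℝ] (ℝ × ℝ) := ContinuousLinearEquiv.prodComm ℝ ℝ ℝ
  have hs : ContDiffOn ℝ 1 (a ∘ e) closedTriangle :=
    ha.comp e.contDiff.contDiffOn fun y hy => swap_mem_closedTriangle.2 hy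
  obtain ⟨h1, h2⟩ := integral_fderiv_snd_openTriangle hs
  have hd : ∀ y, fderiv ℝ (a ∘ e) y (0, 1) = fderiv ℝ a y.swap (1, 0) := fun y => by
    rw [e.comp_right_fderiv]
    rfl
  simp_rw [hd] at h1 h2
  have hmp : MeasurePreserving (Prod.swap : ℝ × ℝ → ℝ × ℝ) volume volume :=
    Measure.measurePreserving_swap
  have hemb : MeasurableEmbedding (Prod.swap : ℝ × ℝ → ℝ × ℝ) :=
    MeasurableEquiv.prodComm.measurableEmbedding
  have hpre : (Prod.swap : ℝ × ℝ → ℝ × ℝ) ⁻¹' openTriangle = openTriangle := by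
    ext y
    simp only [openTriangle, mem_preimage, mem_ofPred_eq, Prod.fst_swap, Prod.snd_swap,
      add_comm y.2]
    tauto
  constructor
  · have := (hmp.integrableOn_comp_preimage hemb (f := fun y => fderiv ℝ a y (1, 0))
      (s := openTriangle)).1
    rw [hpre] at this
    exact this h1
  · have := hmp.setIntegral_preimage_emb hemb (fun y => fderiv ℝ a y (1, 0)) openTriangle
    rw [hpre] at this
    rw [← this, h2]
    rfl

section Forms

variable {E : Type*} [NormedAddCommGroup E] [NormedSpace ℝ E]

/-- The integral of a one-form along a path which is parametrised by `[0, 1]`. -/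
def pathIntegral (A : E → E →L[ℝ] ℝ) (γ : ℝ → E) : ℝ :=
  ∫ t in (0 : ℝ)..1, A (γ t) (derivWithin γ (Icc 0 1) t)

/-- The exterior derivative of a one-form. -/
def formDeriv (A : E → E →L[ℝ] ℝ) (z X Y : E) : ℝ :=
  fderiv ℝ A z X Y - fderiv ℝ A z Y X

theorem pathIntegral_congr {A B : E → E →L[ℝ] ℝ} {γ δ : ℝ → E} (hγ : EqOn γ δ (Icc 0 1))
    (h : ∀ t ∈ Icc (0 : ℝ) 1, A (δ t) (derivWithin δ (Icc 0 1) t) =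
      B (δ t) (derivWithin δ (Icc 0 1) t)) : pathIntegral A γ = pathIntegral B δ := by
  refine intervalIntegral.integral_congr fun t ht => ?_
  rw [uIcc_of_le zero_le_one] at ht
  rw [derivWithin_congr hγ (hγ ht), hγ ht, h t ht]

theorem pathIntegral_line {A : E → E →L[ℝ] ℝ} {z : ℝ × ℝ → E}
    (hz : ContDiffOn ℝ ∞ z closedTriangle) {l : ℝ → ℝ × ℝ} {v : ℝ × ℝ}
    (hl : ∀ t, HasDerivAt l v t) (hmaps : MapsTo l (Icc 0 1) closedTriangle) :
    pathIntegral A (fun t => z (l t)) =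
      ∫ t in (0 : ℝ)..1, A (z (l t)) (fderivWithin ℝ z closedTriangle (l t) v) := by
  refine intervalIntegral.integral_congr fun t ht => ?_
  rw [uIcc_of_le zero_le_one] at ht
  have h := ((hz.differentiableOn (by simp) _ (hmaps ht)).hasFDerivWithinAt).comp_hasDerivWithinAt
    t (hl t).hasDerivWithinAt hmaps
  simp only
  rw [← h.derivWithin (uniqueDiffOn_Icc zero_lt_one t ht)]
  rfl

/-- Stokes' theorem for the pull-back of a one-form to the triangle. -/
theorem integral_formDeriv {A : E → E →L[ℝ] ℝ} {z : ℝ × ℝ → E}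
    (hz : ContDiffOn ℝ ∞ z closedTriangle) (hA : ∀ y ∈ closedTriangle, ContDiffAt ℝ ∞ A (z y)) :
    IntegrableOn (fun y => formDeriv A (z y) (fderiv ℝ z y (1, 0)) (fderiv ℝ z y (0, 1)))
        openTriangle ∧
      ∫ y in openTriangle, formDeriv A (z y) (fderiv ℝ z y (1, 0)) (fderiv ℝ z y (0, 1)) =
        pathIntegral A (fun t => z (1 - t, t)) - pathIntegral A (fun t => z (0, t)) +
          pathIntegral A (fun t => z (t, 0)) := by
  have hAz : ContDiffOn ℝ ∞ (fun y => A (z y)) closedTriangle := fun y hy =>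
    (hA y hy).comp_contDiffWithinAt y (hz y hy)
  have hdz : ContDiffOn ℝ ∞ (fderivWithin ℝ z closedTriangle) closedTriangle :=
    hz.fderivWithin uniqueDiffOn_closedTriangle (by simp)
  have ha : ∀ v : ℝ × ℝ, ContDiffOn ℝ ∞
      (fun y => A (z y) (fderivWithin ℝ z closedTriangle y v)) closedTriangle := fun v =>
    hAz.clm_apply (hdz.clm_apply contDiffOn_const)
  have hone : (1 : ℕ∞ω) ≤ (∞ : ℕ∞ω) := by norm_cast
  obtain ⟨hi₁, he₁⟩ := integral_fderiv_fst_openTriangle ((ha (0, 1)).of_le hone)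
  obtain ⟨hi₂, he₂⟩ := integral_fderiv_snd_openTriangle ((ha (1, 0)).of_le hone)
  -- The pulled-back two-form is `∂₁(A(∂₂z)) - ∂₂(A(∂₁z))`: the terms with second derivatives of `z`
  -- cancel by symmetry. The coefficients use `fderivWithin` so that they are smooth on the closed
  -- triangle.
  have hpt : EqOn (fun y => fderiv ℝ
        (fun y => A (z y) (fderivWithin ℝ z closedTriangle y (0, 1))) y (1, 0) -
      fderiv ℝ (fun y => A (z y) (fderivWithin ℝ z closedTriangle y (1, 0))) y (0, 1))
      (fun y => formDeriv A (z y) (fderiv ℝ z y (1, 0)) (fderiv ℝ z y (0, 1))) openTriangle := by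
    intro y hy
    have hn := mem_nhds_closedTriangle hy
    have hzy : ContDiffAt ℝ ∞ z y := (hz y (openTriangle_subset_closedTriangle hy)).contDiffAt hn
    have hz1 : HasFDerivAt z (fderiv ℝ z y) y := (hzy.differentiableAt (by simp)).hasFDerivAt
    have hA1 : HasFDerivAt (fun y => A (z y)) _ y :=
      ((hA y (openTriangle_subset_closedTriangle hy)).differentiableAt
        (by simp)).hasFDerivAt.comp y hz1
    have hz2 : HasFDerivAt (fderiv ℝ z) (fderiv ℝ (fderiv ℝ z) y) y :=
      ((hzy.fderiv_right (m := 1) (by norm_cast)).differentiableAt one_ne_zero).hasFDerivAt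
    have hev : fderivWithin ℝ z closedTriangle =ᶠ[𝓝 y] fderiv ℝ z :=
      Filter.mem_of_superset (isOpen_openTriangle.mem_nhds hy) fun x hx =>
        fderivWithin_of_mem_nhds (mem_nhds_closedTriangle hx)
    have hsymm : ∀ v w, fderiv ℝ (fderiv ℝ z) y v w = fderiv ℝ (fderiv ℝ z) y w v :=
      hzy.isSymmSndFDerivAt (by simp; norm_cast)
    have hd : ∀ v w, fderiv ℝ (fun y => A (z y) (fderivWithin ℝ z closedTriangle y v)) y w =
        fderiv ℝ A (z y) (fderiv ℝ z y w) (fderiv ℝ z y v) +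
          A (z y) (fderiv ℝ (fderiv ℝ z) y w v) := fun v w => by
      have h1 := hA1.clm_apply ((hz2.congr_of_eventuallyEq hev).clm_apply (hasFDerivAt_const v y))
      rw [HasFDerivAt.fderiv h1]
      simp [hev.eq_of_nhds, add_comm]
    simp only [hd, formDeriv]
    rw [hsymm (0, 1) (1, 0)]
    ring
  refine ⟨(hi₁.sub hi₂).congr_fun hpt isOpen_openTriangle.measurableSet, ?_⟩
  rw [← setIntegral_congr_fun isOpen_openTriangle.measurableSet hpt, integral_sub hi₁ hi₂, he₁,
    he₂]
  have m₀ : MapsTo (fun t : ℝ => (1 - t, t)) (Icc 0 1) closedTriangle := fun t ht =>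
    ⟨by simp only; linarith [ht.2], ht.1, by simp⟩
  have m₀' : MapsTo (fun t : ℝ => (t, 1 - t)) (Icc 0 1) closedTriangle := fun t ht =>
    ⟨ht.1, by simp only; linarith [ht.2], by simp⟩
  have m₁ : MapsTo (fun t : ℝ => ((0 : ℝ), t)) (Icc 0 1) closedTriangle := fun t ht =>
    ⟨le_rfl, ht.1, by simpa using ht.2⟩
  have m₂ : MapsTo (fun t : ℝ => (t, (0 : ℝ))) (Icc 0 1) closedTriangle := fun t ht =>
    ⟨ht.1, le_rfl, by simpa using ht.2⟩
  have l₀ : ∀ t : ℝ, HasDerivAt (fun t : ℝ => (1 - t, t)) ((-1 : ℝ), (1 : ℝ)) t := fun t =>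
    ((hasDerivAt_id t).const_sub 1).prodMk (hasDerivAt_id t)
  have l₁ : ∀ t : ℝ, HasDerivAt (fun t : ℝ => ((0 : ℝ), t)) ((0 : ℝ), (1 : ℝ)) t := fun t =>
    (hasDerivAt_const t 0).prodMk (hasDerivAt_id t)
  have l₂ : ∀ t : ℝ, HasDerivAt (fun t : ℝ => (t, (0 : ℝ))) ((1 : ℝ), (0 : ℝ)) t := fun t =>
    (hasDerivAt_id t).prodMk (hasDerivAt_const t 0)
  rw [pathIntegral_line hz l₀ m₀, pathIntegral_line hz l₁ m₁, pathIntegral_line hz l₂ m₂]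
  have hI : ∀ {l : ℝ → ℝ × ℝ} (v : ℝ × ℝ), Continuous l → MapsTo l (Icc 0 1) closedTriangle →
      IntervalIntegrable (fun t => A (z (l t)) (fderivWithin ℝ z closedTriangle (l t) v))
        volume 0 1 := fun v hl hm =>
    ((ha v).continuousOn.comp hl.continuousOn hm).intervalIntegrable_of_Icc zero_le_one
  have c₀ : Continuous fun t : ℝ => (1 - t, t) := by fun_prop
  have c₀' : Continuous fun t : ℝ => (t, 1 - t) := by fun_prop
  have c₁ : Continuous fun t : ℝ => ((0 : ℝ), t) := by fun_prop
  have c₂ : Continuous fun t : ℝ => (t, (0 : ℝ)) := by fun_prop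
  rw [intervalIntegral.integral_sub (hI _ c₀ m₀) (hI _ c₁ m₁),
    intervalIntegral.integral_sub (hI _ c₀' m₀') (hI _ c₂ m₂)]
  -- The two coordinate integrals traverse the hypotenuse in opposite directions; reversing one of
  -- them combines both into a single path integral.
  have hsub := intervalIntegral.integral_comp_sub_left (a := 0) (b := 1)
    (fun t : ℝ => A (z (1 - t, t)) (fderivWithin ℝ z closedTriangle (1 - t, t) (1, 0))) 1
  simp only [sub_sub_cancel, sub_self, sub_zero] at hsub
  have hsplit : ∀ t : ℝ, A (z (1 - t, t)) (fderivWithin ℝ z closedTriangle (1 - t, t) (-1, 1)) =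
      A (z (1 - t, t)) (fderivWithin ℝ z closedTriangle (1 - t, t) (0, 1)) -
        A (z (1 - t, t)) (fderivWithin ℝ z closedTriangle (1 - t, t) (1, 0)) := fun t => by
    rw [← map_sub, ← map_sub]
    norm_num
  simp_rw [hsplit]
  rw [intervalIntegral.integral_sub (hI _ c₀ m₀) (hI _ c₀ m₀), hsub]
  ring

end Forms

/-! ### Functions on a knot -/

namespace Knot

variable (k : Knot)

/-- The unit tangent vector of a knot. -/
def tangent (t : ℝ) : R4 := deriv k.toFun t

theorem contDiff_tangent : ContDiff ℝ ∞ k.tangent :=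
  ((contDiff_infty_iff_deriv).1 k.smooth).2

theorem hasDerivAt (t : ℝ) : HasDerivAt k.toFun (k.tangent t) t :=
  (k.smooth.differentiable (by simp) t).hasDerivAt

theorem periodic_tangent : Function.Periodic k.tangent k.length := fun t => by
  have : (fun s => k.toFun (s + k.length)) = k.toFun := funext k.periodic
  rw [tangent, ← deriv_comp_add_const, this, tangent]

theorem norm_tangent (t : ℝ) : ‖k.tangent t‖ = 1 := k.unit_speed t

theorem inner_tangent (t : ℝ) : inner ℝ (k.toFun t) (k.tangent t) = 0 := by
  have h := (k.hasDerivAt t).inner ℝ (k.hasDerivAt t)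
  have h1 : (fun t => inner ℝ (k.toFun t) (k.toFun t)) = fun _ => (1 : ℝ) := by
    ext s
    rw [real_inner_self_eq_norm_sq, k.on_sphere, one_pow]
  rw [h1] at h
  have h2 := h.unique (hasDerivAt_const t 1)
  rw [real_inner_comm (k.toFun t)] at h2
  linarith

theorem exists_int_of_eq {s t : ℝ} (h : k.toFun s = k.toFun t) :
    ∃ n : ℤ, s = t + n * k.length := by
  have key : ∀ r, k.toFun (toIcoMod k.length_pos 0 r) = k.toFun r := fun r => by
    rw [← self_sub_toIcoDiv_zsmul, k.periodic.sub_zsmul_eq]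
  have hm : ∀ r, toIcoMod k.length_pos 0 r ∈ Ico 0 k.length := fun r => by
    simpa using toIcoMod_mem_Ico k.length_pos 0 r
  have h1 := k.injective (hm s) (hm t) (by rw [key, key, h])
  rw [← self_sub_toIcoDiv_zsmul, ← self_sub_toIcoDiv_zsmul] at h1
  refine ⟨toIcoDiv k.length_pos 0 s - toIcoDiv k.length_pos 0 t, ?_⟩
  simp only [zsmul_eq_mul] at h1
  push_cast
  linarith

theorem range_eq_image (a : ℝ) : range k.toFun = k.toFun '' Icc a (a + k.length) := by
  refine Subset.antisymm ?_ (image_subset_range _ _)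
  rintro _ ⟨t, rfl⟩
  obtain ⟨s, hs, h⟩ := k.periodic.exists_mem_Ico k.length_pos t a
  exact ⟨s, Ico_subset_Icc_self hs, h.symm⟩

theorem isClosed_range : IsClosed (range k.toFun) := by
  rw [k.range_eq_image 0]
  exact (isCompact_Icc.image k.smooth.continuous).isClosed

/-- Near a point of a knot, the knot consists of a single strand. -/
theorem eventually_mem_strand {t₀ : ℝ} {U : Set ℝ} (hU : U ∈ 𝓝 t₀) :
    ∀ᶠ y in 𝓝 (k.toFun t₀), ∀ s, k.toFun s = y → ∃ n : ℤ, s + n * k.length ∈ U := by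
  obtain ⟨O, hOU, hO, ht₀⟩ := mem_nhds_iff.1 hU
  -- One period centred at `t₀`, without the neighbourhood `O`. Its image is closed and misses
  -- `k(t₀)`, because two parameters of the same point differ by a multiple of the period.
  have hK : IsCompact (Icc (t₀ - k.length / 2) (t₀ - k.length / 2 + k.length) \ O) :=
    isCompact_Icc.diff hO
  have hnot : k.toFun t₀ ∉ k.toFun '' (Icc (t₀ - k.length / 2) (t₀ - k.length / 2 + k.length) \ O)
      := by
    rintro ⟨s, ⟨hs, hsO⟩, h⟩
    obtain ⟨n, hn⟩ := k.exists_int_of_eq h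
    have hl := k.length_pos
    have h0 : n = 0 := by
      have h1 : -(1 : ℝ) < n := by
        by_contra! hc
        nlinarith [hs.1]
      have h2 : (n : ℝ) < 1 := by
        by_contra! hc
        nlinarith [hs.2]
      have h1' : (-1 : ℤ) < n := by exact_mod_cast h1
      have h2' : n < (1 : ℤ) := by exact_mod_cast h2
      omega
    rw [h0, Int.cast_zero, zero_mul, add_zero] at hn
    exact hsO (hn ▸ ht₀)
  filter_upwards [(hK.image k.smooth.continuous).isClosed.isOpen_compl.mem_nhds hnot] with y hy s hs
  refine ⟨-toIcoDiv k.length_pos (t₀ - k.length / 2) s, hOU ?_⟩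
  by_contra hc
  refine hy ⟨_, ⟨?_, hc⟩, ?_⟩
  · have h1 := toIcoMod_mem_Ico k.length_pos (t₀ - k.length / 2) s
    rw [← self_sub_toIcoDiv_zsmul, zsmul_eq_mul, sub_eq_add_neg s, ← neg_mul] at h1
    push_cast
    exact Ico_subset_Icc_self h1
  · have h1 := k.periodic.sub_zsmul_eq (x := s) (toIcoDiv k.length_pos (t₀ - k.length / 2) s)
    rw [zsmul_eq_mul, sub_eq_add_neg s, ← neg_mul] at h1
    push_cast
    rw [h1, hs]

theorem periodic_add_int {F : Type*} {h : ℝ → F} {l : ℝ} (hp : Function.Periodic h l) (t : ℝ)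
    (n : ℤ) : h (t + n * l) = h t := by
  simpa using hp.int_mul n t

/-- A smooth function on a knot extends to a smooth function on four-space. -/
theorem exists_extension {F : Type*} [NormedAddCommGroup F] [NormedSpace ℝ F]
    {h : ℝ → F} (hs : ContDiff ℝ ∞ h) (hp : Function.Periodic h k.length) :
    ∃ H : R4 → F, ContDiff ℝ ∞ H ∧ ∀ t, H (k.toFun t) = h t := by
  -- The admissible values at a point form a single point on the knot and the whole space off it.
  -- These sets are convex, so a partition of unity glues local extensions.
  have hconv : ∀ y : R4, Convex ℝ {v : F | ∀ s, k.toFun s = y → v = h s} := by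
    intro y v hv w hw a b _ _ hab s hsy
    rw [hv s hsy, hw s hsy, ← add_smul, hab, one_smul]
  suffices hloc : ∀ y : R4, ∃ U ∈ 𝓝 y, ∃ g : R4 → F, ContMDiffOn 𝓘(ℝ, R4) 𝓘(ℝ, F) ∞ g U ∧
      ∀ x ∈ U, g x ∈ {v : F | ∀ s, k.toFun s = x → v = h s} by
    obtain ⟨g, hg⟩ := exists_contMDiffMap_forall_mem_convex_of_local (n := ⊤) 𝓘(ℝ, R4) hconv hloc
    exact ⟨g, g.contMDiff.contDiff, fun t => hg _ t rfl⟩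
  · intro y
    by_cases hy : y ∈ range k.toFun
    · obtain ⟨t₀, rfl⟩ := hy
      -- The height in the direction of `k'(t₀)` has derivative `1` at `t₀`. Its local inverse
      -- recovers the parameter and is defined on nearby points off the knot as well.
      let φ : ℝ → ℝ := fun s => inner ℝ (k.tangent t₀) (k.toFun s)
      have hφ : ContDiff ℝ ∞ φ := contDiff_const.inner ℝ k.smooth
      have hφ' : ∀ s, HasDerivAt φ (inner ℝ (k.tangent t₀) (k.tangent s)) s := fun s => by
        simpa using (hasDerivAt_const s (k.tangent t₀)).inner ℝ (k.hasDerivAt s)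
      have h1 : inner ℝ (k.tangent t₀) (k.tangent t₀) = (1 : ℝ) := by
        rw [real_inner_self_eq_norm_sq, k.norm_tangent, one_pow]
      have hφt : HasFDerivAt φ ((ContinuousLinearEquiv.refl ℝ ℝ : ℝ ≃L[ℝ] ℝ) : ℝ →L[ℝ] ℝ) t₀ := by
        refine (hφ' t₀).hasFDerivAt.congr_fderiv ?_
        ext
        simp [k.norm_tangent]
      let e := hφ.contDiffAt.toOpenPartialHomeomorph φ hφt (by simp)
      have he : ∀ s, e s = φ s := fun _ => rfl
      have hcontt : Continuous k.tangent := k.contDiff_tangent.continuous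
      let N : Set ℝ := {s | inner ℝ (k.tangent t₀) (k.tangent s) ≠ (0 : ℝ)}
      have hN : IsOpen N := isOpen_ne_fun (continuous_const.inner hcontt) continuous_const
      have ht₀ : t₀ ∈ e.source := hφ.contDiffAt.mem_toOpenPartialHomeomorph_source hφt (by simp)
      let T : Set ℝ := e.target ∩ e.symm ⁻¹' N
      have hT : IsOpen T := e.isOpen_inter_preimage_symm hN
      have hTt : φ t₀ ∈ T := by
        refine ⟨e.map_source ht₀, ?_⟩
        change e.symm (e t₀) ∈ N
        rw [e.left_inv ht₀]
        exact ne_of_eq_of_ne h1 one_ne_zero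
      have hlin : Continuous fun y : R4 => inner ℝ (k.tangent t₀) y :=
        continuous_const.inner continuous_id
      have hstrand := k.eventually_mem_strand (e.open_source.mem_nhds ht₀)
      have hTn : (fun y : R4 => inner ℝ (k.tangent t₀) y) ⁻¹' T ∈ 𝓝 (k.toFun t₀) :=
        (hT.preimage hlin).mem_nhds hTt
      refine ⟨_, Filter.inter_mem hstrand hTn,
        fun y => h (e.symm (inner ℝ (k.tangent t₀) y)), ?_, ?_⟩
      · refine ContDiffOn.contMDiffOn fun y hy => ContDiffAt.contDiffWithinAt ?_
        have h2 : ContDiffAt ℝ ∞ e.symm (inner ℝ (k.tangent t₀) y) :=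
          e.contDiffAt_symm_deriv hy.2.2 hy.2.1 (hφ' _) hφ.contDiffAt
        exact hs.contDiffAt.comp y (h2.comp y (contDiffAt_const.inner ℝ contDiffAt_id))
      · intro y hy s hsy
        obtain ⟨n, hn⟩ := hy.1 s hsy
        have h3 : inner ℝ (k.tangent t₀) y = e (s + n * k.length) := by
          rw [he, ← hsy]
          change _ = inner ℝ (k.tangent t₀) (k.toFun (s + n * k.length))
          rw [periodic_add_int k.periodic]
        simp only [h3, e.left_inv hn, periodic_add_int hp]
    · exact ⟨_, k.isClosed_range.isOpen_compl.mem_nhds hy, fun _ => 0, contMDiffOn_const,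
        fun y hy s hsy => absurd ⟨s, hsy⟩ hy⟩

/-- The angular coordinate of a knot as a complex number of norm one. -/
def angle (t : ℝ) : ℂ := Complex.exp ((2 * Real.pi / k.length * t : ℝ) * Complex.I)

theorem contDiff_angle : ContDiff ℝ ∞ k.angle := by
  have h1 : ContDiff ℝ ∞ (fun t : ℝ => ((2 * Real.pi / k.length * t : ℝ) : ℂ)) :=
    Complex.ofRealCLM.contDiff.comp (contDiff_const.mul contDiff_id)
  exact (h1.mul contDiff_const).cexp

theorem angle_ne_zero (t : ℝ) : k.angle t ≠ 0 := Complex.exp_ne_zero _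

theorem periodic_angle : Function.Periodic k.angle k.length := fun t => by
  have hl := k.length_pos.ne'
  rw [angle, angle, Complex.exp_eq_exp_iff_exists_int]
  refine ⟨1, ?_⟩
  have hl' : (k.length : ℂ) ≠ 0 := by exact_mod_cast hl
  push_cast
  field_simp

theorem hasDerivAt_angle (t : ℝ) :
    HasDerivAt k.angle ((2 * Real.pi / k.length : ℝ) * Complex.I * k.angle t) t := by
  have h1 : HasDerivAt (fun t : ℝ => ((2 * Real.pi / k.length * t : ℝ) : ℂ) * Complex.I)
      ((2 * Real.pi / k.length : ℝ) * Complex.I) t := by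
    have := ((hasDerivAt_id t).const_mul (2 * Real.pi / k.length)).ofReal_comp
    simpa using this.mul_const Complex.I
  have h2 := h1.cexp
  rw [mul_comm (Complex.exp _)] at h2
  exact h2

/-- A differentiable path in the image of a knot is tangent to the knot. -/
theorem exists_smul_tangent {x : ℝ → R4} {x' : R4} {s : Set ℝ} {τ t₀ : ℝ}
    (hx : HasDerivWithinAt x x' s τ) (hs : UniqueDiffWithinAt ℝ s τ)
    (hmem : ∀ r ∈ s, x r ∈ range k.toFun) (hτ : τ ∈ s)
    (h₀ : x τ = k.toFun t₀) : ∃ c : ℝ, x' = c • k.tangent t₀ := by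
  obtain ⟨G, hG, hGk⟩ := k.exists_extension k.contDiff_angle k.periodic_angle
  have hl : (2 * Real.pi / k.length : ℝ) ≠ 0 :=
    div_ne_zero (by positivity) k.length_pos.ne'
  let q : ℝ → ℂ := fun r => G (x r) / k.angle t₀
  have hq0 : q τ = 1 := by
    simp only [q, h₀, hGk, div_self (k.angle_ne_zero t₀)]
  obtain ⟨q', hq⟩ : ∃ q', HasDerivWithinAt q q' s τ :=
    ⟨_, (((hG.differentiable (by simp) (x τ)).hasFDerivAt.comp_hasDerivWithinAt τ hx
      ).div_const _)⟩
  have hlog := hq.clog_real (by rw [hq0]; exact Complex.one_mem_slitPlane)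
  -- The parameter is read off from the argument of `q`. The principal branch suffices: its jumps
  -- change `u` by whole periods, which `k` does not see, and differentiability is needed only at
  -- `τ`, where `q = 1`.
  let u : ℝ → ℝ := fun r => t₀ + (2 * Real.pi / k.length)⁻¹ * (Complex.log (q r)).im
  obtain ⟨u', hu⟩ : ∃ u', HasDerivWithinAt u u' s τ := by
    have := (Complex.imCLM.hasFDerivAt (x := Complex.log (q τ))).comp_hasDerivWithinAt τ hlog
    exact ⟨_, (this.const_mul _).const_add t₀⟩
  have huτ : u τ = t₀ := by simp [u, hq0]
  have hxu : EqOn x (fun r => k.toFun (u r)) s := by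
    intro r hr
    obtain ⟨t, ht⟩ := hmem r hr
    have hqr : q r = Complex.exp ((2 * Real.pi / k.length * (t - t₀) : ℝ) * Complex.I) := by
      simp only [q, ← ht, hGk, angle, ← Complex.exp_sub]
      congr 1
      push_cast
      ring
    have hlogr : Complex.exp (Complex.log (q r)) =
        Complex.exp ((2 * Real.pi / k.length * (t - t₀) : ℝ) * Complex.I) := by
      rw [Complex.exp_log (by rw [hqr]; exact Complex.exp_ne_zero _), hqr]
    obtain ⟨n, hn⟩ := Complex.exp_eq_exp_iff_exists_int.1 hlogr
    have him : (Complex.log (q r)).im = 2 * Real.pi / k.length * (t - t₀) + n * (2 * Real.pi) := by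
      rw [hn]
      have : ((2 * Real.pi / k.length * (t - t₀) : ℝ) * Complex.I + n * (2 * Real.pi * Complex.I)
          : ℂ) = ((2 * Real.pi / k.length * (t - t₀) + n * (2 * Real.pi) : ℝ) : ℂ) * Complex.I := by
        push_cast
        ring
      rw [this, Complex.im_ofReal_mul, Complex.I_im, mul_one]
    have hur : u r = t + n * k.length := by
      simp only [u, him]
      have := k.length_pos.ne'
      field_simp
      ring
    simp only [hur, periodic_add_int k.periodic, ht]
  have hk : HasDerivWithinAt (fun r => k.toFun (u r)) (u' • k.tangent t₀) s τ := by
    have := k.hasDerivAt (u τ)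
    rw [huτ] at this
    exact HasDerivAt.scomp_hasDerivWithinAt_of_eq τ this hu huτ.symm
  exact ⟨u', hs.eq_deriv _ hx (hk.congr hxu (hxu hτ))⟩

end Knot

/-! ### Projections onto complex lines in the plane -/

/-- Complex Euclidean two-space. -/
abbrev C2 : Type := EuclideanSpace ℂ (Fin 2)

/-- The operator `w ↦ ⟨v, w⟩ v`. -/
def rankOne (v : C2) : C2 →L[ℝ] C2 :=
  ((innerSL ℂ v).smulRight v).restrictScalars ℝ

theorem rankOne_apply (v w : C2) : rankOne v w = inner ℂ v w • v := rfl

theorem contDiff_rankOne : ContDiff ℝ ∞ rankOne := by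
  rw [contDiff_clm_apply_iff]
  intro w
  simp only [rankOne_apply]
  exact (contDiff_id.inner ℂ contDiff_const).smul contDiff_id

theorem rankOne_smul (c : ℂ) (v : C2) : rankOne (c • v) = ‖c‖ ^ 2 • rankOne v := by
  ext w : 1
  rw [smul_apply, rankOne_apply, rankOne_apply, inner_smul_left, smul_smul,
    mul_right_comm, Complex.conj_mul', mul_smul, ← Complex.ofReal_pow, Complex.coe_smul]

/-- The orthogonal projection onto the complex line through a nonzero vector. -/
def projOn (v : C2) : C2 →L[ℝ] C2 := (‖v‖ ^ 2)⁻¹ • rankOne v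

theorem projOn_apply (v w : C2) : projOn v w = (‖v‖ ^ 2)⁻¹ • (inner ℂ v w • v) := rfl

theorem contDiffAt_projOn {v : C2} (hv : v ≠ 0) : ContDiffAt ℝ ∞ projOn v :=
  ((contDiff_norm_sq ℂ).contDiffAt.inv (by simpa using hv)).smul contDiff_rankOne.contDiffAt

/-- The projector depends only on the line, so it is a function on the projective line. It serves as
a global substitute for the affine charts. -/
theorem projOn_smul {c : ℂ} (hc : c ≠ 0) (v : C2) : projOn (c • v) = projOn v := by
  rw [projOn, projOn, rankOne_smul, norm_smul, smul_smul, mul_pow]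
  have : ‖c‖ ^ 2 ≠ 0 := by simpa using hc
  congr 1
  field_simp

theorem projOn_self {v : C2} (hv : v ≠ 0) : projOn v v = v := by
  have h : ‖v‖ ^ 2 ≠ 0 := by simpa using hv
  rw [projOn_apply, inner_self_eq_norm_sq_to_K, ← Complex.coe_smul, smul_smul]
  have h' : (((‖v‖ ^ 2)⁻¹ : ℝ) : ℂ) * (‖v‖ : ℂ) ^ 2 = 1 := by
    push_cast
    exact inv_mul_cancel₀ (by exact_mod_cast h)
  exact (congrArg (· • v) h').trans (one_smul _ _)

theorem projOn_smul_self {v : C2} (hv : v ≠ 0) (c : ℂ) : projOn v (c • v) = c • v := by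
  conv_rhs => rw [← projOn_self hv]
  rw [projOn_apply, projOn_apply, inner_smul_right, ← Complex.coe_smul, ← Complex.coe_smul]
  module

theorem projOn_projOn {v : C2} (hv : v ≠ 0) (w : C2) : projOn v (projOn v w) = projOn v w := by
  rw [projOn_apply v w, ← Complex.coe_smul, smul_smul, projOn_smul_self hv]

/-- A vector which spans a given point of the projective line. -/
def lineVec (l : CP1) : C2 := WithLp.toLp 2 l.rep

theorem lineVec_ne_zero (l : CP1) : lineVec l ≠ 0 := fun h =>
  l.rep_nonzero (by simpa [lineVec] using h)

theorem lineVec_zero (l : CP1) : lineVec l 0 = uCoord l := rfl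

theorem lineVec_one (l : CP1) : lineVec l 1 = vCoord l := rfl

/-- The orthogonal projection of complex two-space onto a line. -/
def lineProj (l : CP1) : C2 →L[ℝ] C2 := projOn (lineVec l)

theorem continuous_lineProj : Continuous lineProj := by
  rw [continuous_coinduced_dom]
  have : (lineProj ∘ fun v : {v : Fin 2 → ℂ // v ≠ 0} => Projectivization.mk ℂ v.1 v.2) =
      fun v => projOn (WithLp.toLp 2 v.1) := by
    funext v
    obtain ⟨a, ha⟩ := Projectivization.exists_smul_eq_mk_rep ℂ v.1 v.2
    have h : lineVec (Projectivization.mk ℂ v.1 v.2) = (a : ℂ) • (WithLp.toLp 2 v.1 : C2) :=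
      congrArg (WithLp.toLp 2) ha.symm
    rw [Function.comp_apply, lineProj, h, projOn_smul a.ne_zero]
  rw [this, continuous_iff_continuousAt]
  intro v
  have hv : WithLp.toLp 2 v.1 ≠ (0 : C2) := by simpa using v.2
  have hc : Continuous fun v : {v : Fin 2 → ℂ // v ≠ 0} => (WithLp.toLp 2 v.1 : C2) :=
    (PiLp.continuous_toLp 2 _).comp continuous_subtype_val
  exact ContinuousAt.comp (f := fun v : {v : Fin 2 → ℂ // v ≠ 0} => (WithLp.toLp 2 v.1 : C2))
    (contDiffAt_projOn hv).continuousAt hc.continuousAt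

theorem lineProj_of_vCoord_ne_zero {l : CP1} (h : vCoord l ≠ 0) :
    lineProj l = projOn !₂[affU l, 1] := by
  have : lineVec l = vCoord l • !₂[affU l, 1] := by
    ext i
    fin_cases i
    · simp [lineVec_zero, affU, mul_div_cancel₀ _ h]
    · simp [lineVec_one]
  rw [lineProj, this, projOn_smul h]

theorem lineProj_of_uCoord_ne_zero {l : CP1} (h : uCoord l ≠ 0) :
    lineProj l = projOn !₂[1, affV l] := by
  have : lineVec l = uCoord l • !₂[1, affV l] := by
    ext i
    fin_cases i
    · simp [lineVec_zero]
    · simp [lineVec_one, affV, mul_div_cancel₀ _ h]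
  rw [lineProj, this, projOn_smul h]

theorem exists_eq_smul_lineVec {l : CP1} {w : C2} (h : lineProj l w = w) :
    ∃ c : ℂ, w = c • lineVec l := by
  rw [lineProj, projOn_apply, ← Complex.coe_smul, smul_smul] at h
  exact ⟨_, h.symm⟩

theorem exists_eq_smul_of_lineProj {l : CP1} {v w : C2} (hv : lineProj l v = v) (hv0 : v ≠ 0)
    (hw : lineProj l w = w) : ∃ c : ℂ, w = c • v := by
  obtain ⟨c, rfl⟩ := exists_eq_smul_lineVec hv
  obtain ⟨d, rfl⟩ := exists_eq_smul_lineVec hw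
  have hc : c ≠ 0 := by
    rintro rfl
    simp at hv0
  exact ⟨d / c, by rw [smul_smul, div_mul_cancel₀ _ hc]⟩

/-! ### The line of a point of the conifold -/

/-- The first row of the matrix of a point of complex four-space. -/
def row1 (z : C4) : C2 := !₂[w1 z, w2 z]

/-- The second row of the matrix of a point of complex four-space. -/
def row2 (z : C4) : C2 := !₂[w3 z, w4 z]

/-- On the conifold, the projection onto the row space of the matrix of a point. -/
def rowProj (z : C4) : C2 →L[ℝ] C2 := (2 * ‖z‖ ^ 2)⁻¹ • (rankOne (row1 z) + rankOne (row2 z))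

theorem norm_row1_add_norm_row2 (z : C4) : ‖row1 z‖ ^ 2 + ‖row2 z‖ ^ 2 = 2 * ‖z‖ ^ 2 := by
  simp only [EuclideanSpace.norm_sq_eq, Fin.sum_univ_two, Fin.sum_univ_four, row1, row2, w1, w2,
    w3, w4, Complex.sq_norm, Complex.normSq_apply]
  simp
  ring

/-- The determinant equations make both rows multiples `c l` and `d l` of a spanning vector `l`, so
the sum of the rank-one operators is `|c|² + |d|²` times the one of `l`. The normalisation comes
from `norm_row1_add_norm_row2`. Hence the projective component is a smooth function of `z` away from
the exceptional curve. -/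
theorem rowProj_eq_lineProj (q : Resolved) (hq : q.point ≠ 0) :
    rowProj q.point = lineProj q.base := by
  have hne := lineVec_ne_zero q.base
  have key : ∀ a b : ℂ, a * vCoord q.base - b * uCoord q.base = 0 →
      ∃ c : ℂ, (!₂[a, b] : C2) = c • lineVec q.base := by
    intro a b hab
    by_cases hu : uCoord q.base = 0
    · have hv : vCoord q.base ≠ 0 := fun hv => hne (by
        ext i
        fin_cases i
        · exact hu
        · exact hv)
      rw [hu, mul_zero, sub_zero] at hab
      refine ⟨b / vCoord q.base, ?_⟩
      ext i
      fin_cases i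
      · simpa [lineVec_zero, hu, hv] using hab
      · simp [lineVec_one, div_mul_cancel₀ _ hv]
    · refine ⟨a / uCoord q.base, ?_⟩
      ext i
      fin_cases i
      · simp [lineVec_zero, div_mul_cancel₀ _ hu]
      · simp only [PiLp.smul_apply, smul_eq_mul, Fin.mk_one, lineVec_one]
        change b = _
        field_simp
        linear_combination -hab
  obtain ⟨c, hc⟩ := key _ _ q.2.1
  obtain ⟨d, hd⟩ := key _ _ q.2.2
  change row1 q.point = _ at hc
  change row2 q.point = _ at hd
  have hn := norm_row1_add_norm_row2 q.point
  have h1 : ‖lineVec q.base‖ ≠ 0 := norm_ne_zero_iff.2 hne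
  have h2 : ‖q.point‖ ≠ 0 := norm_ne_zero_iff.2 hq
  have hs : ∀ (α β γ : ℝ) (A : C2 →L[ℝ] C2), α • (β • A + γ • A) = (α * (β + γ)) • A :=
    fun α β γ A => by module
  rw [rowProj, lineProj, projOn, hc, hd, rankOne_smul, rankOne_smul, hs]
  congr 1
  rw [hc, hd, norm_smul, norm_smul, mul_pow, mul_pow, ← add_mul] at hn
  rw [← hn, mul_inv_rev, mul_assoc, inv_mul_cancel₀, mul_one]
  intro h0
  rw [h0, zero_mul] at hn
  exact h2 (by nlinarith)

theorem contDiff_row1 : ContDiff ℝ ∞ row1 := by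
  refine contDiff_piLp' 2 fun i => ?_
  fin_cases i
  · change ContDiff ℝ ∞ fun z : C4 => z 0 + Complex.I * z 1
    fun_prop
  · change ContDiff ℝ ∞ fun z : C4 => -z 2 + Complex.I * z 3
    fun_prop

theorem contDiff_row2 : ContDiff ℝ ∞ row2 := by
  refine contDiff_piLp' 2 fun i => ?_
  fin_cases i
  · change ContDiff ℝ ∞ fun z : C4 => z 2 + Complex.I * z 3
    fun_prop
  · change ContDiff ℝ ∞ fun z : C4 => z 0 - Complex.I * z 1
    fun_prop

theorem contDiffAt_rowProj {z : C4} (hz : z ≠ 0) : ContDiffAt ℝ ∞ rowProj z := by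
  have h : 2 * ‖z‖ ^ 2 ≠ 0 := by simpa using hz
  exact ((contDiffAt_const.mul (contDiff_norm_sq ℂ).contDiffAt).inv h).smul
    ((contDiff_rankOne.comp contDiff_row1).add (contDiff_rankOne.comp contDiff_row2)).contDiffAt

theorem rowProj_smul {r : ℝ} (hr : r ≠ 0) (z : C4) : rowProj (r • z) = rowProj z := by
  have h1 : row1 (r • z) = (r : ℂ) • row1 z := by
    ext i
    fin_cases i <;> simp [row1, w1, w2] <;> ring
  have h2 : row2 (r • z) = (r : ℂ) • row2 z := by
    ext i
    fin_cases i <;> simp [row2, w3, w4] <;> ring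
  have hs : ∀ (α β : ℝ) (A B : C2 →L[ℝ] C2), α • (β • A + β • B) = (α * β) • (A + B) :=
    fun α β A B => by module
  rw [rowProj, rowProj, h1, h2, rankOne_smul, rankOne_smul, hs, norm_smul]
  congr 1
  simp only [Complex.norm_real, mul_pow]
  have : ‖r‖ ^ 2 ≠ 0 := by simpa using hr
  by_cases hz : ‖z‖ = 0
  · simp [hz]
  · field_simp

/-! ### Spin projections -/

/-- The real part of a vector. -/
def rePart : C4 →L[ℝ] R4 :=
  LinearMap.toContinuousLinearMap
    { toFun := fun z => WithLp.toLp 2 fun j => (z j).re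
      map_add' := fun z w => by ext j; simp
      map_smul' := fun c z => by ext j; simp }

/-- The imaginary part of a vector. -/
def imPart : C4 →L[ℝ] R4 :=
  LinearMap.toContinuousLinearMap
    { toFun := fun z => WithLp.toLp 2 fun j => (z j).im
      map_add' := fun z w => by ext j; simp
      map_smul' := fun c z => by ext j; simp }

@[simp] theorem rePart_apply (z : C4) (j : Fin 4) : rePart z j = (z j).re := rfl

@[simp] theorem imPart_apply (z : C4) (j : Fin 4) : imPart z j = (z j).im := rfl

theorem norm_sq_eq_rePart_add_imPart (z : C4) : ‖z‖ ^ 2 = ‖rePart z‖ ^ 2 + ‖imPart z‖ ^ 2 := by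
  simp only [EuclideanSpace.norm_sq_eq, Fin.sum_univ_four, rePart_apply, imPart_apply,
    Complex.sq_norm, Complex.normSq_apply, Real.norm_eq_abs, sq_abs]
  ring

/-- The first component of the quaternion `a⁻¹ b`, up to a sign. -/
def spinRe (a b : R4) : ℝ := a 1 * b 0 - a 0 * b 1 + a 3 * b 2 - a 2 * b 3

/-- The remaining two components of the quaternion `a⁻¹ b`, up to signs. -/
def spinIm (a b : R4) : ℂ :=
  (a 3 * b 0 - a 0 * b 3 + a 2 * b 1 - a 1 * b 2 : ℝ) -
    (a 0 * b 2 - a 2 * b 0 + a 3 * b 1 - a 1 * b 3 : ℝ) * Complex.I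

/-- The quaternion `ā b` has real part `⟨a, b⟩` and norm `|a| |b|`; `spinRe` and `spinIm` are its
imaginary components up to sign. For a unit vector `a` they give an isometry from the orthogonal
complement of `a` to `ℝ × ℂ`. -/
theorem spin_inner (a b c : R4) :
    spinRe a b * spinRe a c + (starRingEnd ℂ (spinIm a b) * spinIm a c).re =
      ‖a‖ ^ 2 * inner ℝ b c - inner ℝ a b * inner ℝ a c := by
  simp [spinRe, spinIm, EuclideanSpace.norm_sq_eq, Fin.sum_univ_four, PiLp.inner_apply]
  ring

theorem spin_norm (a b : R4) :
    spinRe a b ^ 2 + ‖spinIm a b‖ ^ 2 = ‖a‖ ^ 2 * ‖b‖ ^ 2 - inner ℝ a b ^ 2 := by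
  have h := spin_inner a b b
  rw [Complex.conj_mul', ← Complex.ofReal_pow, Complex.ofReal_re, real_inner_self_eq_norm_sq] at h
  linarith

/-- The matrix `(1 + n · σ) / 2` of the spin operator in the direction `n = (τ, ν) ∈ ℝ × ℂ`. -/
def spin (τ : ℝ) (ν : ℂ) (w : C2) : C2 :=
  !₂[((1 + τ) * w 0 + starRingEnd ℂ ν * w 1) / 2, (ν * w 0 + (1 - τ) * w 1) / 2]

/-- Comparing matrix entries, which are quadratic in the real and imaginary parts of `z`; the
conifold equation is not needed. It identifies the line over `z` with a direction in three-space, so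
that angles between lines become angles between covectors. -/
theorem rowProj_eq_spin {z : C4} (hz : z ≠ 0) (w : C2) :
    rowProj z w = spin (2 * spinRe (rePart z) (imPart z) / ‖z‖ ^ 2)
      (2 * spinIm (rePart z) (imPart z) / (‖z‖ ^ 2 : ℝ)) w := by
  have hz' : ((‖z‖ ^ 2 : ℝ) : ℂ) ≠ 0 := by
    simpa using hz
  have hN : ((‖z‖ ^ 2 : ℝ) : ℂ) = ∑ j, (((z j).re * (z j).re + (z j).im * (z j).im : ℝ) : ℂ) := by
    rw [← Complex.ofReal_sum, EuclideanSpace.norm_sq_eq]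
    simp only [Complex.sq_norm, Complex.normSq_apply]
  have happ : rowProj z w = ((2 * (‖z‖ ^ 2 : ℝ) : ℂ))⁻¹ •
      (inner ℂ (row1 z) w • row1 z + inner ℂ (row2 z) w • row2 z) := by
    rw [rowProj, smul_apply, ← Complex.coe_smul]
    push_cast
    rfl
  have h1 : inner ℂ (row1 z) w = starRingEnd ℂ (w1 z) * w 0 + starRingEnd ℂ (w2 z) * w 1 := by
    simp [PiLp.inner_apply, row1, mul_comm]
  have h2 : inner ℂ (row2 z) w = starRingEnd ℂ (w3 z) * w 0 + starRingEnd ℂ (w4 z) * w 1 := by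
    simp [PiLp.inner_apply, row2, mul_comm]
  rw [happ, h1, h2]
  have e0 : (starRingEnd ℂ (w1 z) * w 0 + starRingEnd ℂ (w2 z) * w 1) * w1 z +
      (starRingEnd ℂ (w3 z) * w 0 + starRingEnd ℂ (w4 z) * w 1) * w3 z =
      (((‖z‖ ^ 2 : ℝ) : ℂ) + 2 * spinRe (rePart z) (imPart z)) * w 0 +
        2 * starRingEnd ℂ (spinIm (rePart z) (imPart z)) * w 1 := by
    rw [hN, Fin.sum_univ_four]
    apply Complex.ext <;> simp [spinRe, spinIm, w1, w2, w3, w4] <;> ring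
  have e1 : (starRingEnd ℂ (w1 z) * w 0 + starRingEnd ℂ (w2 z) * w 1) * w2 z +
      (starRingEnd ℂ (w3 z) * w 0 + starRingEnd ℂ (w4 z) * w 1) * w4 z =
      2 * spinIm (rePart z) (imPart z) * w 0 +
        (((‖z‖ ^ 2 : ℝ) : ℂ) - 2 * spinRe (rePart z) (imPart z)) * w 1 := by
    rw [hN, Fin.sum_univ_four]
    apply Complex.ext <;> simp [spinRe, spinIm, w1, w2, w3, w4] <;> ring
  ext i
  fin_cases i
  · change ((2 * (‖z‖ ^ 2 : ℝ) : ℂ))⁻¹ * ((starRingEnd ℂ (w1 z) * w 0 +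
      starRingEnd ℂ (w2 z) * w 1) * w1 z +
      (starRingEnd ℂ (w3 z) * w 0 + starRingEnd ℂ (w4 z) * w 1) * w3 z) = _
    rw [e0]
    simp only [spin, Fin.zero_eta, PiLp.toLp_apply, Matrix.cons_val_zero, map_div₀, map_mul,
      Complex.conj_ofReal, Complex.ofReal_div, Complex.ofReal_mul, Complex.ofReal_ofNat]
    rw [Complex.conj_ofNat]
    field_simp
  · change ((2 * (‖z‖ ^ 2 : ℝ) : ℂ))⁻¹ * ((starRingEnd ℂ (w1 z) * w 0 +
      starRingEnd ℂ (w2 z) * w 1) * w2 z +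
      (starRingEnd ℂ (w3 z) * w 0 + starRingEnd ℂ (w4 z) * w 1) * w4 z) = _
    rw [e1]
    simp only [spin, Fin.mk_one, PiLp.toLp_apply, Matrix.cons_val_one, Matrix.cons_val_zero,
      Complex.ofReal_div, Complex.ofReal_mul, Complex.ofReal_ofNat]
    field_simp

theorem spin_eq_iff {τ : ℝ} {ν : ℂ} {w : C2} : spin τ ν w = w ↔
    starRingEnd ℂ ν * w 1 = (1 - τ) * w 0 ∧ ν * w 0 = (1 + τ) * w 1 := by
  constructor
  · intro h
    have h0 : ((1 + τ) * w 0 + starRingEnd ℂ ν * w 1) / 2 = w 0 := congrArg (fun v : C2 => v 0) h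
    have h1 : (ν * w 0 + (1 - τ) * w 1) / 2 = w 1 := congrArg (fun v : C2 => v 1) h
    constructor
    · linear_combination 2 * h0
    · linear_combination 2 * h1
  · rintro ⟨h0, h1⟩
    ext i
    fin_cases i
    · change ((1 + τ) * w 0 + starRingEnd ℂ ν * w 1) / 2 = w 0
      linear_combination h0 / 2
    · change (ν * w 0 + (1 - τ) * w 1) / 2 = w 1
      linear_combination h1 / 2

theorem normSq_eq (w : C2) : ((‖w‖ ^ 2 : ℝ) : ℂ) =
    starRingEnd ℂ (w 0) * w 0 + starRingEnd ℂ (w 1) * w 1 := by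
  rw [EuclideanSpace.norm_sq_eq, Fin.sum_univ_two, Complex.conj_mul', Complex.conj_mul']
  push_cast
  rfl

/-- A vector fixed by a spin operator points in its direction. -/
theorem bloch_of_spin_eq {τ : ℝ} {ν : ℂ} {w : C2} (hw : spin τ ν w = w) :
    starRingEnd ℂ (w 0) * w 0 - starRingEnd ℂ (w 1) * w 1 = τ * (‖w‖ ^ 2 : ℝ) ∧
      2 * (starRingEnd ℂ (w 0) * w 1) = ν * (‖w‖ ^ 2 : ℝ) := by
  obtain ⟨h0, h1⟩ := spin_eq_iff.1 hw
  have h0' := congrArg (starRingEnd ℂ) h0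
  have h1' := congrArg (starRingEnd ℂ) h1
  simp only [map_mul, map_sub, map_add, map_one, Complex.conj_ofReal, Complex.conj_conj] at h0' h1'
  rw [normSq_eq]
  constructor
  · linear_combination w 1 * h1' - starRingEnd ℂ (w 0) * h0
  · linear_combination -starRingEnd ℂ (w 0) * h1 - w 1 * h0'

theorem norm_sq_spin {τ : ℝ} {ν : ℂ} (h : τ ^ 2 + ‖ν‖ ^ 2 = 1) (w : C2) :
    ((‖spin τ ν w‖ ^ 2 : ℝ) : ℂ) = ((‖w‖ ^ 2 : ℝ) +
      τ * (starRingEnd ℂ (w 0) * w 0 - starRingEnd ℂ (w 1) * w 1) +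
      ν * w 0 * starRingEnd ℂ (w 1) + starRingEnd ℂ ν * starRingEnd ℂ (w 0) * w 1) / 2 := by
  have hc : (τ : ℂ) ^ 2 + starRingEnd ℂ ν * ν = 1 := by
    rw [Complex.conj_mul']
    exact_mod_cast h
  rw [normSq_eq, normSq_eq]
  simp only [spin, PiLp.toLp_apply, Matrix.cons_val_zero, Matrix.cons_val_one, map_div₀, map_add,
    map_sub, map_mul, map_one, Complex.conj_ofReal, Complex.conj_conj, Complex.conj_ofNat]
  linear_combination (starRingEnd ℂ (w 0) * w 0 + starRingEnd ℂ (w 1) * w 1) / 4 * hc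

/-- If `w` points in the direction `n'`, its projection to the direction `n` satisfies `‖P w‖² =
‖w‖² (1 + n · n') / 2`. -/
theorem half_le_norm_spin {τ τ' : ℝ} {ν ν' : ℂ} {w : C2} (h : τ ^ 2 + ‖ν‖ ^ 2 = 1)
    (hpos : 0 ≤ τ * τ' + (starRingEnd ℂ ν * ν').re) (hw : spin τ' ν' w = w) :
    ‖w‖ ^ 2 / 2 ≤ ‖spin τ ν w‖ ^ 2 := by
  obtain ⟨h0, h1⟩ := bloch_of_spin_eq hw
  have h1' := congrArg (starRingEnd ℂ) h1
  simp only [map_mul, Complex.conj_ofReal, Complex.conj_conj, Complex.conj_ofNat] at h1'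
  have hs := norm_sq_spin h w
  have key : ((‖spin τ ν w‖ ^ 2 : ℝ) : ℂ) = ((‖w‖ ^ 2 * (1 + τ * τ') / 2 : ℝ) : ℂ) +
      (‖w‖ ^ 2 / 2 : ℝ) * ((starRingEnd ℂ ν * ν' + ν * starRingEnd ℂ ν') / 2) := by
    rw [hs]
    push_cast at h0 h1 h1' ⊢
    linear_combination (τ : ℂ) / 2 * h0 + ν / 4 * h1' + starRingEnd ℂ ν / 4 * h1
  have hre := congrArg Complex.re key
  have h2 : (starRingEnd ℂ ν * ν' + ν * starRingEnd ℂ ν') / 2 =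
      (((starRingEnd ℂ ν * ν').re : ℝ) : ℂ) := by
    apply Complex.ext
    · simp
    · simp
      ring
  rw [h2, ← Complex.ofReal_mul, ← Complex.ofReal_add, Complex.ofReal_re, Complex.ofReal_re] at hre
  rw [hre]
  nlinarith [sq_nonneg ‖w‖, mul_nonneg (sq_nonneg ‖w‖) hpos]

theorem contDiff_spin {E : Type*} [NormedAddCommGroup E] [NormedSpace ℝ E] {τ : E → ℝ}
    {ν : E → ℂ} (hτ : ContDiff ℝ ∞ τ) (hν : ContDiff ℝ ∞ ν) (w : C2) :
    ContDiff ℝ ∞ fun x => spin (τ x) (ν x) w := by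
  have hτ' : ContDiff ℝ ∞ fun x => (τ x : ℂ) := Complex.ofRealCLM.contDiff.comp hτ
  have hν' : ContDiff ℝ ∞ fun x => starRingEnd ℂ (ν x) := Complex.conjCLE.contDiff.comp hν
  refine contDiff_piLp' 2 fun i => ?_
  fin_cases i
  · change ContDiff ℝ ∞ fun x => ((1 + τ x) * w 0 + starRingEnd ℂ (ν x) * w 1) / 2
    fun_prop
  · change ContDiff ℝ ∞ fun x => (ν x * w 0 + (1 - τ x) * w 1) / 2
    fun_prop

theorem contDiff_spinRe {E : Type*} [NormedAddCommGroup E] [NormedSpace ℝ E] {a b : E → R4}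
    (ha : ContDiff ℝ ∞ a) (hb : ContDiff ℝ ∞ b) : ContDiff ℝ ∞ fun x => spinRe (a x) (b x) := by
  unfold spinRe
  fun_prop

theorem contDiff_spinIm {E : Type*} [NormedAddCommGroup E] [NormedSpace ℝ E] {a b : E → R4}
    (ha : ContDiff ℝ ∞ a) (hb : ContDiff ℝ ∞ b) : ContDiff ℝ ∞ fun x => spinIm (a x) (b x) := by
  have h1 : ContDiff ℝ ∞ fun x =>
      a x 3 * b x 0 - a x 0 * b x 3 + a x 2 * b x 1 - a x 1 * b x 2 := by fun_prop
  have h2 : ContDiff ℝ ∞ fun x =>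
      a x 0 * b x 2 - a x 2 * b x 0 + a x 3 * b x 1 - a x 1 * b x 3 := by fun_prop
  exact (Complex.ofRealCLM.contDiff.comp h1).sub
    ((Complex.ofRealCLM.contDiff.comp h2).mul contDiff_const)

/-- A spin operator of a unit direction is a projection. -/
theorem spin_spin {τ : ℝ} {ν : ℂ} (h : τ ^ 2 + ‖ν‖ ^ 2 = 1) (w : C2) :
    spin τ ν (spin τ ν w) = spin τ ν w := by
  have hc : (τ : ℂ) ^ 2 + starRingEnd ℂ ν * ν = 1 := by
    rw [Complex.conj_mul']
    exact_mod_cast h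
  rw [spin_eq_iff]
  simp only [spin, PiLp.toLp_apply, Matrix.cons_val_zero, Matrix.cons_val_one]
  constructor
  · linear_combination w 0 / 2 * hc
  · linear_combination w 1 / 2 * hc

theorem spin_smul (τ : ℝ) (ν : ℂ) (c : ℂ) (w : C2) : spin τ ν (c • w) = c • spin τ ν w := by
  ext i
  fin_cases i <;> simp [spin] <;> ring

/-- For a knot there is a smooth nowhere vanishing section of the line bundle which is spanned by
the tangent vectors of the knot. -/
theorem Knot.exists_frame (k : Knot) : ∃ h : ℝ → C2, ContDiff ℝ ∞ h ∧
    Function.Periodic h k.length ∧ (∀ t, ‖h t‖ = 1) ∧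
    ∀ t, spin (spinRe (k.toFun t) (k.tangent t)) (spinIm (k.toFun t) (k.tangent t)) (h t) =
      h t := by
  let τ : ℝ → ℝ := fun t => spinRe (k.toFun t) (k.tangent t)
  let ν : ℝ → ℂ := fun t => spinIm (k.toFun t) (k.tangent t)
  have hτ : ContDiff ℝ ∞ τ := contDiff_spinRe k.smooth k.contDiff_tangent
  have hν : ContDiff ℝ ∞ ν := contDiff_spinIm k.smooth k.contDiff_tangent
  have hunit : ∀ t, τ t ^ 2 + ‖ν t‖ ^ 2 = 1 := fun t => by
    rw [spin_norm, k.on_sphere, k.norm_tangent, k.inner_tangent]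
    norm_num
  -- The image of `φ` is the cone of all real multiples of the tangent directions. It comes from a
  -- two-dimensional source, so its complement in three-space is dense.
  let φ : ℝ × ℝ → ℝ × ℂ := fun p => (p.1 * τ p.2, p.1 * ν p.2)
  have hφ : ContDiff ℝ 1 φ := by
    have h1 : ContDiff ℝ ∞ φ := (contDiff_fst.mul (hτ.comp contDiff_snd)).prodMk
      ((Complex.ofRealCLM.contDiff.comp contDiff_fst).mul (hν.comp contDiff_snd))
    exact h1.of_le (by norm_cast)
  have hdense := hφ.dense_compl_range_of_finrank_lt_finrank (by simp)
  obtain ⟨⟨a, b⟩, hb, hab⟩ := hdense.inter_open_nonempty {p : ℝ × ℂ | p.2 ≠ 0}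
    (isOpen_ne_fun continuous_snd continuous_const) ⟨(0, 1), one_ne_zero⟩
  change b ≠ 0 at hb
  let R := Real.sqrt (a ^ 2 + ‖b‖ ^ 2)
  have hR : R ^ 2 = a ^ 2 + ‖b‖ ^ 2 := Real.sq_sqrt (by positivity)
  have hRa : 0 < a + R := by
    have h1 : |a| < R := by
      rw [← Real.sqrt_sq_eq_abs]
      have : 0 < ‖b‖ := norm_pos_iff.2 hb
      exact Real.sqrt_lt_sqrt (sq_nonneg a) (by nlinarith)
    linarith [neg_abs_le a]
  -- A vector in the direction `(a, b) / R`. Its projection to the direction of the tangent vanishes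
  -- only if that direction is antipodal, which would put `(a, b)` in the image of `φ`. The
  -- condition `b ≠ 0` ensures `a + R > 0`.
  let e : C2 := !₂[((a + R : ℝ) : ℂ), b]
  have he0 : e 0 = ((a + R : ℝ) : ℂ) := rfl
  have he1 : e 1 = b := rfl
  have hne : ∀ t, spin (τ t) (ν t) e ≠ 0 := by
    intro t ht
    have h0 : ((1 + τ t) * e 0 + starRingEnd ℂ (ν t) * e 1) / 2 = 0 :=
      congrArg (fun v : C2 => v 0) ht
    have h1 : (ν t * e 0 + (1 - τ t) * e 1) / 2 = 0 := congrArg (fun v : C2 => v 1) ht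
    have hopp : spin (-τ t) (-ν t) e = e := by
      rw [spin_eq_iff]
      push_cast
      rw [map_neg]
      constructor
      · linear_combination -2 * h0
      · linear_combination -2 * h1
    obtain ⟨h2, h3⟩ := bloch_of_spin_eq hopp
    rw [he0, he1, Complex.conj_ofReal, Complex.conj_mul', ← Complex.ofReal_pow,
      ← Complex.ofReal_mul, ← Complex.ofReal_sub, ← Complex.ofReal_mul, Complex.ofReal_inj] at h2
    rw [he0, he1, Complex.conj_ofReal] at h3
    -- Since `‖e‖² = 2 R (a + R)`, this coefficient is `-R`.
    refine hab ⟨(-(‖e‖ ^ 2) / (2 * (a + R)), t), ?_⟩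
    have hRa' : ((a : ℂ) + R) ≠ 0 := by exact_mod_cast hRa.ne'
    refine Prod.ext ?_ ?_
    · simp only [φ]
      field_simp
      nlinarith
    · simp only [φ]
      push_cast at h3 ⊢
      field_simp
      linear_combination -h3
  have hs : ContDiff ℝ ∞ fun t => spin (τ t) (ν t) e := contDiff_spin hτ hν e
  have hpt : ∀ t, spin (τ (t + k.length)) (ν (t + k.length)) e = spin (τ t) (ν t) e := fun t => by
    simp only [τ, ν, k.periodic t, k.periodic_tangent t]
  refine ⟨fun t => ((‖spin (τ t) (ν t) e‖⁻¹ : ℝ) : ℂ) • spin (τ t) (ν t) e, ?_, ?_, ?_, ?_⟩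
  · exact (Complex.ofRealCLM.contDiff.comp ((hs.norm ℂ hne).inv fun t =>
      norm_ne_zero_iff.2 (hne t))).smul hs
  · intro t
    simp only [hpt]
  · intro t
    rw [norm_smul, Complex.norm_real, norm_inv, norm_norm,
      inv_mul_cancel₀ (norm_ne_zero_iff.2 (hne t))]
  · intro t
    change spin (τ t) (ν t) _ = _
    rw [spin_smul, spin_spin (hunit t)]

/-! ### The conifold transition of a shifted conormal bundle -/

/-- The vectors `z = |p| k(t) + i p` with `p ⟂ k(t)` and `p · k'(t) = ε`. -/
structure IsConormal (k : Knot) (ε : ℝ) (t : ℝ) (z : C4) : Prop where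
  re_eq : rePart z = ‖imPart z‖ • k.toFun t
  inner_point : inner ℝ (imPart z) (k.toFun t) = 0
  inner_tangent : inner ℝ (imPart z) (k.tangent t) = ε

namespace IsConormal

variable {k : Knot} {ε t : ℝ} {z : C4}

theorem le_norm_imPart (h : IsConormal k ε t z) : ε ≤ ‖imPart z‖ := by
  have := real_inner_le_norm (imPart z) (k.tangent t)
  rwa [h.inner_tangent, k.norm_tangent, mul_one] at this

theorem norm_sq (h : IsConormal k ε t z) : ‖z‖ ^ 2 = 2 * ‖imPart z‖ ^ 2 := by
  rw [norm_sq_eq_rePart_add_imPart, h.re_eq, norm_smul, norm_norm, k.on_sphere]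
  ring

theorem norm_eq (h : IsConormal k ε t z) : ‖z‖ = √2 * ‖imPart z‖ := by
  rw [← Real.sqrt_sq (norm_nonneg z), h.norm_sq, Real.sqrt_mul zero_le_two,
    Real.sqrt_sq (norm_nonneg _)]

theorem le_norm_sq (h : IsConormal k ε t z) (hε : 0 < ε) : 2 * ε ^ 2 ≤ ‖z‖ ^ 2 := by
  rw [h.norm_sq]
  have := h.le_norm_imPart
  gcongr

theorem norm_imPart_pos (h : IsConormal k ε t z) (hε : 0 < ε) : 0 < ‖imPart z‖ :=
  hε.trans_le h.le_norm_imPart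

theorem ne_zero (h : IsConormal k ε t z) (hε : 0 < ε) : z ≠ 0 := by
  rintro rfl
  have := h.norm_imPart_pos hε
  simp at this

end IsConormal

theorem rePart_toC4 (q : R4 × R4) : rePart (toC4 q) = q.1 := by
  ext j
  simp [toC4]

theorem imPart_toC4 (q : R4 × R4) : imPart (toC4 q) = q.2 := by
  ext j
  simp [toC4]

theorem isConormal_of_mem_contraction {k : Knot} {ε : ℝ} {z : C4}
    (h : z ∈ contraction '' shiftedConormal k ε) : ∃ t, IsConormal k ε t z := by
  obtain ⟨_, ⟨t, p, ⟨-, h1⟩, h2, rfl⟩, rfl⟩ := h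
  change inner ℝ p (k.toFun t) = 0 at h1
  refine ⟨t, ?_, ?_, ?_⟩
  · rw [contraction, rePart_toC4, imPart_toC4]
  · rw [contraction, imPart_toC4, inner_add_left, h1, real_inner_smul_left, real_inner_comm]
    change 0 + ε * inner ℝ (k.toFun t) (k.tangent t) = 0
    rw [k.inner_tangent, mul_zero, add_zero]
  · rw [contraction, imPart_toC4]
    change inner ℝ (p + ε • k.tangent t) (k.tangent t) = ε
    change inner ℝ p (k.tangent t) = 0 at h2
    rw [inner_add_left, h2, real_inner_smul_left, real_inner_self_eq_norm_sq, k.norm_tangent]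
    ring

/-- The parameter `t` may be restricted to one compact period, and projecting along a compact factor
is a closed map. Taking the closure in the conifold transition therefore adds no new values of `z`,
and `L` stays away from the exceptional curve because `|p| ≥ ε`. -/
theorem isClosed_isConormal (k : Knot) (ε : ℝ) : IsClosed {z | ∃ t, IsConormal k ε t z} := by
  have : {z | ∃ t, IsConormal k ε t z} = Prod.snd '' {p : Icc (0 : ℝ) k.length × C4 |
      rePart p.2 = ‖imPart p.2‖ • k.toFun p.1 ∧ inner ℝ (imPart p.2) (k.toFun p.1) = 0 ∧
        inner ℝ (imPart p.2) (k.tangent p.1) = ε} := by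
    ext z
    constructor
    · rintro ⟨t, h1, h2, h3⟩
      have hper : Function.Periodic (fun s => (k.toFun s, k.tangent s)) k.length := fun s =>
        Prod.ext (k.periodic s) (k.periodic_tangent s)
      obtain ⟨s, hs, h⟩ := hper.exists_mem_Ico₀ k.length_pos t
      obtain ⟨h4, h5⟩ := Prod.ext_iff.1 h
      simp only at h4 h5
      exact ⟨(⟨s, Ico_subset_Icc_self hs⟩, z), ⟨h4 ▸ h1, h4 ▸ h2, h5 ▸ h3⟩, rfl⟩
    · rintro ⟨⟨t, z⟩, ⟨h1, h2, h3⟩, rfl⟩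
      exact ⟨t, h1, h2, h3⟩
  rw [this]
  refine isClosedMap_snd_of_compactSpace _ ?_
  have ck : Continuous fun p : Icc (0 : ℝ) k.length × C4 => k.toFun p.1 :=
    k.smooth.continuous.comp (continuous_subtype_val.comp continuous_fst)
  have ct : Continuous fun p : Icc (0 : ℝ) k.length × C4 => k.tangent p.1 :=
    k.contDiff_tangent.continuous.comp (continuous_subtype_val.comp continuous_fst)
  have ci : Continuous fun p : Icc (0 : ℝ) k.length × C4 => imPart p.2 :=
    imPart.continuous.comp continuous_snd
  have cr : Continuous fun p : Icc (0 : ℝ) k.length × C4 => rePart p.2 :=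
    rePart.continuous.comp continuous_snd
  exact (isClosed_eq cr (ci.norm.smul ck)).inter
    ((isClosed_eq (ci.inner ck) continuous_const).inter
      (isClosed_eq (ci.inner ct) continuous_const))

theorem continuous_point : Continuous Resolved.point :=
  continuous_snd.comp continuous_subtype_val

theorem continuous_base : Continuous Resolved.base :=
  continuous_fst.comp continuous_subtype_val

theorem isConormal_of_mem {k : Knot} {ε : ℝ} {q : Resolved}
    (h : q ∈ conifoldTransition (shiftedConormal k ε)) : ∃ t, IsConormal k ε t q.point := by
  refine closure_minimal ?_ ((isClosed_isConormal k ε).preimage continuous_point) h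
  exact fun q hq => isConormal_of_mem_contraction hq.1

/-! ### Cut-off functions -/

/-- A smooth step from `0` on `(-∞, c]` to `1` on `[2 c, ∞)`. -/
def cut (c y : ℝ) : ℝ := Real.smoothTransition (y / c - 1)

theorem cut_of_le {c y : ℝ} (hc : 0 < c) (h : y ≤ c) : cut c y = 0 :=
  Real.smoothTransition.zero_of_nonpos (by rw [sub_nonpos, div_le_one hc]; exact h)

theorem cut_of_ge {c y : ℝ} (hc : 0 < c) (h : 2 * c ≤ y) : cut c y = 1 :=
  Real.smoothTransition.one_of_one_le (by rw [le_sub_iff_add_le, le_div_iff₀ hc]; linarith)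

theorem cut_nonneg (c y : ℝ) : 0 ≤ cut c y := Real.smoothTransition.nonneg _

theorem contDiff_cut (c : ℝ) : ContDiff ℝ ∞ (cut c) :=
  Real.smoothTransition.contDiff.comp ((contDiff_id.div_const c).sub contDiff_const)

theorem monotone_cut {c : ℝ} (hc : 0 < c) : Monotone (cut c) := fun x y h =>
  Real.smoothTransition.monotone (by gcongr)

theorem contDiff_cut_mul {c : ℝ} (hc : 0 < c) {g : ℝ → ℝ} (hg : ∀ y, 0 < y → ContDiffAt ℝ ∞ g y) :
    ContDiff ℝ ∞ fun y => cut c y * g y := by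
  rw [contDiff_iff_contDiffAt]
  intro y
  rcases lt_or_ge y c with h | h
  · refine (contDiffAt_const (c := (0 : ℝ))).congr_of_eventuallyEq ?_
    filter_upwards [isOpen_Iio.mem_nhds h] with x hx
    rw [cut_of_le hc (le_of_lt hx), zero_mul]
  · exact (contDiff_cut c).contDiffAt.mul (hg y (hc.trans_le h))

/-! ### One-forms -/

section Forms

variable {E : Type*} [NormedAddCommGroup E] [InnerProductSpace ℂ E]
  [NormedSpace ℝ E] [IsScalarTower ℝ ℂ E]

/-- The one-form `X ↦ Im ⟨v, X⟩` on a complex inner product space, as a function of the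
vector `v`. -/
def imForm : E →L[ℝ] E →L[ℝ] ℝ :=
  LinearMap.mkContinuous₂ (LinearMap.mk₂ ℝ (fun v w : E => (inner ℂ v w).im)
    (fun v v' w => by simp) (fun c v w => by simp [inner_smul_left_eq_smul])
    (fun v w w' => by simp) (fun c v w => by simp [inner_smul_right_eq_smul]))
    1 fun v w => by
      rw [one_mul]
      exact (Complex.abs_im_le_norm _).trans (norm_inner_le_norm v w)

@[simp] theorem imForm_apply (v w : E) : imForm v w = (inner ℂ v w).im := rfl

theorem formDeriv_imForm (z X Y : E) :
    formDeriv (fun z => imForm z) z X Y = 2 * (inner ℂ X Y).im := by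
  rw [formDeriv, ContinuousLinearMap.fderiv, imForm_apply, imForm_apply, ← inner_conj_symm Y X,
    Complex.conj_im]
  ring

/-- A two-form restricted to a complex line is determined by its value on `(Z, iZ)`. This reduces
comparisons of two-forms along a holomorphic curve to inequalities on complex lines. -/
theorem formDeriv_line {A : E → E →L[ℝ] ℝ} (z Z : E) (c d : ℂ) :
    formDeriv A z (c • Z) (d • Z) =
      (starRingEnd ℂ c * d).im * formDeriv A z Z (Complex.I • Z) := by
  have h : ∀ e : ℂ, e • Z = e.re • Z + e.im • (Complex.I • Z) := fun e => by
    conv_lhs => rw [← Complex.re_add_im e]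
    have hr : ∀ (r : ℝ) (w : E), (r : ℂ) • w = r • w := fun r w => algebraMap_smul ℂ r w
    rw [add_smul, mul_smul, hr, hr]
  rw [h c, h d]
  simp only [formDeriv, map_add, map_smul, add_apply, smul_apply, smul_eq_mul, Complex.mul_im,
    Complex.conj_re, Complex.conj_im]
  ring

end Forms

section Forms

variable {E : Type*} [NormedAddCommGroup E] [NormedSpace ℝ E]

theorem formDeriv_smul {f : E → ℝ} {A : E → E →L[ℝ] ℝ} {z : E} (hf : DifferentiableAt ℝ f z)
    (hA : DifferentiableAt ℝ A z) (X Y : E) :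
    formDeriv (fun z => f z • A z) z X Y =
      fderiv ℝ f z X * A z Y - fderiv ℝ f z Y * A z X + f z * formDeriv A z X Y := by
  have h : HasFDerivAt (fun z => f z • A z) _ z := hf.hasFDerivAt.smul hA.hasFDerivAt
  rw [formDeriv, h.fderiv]
  simp only [add_apply, smul_apply, ContinuousLinearMap.smulRight_apply, smul_eq_mul, formDeriv]
  ring

theorem formDeriv_const_smul {c : ℝ} {A : E → E →L[ℝ] ℝ} {z : E} (hA : DifferentiableAt ℝ A z)
    (X Y : E) : formDeriv (fun z => c • A z) z X Y = c * formDeriv A z X Y := by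
  rw [formDeriv_smul (differentiableAt_const c) hA]
  simp

theorem abs_formDeriv_le (A : E → E →L[ℝ] ℝ) (z X Y : E) :
    |formDeriv A z X Y| ≤ 2 * ‖fderiv ℝ A z‖ * (‖X‖ * ‖Y‖) := by
  have h1 := (fderiv ℝ A z).le_opNorm₂ X Y
  have h2 := (fderiv ℝ A z).le_opNorm₂ Y X
  rw [Real.norm_eq_abs] at h1 h2
  refine (abs_sub _ _).trans ?_
  nlinarith

/-- The derivative of a homogeneous function of non-positive degree decays like `1 / |z|`. -/
theorem exists_fderiv_bound {F : Type*} [NormedAddCommGroup F] [NormedSpace ℝ F] [ProperSpace E]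
    {A : E → F} (hA : ∀ z, z ≠ 0 → ContDiffAt ℝ 1 A z) {R r : ℝ} (hR : 0 < R) (hr : 0 < r) {d : ℕ}
    (hom : ∀ z (c : ℝ), R < ‖z‖ → 1 ≤ c → A (c • z) = c⁻¹ ^ d • A z) :
    ∃ C, 0 ≤ C ∧ ∀ z, r ≤ ‖z‖ → ‖fderiv ℝ A z‖ ≤ C / ‖z‖ := by
  have hK : IsCompact (Metric.closedBall (0 : E) (2 * R + r) \ Metric.ball 0 r) :=
    (isCompact_closedBall _ _).diff Metric.isOpen_ball
  have hKmem : ∀ z : E, z ∈ Metric.closedBall (0 : E) (2 * R + r) \ Metric.ball 0 r ↔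
      ‖z‖ ≤ 2 * R + r ∧ r ≤ ‖z‖ := fun z => by simp
  have hcont : ContinuousOn (fderiv ℝ A)
      (Metric.closedBall (0 : E) (2 * R + r) \ Metric.ball 0 r) := fun z hz => by
    have hz0 : z ≠ 0 := norm_pos_iff.1 (hr.trans_le ((hKmem z).1 hz).2)
    exact ((hA z hz0).fderiv_right (m := 0) (by norm_num)).continuousAt.continuousWithinAt
  obtain ⟨M, hM⟩ := hK.exists_bound_of_continuousOn hcont
  have hM' : ∀ z : E, ‖z‖ ≤ 2 * R + r → r ≤ ‖z‖ → ‖fderiv ℝ A z‖ ≤ |M| := fun z h1 h2 =>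
    (hM z ((hKmem z).2 ⟨h1, h2⟩)).trans (le_abs_self M)
  refine ⟨|M| * (2 * R + r), by positivity, fun z hz => ?_⟩
  have hzp : 0 < ‖z‖ := hr.trans_le hz
  rw [le_div_iff₀ hzp]
  rcases le_total ‖z‖ (2 * R + r) with h | h
  · exact mul_le_mul (hM' z h hz) h hzp.le (abs_nonneg M)
  · let c : ℝ := ‖z‖ / (2 * R + r)
    have hRr : 0 < 2 * R + r := by positivity
    have hc : 1 ≤ c := by rwa [one_le_div hRr]
    have hc0 : 0 < c := by linarith
    have hw : ‖c⁻¹ • z‖ = 2 * R + r := by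
      rw [norm_smul, norm_inv, Real.norm_of_nonneg hc0.le]
      simp only [c]
      field_simp
    have hcz : c • c⁻¹ • z = z := smul_inv_smul₀ hc0.ne' z
    have hw0 : c⁻¹ • z ≠ 0 := norm_pos_iff.1 (hw ▸ hRr)
    -- Homogeneity moves `z` to the sphere of radius `2R + r`, where compactness bounds the
    -- derivative. Differentiating `A(c y) = c⁻ᵈ A(y)` gains one further factor `1 / c`, which is
    -- the asserted decay.
    have hev : (fun y => A (c • y)) =ᶠ[𝓝 (c⁻¹ • z)] fun y => c⁻¹ ^ d • A y := by
      have : {y : E | R < ‖y‖} ∈ 𝓝 (c⁻¹ • z) :=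
        (isOpen_lt continuous_const continuous_norm).mem_nhds (by
          change R < ‖c⁻¹ • z‖
          rw [hw]
          linarith)
      filter_upwards [this] with y hy using hom y c hy hc
    have h1 := hev.fderiv_eq (𝕜 := ℝ)
    rw [fderiv_comp_smul, hcz, fderiv_fun_const_smul
      ((hA _ hw0).differentiableAt one_ne_zero)] at h1
    have h2 := congrArg norm h1
    rw [norm_smul, norm_smul, norm_pow, norm_inv, Real.norm_of_nonneg hc0.le] at h2
    have h3 : c⁻¹ ^ d ≤ 1 := pow_le_one₀ (inv_nonneg.2 hc0.le) (inv_le_one_of_one_le₀ hc)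
    have h4 := hM' _ hw.le (by rw [hw]; linarith)
    have h5 : c * ‖fderiv ℝ A z‖ ≤ |M| := by
      rw [h2]
      nlinarith [norm_nonneg (fderiv ℝ A (c⁻¹ • z))]
    have h6 : ‖z‖ = c * (2 * R + r) := by
      simp only [c]
      field_simp
    rw [h6]
    nlinarith

end Forms

/-! ### The one-forms of the area estimate -/

namespace Knot

variable (k : Knot)

/-- A unit section of the line bundle spanned by the tangent vectors of a knot. -/
def frame : ℝ → C2 := k.exists_frame.choose

theorem norm_frame (t : ℝ) : ‖k.frame t‖ = 1 := k.exists_frame.choose_spec.2.2.1 t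

theorem spin_frame (t : ℝ) : spin (spinRe (k.toFun t) (k.tangent t))
    (spinIm (k.toFun t) (k.tangent t)) (k.frame t) = k.frame t :=
  k.exists_frame.choose_spec.2.2.2 t

/-- A smooth extension of the frame to four-space. -/
def frameExt : R4 → C2 :=
  (k.exists_extension k.exists_frame.choose_spec.1 k.exists_frame.choose_spec.2.1).choose

theorem contDiff_frameExt : ContDiff ℝ ∞ k.frameExt :=
  (k.exists_extension k.exists_frame.choose_spec.1 k.exists_frame.choose_spec.2.1).choose_spec.1

theorem frameExt_apply (t : ℝ) : k.frameExt (k.toFun t) = k.frame t :=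
  (k.exists_extension k.exists_frame.choose_spec.1 k.exists_frame.choose_spec.2.1).choose_spec.2 t

/-- A smooth extension of the tangent vector to four-space. -/
def tangentExt : R4 → R4 := (k.exists_extension k.contDiff_tangent k.periodic_tangent).choose

theorem contDiff_tangentExt : ContDiff ℝ ∞ k.tangentExt :=
  (k.exists_extension k.contDiff_tangent k.periodic_tangent).choose_spec.1

theorem tangentExt_apply (t : ℝ) : k.tangentExt (k.toFun t) = k.tangent t :=
  (k.exists_extension k.contDiff_tangent k.periodic_tangent).choose_spec.2 t

/-- A smooth extension of the angular coordinate to four-space. -/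
def angleExt : R4 → ℂ := (k.exists_extension k.contDiff_angle k.periodic_angle).choose

theorem contDiff_angleExt : ContDiff ℝ ∞ k.angleExt :=
  (k.exists_extension k.contDiff_angle k.periodic_angle).choose_spec.1

theorem angleExt_apply (t : ℝ) : k.angleExt (k.toFun t) = k.angle t :=
  (k.exists_extension k.contDiff_angle k.periodic_angle).choose_spec.2 t

end Knot

/-- The point of the three-sphere below a point of the conifold. -/
def footPoint (z : C4) : R4 := (√2 * ‖z‖⁻¹) • rePart z

theorem contDiffAt_footPoint {z : C4} (hz : z ≠ 0) : ContDiffAt ℝ ∞ footPoint z :=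
  (contDiffAt_const.mul ((contDiffAt_norm ℂ hz).inv (norm_ne_zero_iff.2 hz))).smul
    rePart.contDiff.contDiffAt

theorem footPoint_smul {c : ℝ} (hc : 0 < c) (z : C4) : footPoint (c • z) = footPoint z := by
  rw [footPoint, footPoint, map_smul, smul_smul, norm_smul, Real.norm_of_nonneg hc.le]
  congr 1
  field_simp

theorem IsConormal.footPoint_eq {k : Knot} {ε t : ℝ} {z : C4} (h : IsConormal k ε t z)
    (hε : 0 < ε) : footPoint z = k.toFun t := by
  have := h.norm_imPart_pos hε
  rw [footPoint, h.norm_eq, h.re_eq, smul_smul]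
  have h2 : √2 ≠ 0 := by positivity
  rw [show √2 * (√2 * ‖imPart z‖)⁻¹ * ‖imPart z‖ = 1 by field_simp, one_smul]

/-- A vector in the line over a point of the conifold, obtained from the frame of a knot. -/
def lineSection (k : Knot) (z : C4) : C2 := rowProj z (k.frameExt (footPoint z))

theorem contDiffAt_lineSection (k : Knot) {z : C4} (hz : z ≠ 0) :
    ContDiffAt ℝ ∞ (lineSection k) z :=
  (contDiffAt_rowProj hz).clm_apply
    (k.contDiff_frameExt.contDiffAt.comp z (contDiffAt_footPoint hz))

theorem lineSection_smul (k : Knot) {c : ℝ} (hc : 0 < c) (z : C4) :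
    lineSection k (c • z) = lineSection k z := by
  rw [lineSection, lineSection, rowProj_smul hc.ne', footPoint_smul hc]

theorem lineProj_lineSection (k : Knot) {q : Resolved} (hq : q.point ≠ 0) :
    lineProj q.base (lineSection k q.point) = lineSection k q.point := by
  rw [lineSection, rowProj_eq_lineProj q hq]
  exact projOn_projOn (lineVec_ne_zero _) _

/-- The line over `z` points in the direction `p / |p|` and the frame in the direction `k'`, both
translated by `k(t)⁻¹`. Their inner product is `ε / |p| ≥ 0`, so at least half of the squared length
of the frame survives the projection. This is where the shift of the conormal bundle enters. -/
theorem IsConormal.half_le_norm_lineSection {k : Knot} {ε t : ℝ} {z : C4}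
    (h : IsConormal k ε t z) (hε : 0 < ε) : 1 / 2 ≤ ‖lineSection k z‖ ^ 2 := by
  have hp := h.norm_imPart_pos hε
  have hn := h.norm_sq
  have hz2 : ‖z‖ ^ 2 ≠ 0 := by rw [hn]; positivity
  rw [lineSection, h.footPoint_eq hε, k.frameExt_apply, rowProj_eq_spin (h.ne_zero hε)]
  have hk : inner ℝ (k.toFun t) (imPart z) = 0 := by rw [real_inner_comm, h.inner_point]
  have hh := half_le_norm_spin (w := k.frame t) (τ := 2 * spinRe (rePart z) (imPart z) / ‖z‖ ^ 2)
    (ν := 2 * spinIm (rePart z) (imPart z) / (‖z‖ ^ 2 : ℝ)) ?_ ?_ (k.spin_frame t)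
  · rwa [k.norm_frame, one_pow] at hh
  · have h1 := spin_norm (rePart z) (imPart z)
    rw [h.re_eq, norm_smul, norm_norm, k.on_sphere, real_inner_smul_left, hk] at h1
    rw [norm_div, norm_mul, Complex.norm_real, Complex.norm_ofNat, Real.norm_of_nonneg
      (sq_nonneg _), hn, h.re_eq]
    field_simp
    linarith
  · have hre : ∀ b, spinRe (rePart z) b = ‖imPart z‖ * spinRe (k.toFun t) b := fun b => by
      rw [h.re_eq]
      simp [spinRe]
      ring
    have him : ∀ b, spinIm (rePart z) b = ‖imPart z‖ * spinIm (k.toFun t) b := fun b => by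
      rw [h.re_eq]
      simp [spinIm]
      ring
    have h1 := spin_inner (k.toFun t) (imPart z) (k.tangent t)
    rw [k.on_sphere, h.inner_tangent, hk] at h1
    have h2 : 2 * spinRe (rePart z) (imPart z) / ‖z‖ ^ 2 * spinRe (k.toFun t) (k.tangent t) +
        (starRingEnd ℂ (2 * spinIm (rePart z) (imPart z) / (‖z‖ ^ 2 : ℝ)) *
          spinIm (k.toFun t) (k.tangent t)).re = 2 * ‖imPart z‖ / ‖z‖ ^ 2 * ε := by
      have h3 : starRingEnd ℂ (2 * spinIm (rePart z) (imPart z) / (‖z‖ ^ 2 : ℝ)) *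
          spinIm (k.toFun t) (k.tangent t) = ((2 * ‖imPart z‖ / ‖z‖ ^ 2 : ℝ) : ℂ) *
            (starRingEnd ℂ (spinIm (k.toFun t) (imPart z)) * spinIm (k.toFun t) (k.tangent t)) := by
        rw [him, map_div₀, map_mul, map_mul, Complex.conj_ofReal, Complex.conj_ofReal,
          Complex.conj_ofNat]
        push_cast
        ring
      rw [h3, Complex.re_ofReal_mul, hre]
      linear_combination (2 * ‖imPart z‖ / ‖z‖ ^ 2) * h1
    rw [h2]
    positivity

/-- The Liouville form of complex four-space. -/
def liouville (z : C4) : C4 →L[ℝ] ℝ := (1 / 2 : ℝ) • imForm z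

/-- The radial factor of the conical Liouville form. -/
def coneFactor (ε ρ : ℝ) : ℝ := cut (ε ^ 2 / 2) ρ * (√ρ)⁻¹

/-- A primitive of the conical Kähler form, cut off near the origin. -/
def coneForm (ε : ℝ) (z : C4) : C4 →L[ℝ] ℝ := coneFactor ε (‖z‖ ^ 2) • liouville z

/-- The connection form of the tautological bundle over the projective line. -/
def connForm (s : C2) : C2 →L[ℝ] ℝ := (‖s‖ ^ 2)⁻¹ • imForm s

/-- A form which agrees with the Liouville form on the conifold transition of a shifted conormal
bundle. -/
def tangentForm (k : Knot) (ε : ℝ) (z : C4) : C4 →L[ℝ] ℝ :=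
  (-ε * cut (ε ^ 2) (‖z‖ ^ 2)) • (innerSL ℝ (k.tangentExt (footPoint z))).comp rePart

/-- A form which agrees with the pull-back of the connection form on the conifold transition of a
shifted conormal bundle. -/
def frameForm (k : Knot) (ε : ℝ) (z : C4) : C4 →L[ℝ] ℝ :=
  (cut (ε ^ 2) (‖z‖ ^ 2) * (cut (1 / 4) (‖lineSection k z‖ ^ 2) * (‖lineSection k z‖ ^ 2)⁻¹)) •
    (imForm (lineSection k z)).comp (fderiv ℝ (lineSection k) z)

/-- The boundary correction of the Kähler form. -/
def boundaryForm (k : Knot) (ε : ℝ) (z : C4) : C4 →L[ℝ] ℝ :=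
  tangentForm k ε z + (1 / 2 : ℝ) • frameForm k ε z

theorem contDiff_liouville : ContDiff ℝ ∞ liouville := by
  have : ContDiff ℝ ∞ fun z : C4 => (1 / 2 : ℝ) • imForm z :=
    (imForm (E := C4)).contDiff.const_smul (1 / 2 : ℝ)
  exact this

theorem formDeriv_liouville (z X Y : C4) : formDeriv liouville z X Y = (inner ℂ X Y).im := by
  have h : DifferentiableAt ℝ (fun z : C4 => imForm z) z := imForm.differentiableAt
  have := formDeriv_const_smul (c := 1 / 2) h X Y
  rw [formDeriv_imForm] at this
  change formDeriv (fun z => (1 / 2 : ℝ) • imForm z) z X Y = _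
  rw [this]
  ring

theorem contDiff_coneFactor {ε : ℝ} (hε : 0 < ε) : ContDiff ℝ ∞ (coneFactor ε) :=
  contDiff_cut_mul (by positivity) fun y hy =>
    (Real.contDiffAt_sqrt hy.ne').inv (Real.sqrt_ne_zero'.2 hy)

theorem contDiff_coneForm {ε : ℝ} (hε : 0 < ε) : ContDiff ℝ ∞ (coneForm ε) :=
  ((contDiff_coneFactor hε).comp (contDiff_norm_sq ℂ)).smul contDiff_liouville

theorem real_inner_eq_re (z X : C4) : inner ℝ z X = (inner ℂ z X).re := by
  simp [PiLp.inner_apply, Complex.inner]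

theorem hasFDerivAt_norm_sq (z : C4) :
    HasFDerivAt (fun z : C4 => ‖z‖ ^ 2) (2 • (innerSL ℝ z : C4 →L[ℝ] ℝ)) z :=
  (hasFDerivAt_id z).norm_sq

theorem formDeriv_coneForm {ε : ℝ} (hε : 0 < ε) (z Z : C4) :
    formDeriv (coneForm ε) z Z (Complex.I • Z) =
      deriv (coneFactor ε) (‖z‖ ^ 2) * ‖inner ℂ z Z‖ ^ 2 + coneFactor ε (‖z‖ ^ 2) * ‖Z‖ ^ 2 := by
  have h1 : HasFDerivAt (fun z : C4 => coneFactor ε (‖z‖ ^ 2))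
      (deriv (coneFactor ε) (‖z‖ ^ 2) • (2 • (innerSL ℝ z : C4 →L[ℝ] ℝ))) z :=
    (((contDiff_coneFactor hε).differentiable (by simp)) _).hasDerivAt.comp_hasFDerivAt z
      (hasFDerivAt_norm_sq z)
  have h2 := formDeriv_smul h1.differentiableAt
    (contDiff_liouville.differentiable (by simp) z) Z (Complex.I • Z)
  change formDeriv (fun z => coneFactor ε (‖z‖ ^ 2) • liouville z) z Z (Complex.I • Z) = _
  rw [h2, h1.fderiv, formDeriv_liouville]
  have hf : ∀ X : C4, (deriv (coneFactor ε) (‖z‖ ^ 2) • (2 • (innerSL ℝ z : C4 →L[ℝ] ℝ))) X =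
      deriv (coneFactor ε) (‖z‖ ^ 2) * (2 * (inner ℂ z X).re) := fun X => by
    rw [← real_inner_eq_re, two_smul, two_mul]
    rfl
  have hl : ∀ X : C4, liouville z X = 1 / 2 * (inner ℂ z X).im := fun X => rfl
  rw [hf, hf, hl, hl, inner_smul_right, inner_smul_right, inner_self_eq_norm_sq_to_K,
    Complex.sq_norm, Complex.normSq_apply]
  have h3 : (Complex.I * (‖Z‖ : ℂ) ^ 2).im = ‖Z‖ ^ 2 := by
    rw [← Complex.ofReal_pow, mul_comm, Complex.im_ofReal_mul, Complex.I_im, mul_one]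
  simp only [Complex.coe_algebraMap] at *
  rw [h3]
  simp only [Complex.mul_re, Complex.mul_im, Complex.I_re, Complex.I_im]
  ring

theorem coneFactor_nonneg (ε ρ : ℝ) : 0 ≤ coneFactor ε ρ :=
  mul_nonneg (cut_nonneg _ _) (inv_nonneg.2 (Real.sqrt_nonneg _))

/-- The cut-off is increasing and can only help; the other term is the derivative of `ρ^(-1/2)`. -/
theorem le_deriv_coneFactor {ε ρ : ℝ} (hε : 0 < ε) (hρ : 0 < ρ) :
    -(coneFactor ε ρ / (2 * ρ)) ≤ deriv (coneFactor ε) ρ := by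
  have hc : 0 < ε ^ 2 / 2 := by positivity
  have hs : 0 < √ρ := Real.sqrt_pos.2 hρ
  have h1 : HasDerivAt (cut (ε ^ 2 / 2)) (deriv (cut (ε ^ 2 / 2)) ρ) ρ :=
    ((contDiff_cut _).differentiable (by simp) ρ).hasDerivAt
  have h2 := h1.mul ((Real.hasDerivAt_sqrt hρ.ne').inv hs.ne')
  have h3 : HasDerivAt (coneFactor ε) _ ρ := h2
  rw [h3.deriv]
  have h4 : 0 ≤ deriv (cut (ε ^ 2 / 2)) ρ := (monotone_cut hc).deriv_nonneg
  have h5 : 0 ≤ deriv (cut (ε ^ 2 / 2)) ρ * (√ρ)⁻¹ := by positivity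
  have h6 : cut (ε ^ 2 / 2) ρ * (-(1 / (2 * √ρ)) / √ρ ^ 2) = -(coneFactor ε ρ / (2 * ρ)) := by
    rw [coneFactor, Real.sq_sqrt hρ.le]
    field_simp
  simp only [Pi.inv_apply] at *
  linarith

/-- By Cauchy–Schwarz the negative radial term consumes at most half of the term `coneFactor ·
‖Z‖²`. So `d (λ / |z|)` stays positive on complex lines, with size `1 / |z|`. -/
theorem half_coneFactor_le_formDeriv {ε : ℝ} (hε : 0 < ε) (z Z : C4) :
    coneFactor ε (‖z‖ ^ 2) / 2 * ‖Z‖ ^ 2 ≤ formDeriv (coneForm ε) z Z (Complex.I • Z) := by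
  rw [formDeriv_coneForm hε]
  have h0 := coneFactor_nonneg ε (‖z‖ ^ 2)
  by_cases hz : z = 0
  · subst hz
    simp only [inner_zero_left, norm_zero] at h0 ⊢
    generalize coneFactor ε (0 ^ 2) = c at h0
    nlinarith [mul_nonneg h0 (sq_nonneg ‖Z‖)]
  · have hρ : 0 < ‖z‖ ^ 2 := by positivity
    have h1 := le_deriv_coneFactor hε hρ
    have h2 : ‖inner ℂ z Z‖ ^ 2 ≤ ‖z‖ ^ 2 * ‖Z‖ ^ 2 := by
      rw [← mul_pow]
      gcongr
      exact norm_inner_le_norm z Z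
    have h3 : coneFactor ε (‖z‖ ^ 2) / (2 * ‖z‖ ^ 2) * ‖inner ℂ z Z‖ ^ 2 ≤
        coneFactor ε (‖z‖ ^ 2) / 2 * ‖Z‖ ^ 2 := by
      calc _ ≤ coneFactor ε (‖z‖ ^ 2) / (2 * ‖z‖ ^ 2) * (‖z‖ ^ 2 * ‖Z‖ ^ 2) := by gcongr
        _ = _ := by field_simp
    nlinarith [mul_le_mul_of_nonneg_right h1 (sq_nonneg ‖inner ℂ z Z‖)]

theorem coneFactor_eq {ε ρ : ℝ} (hε : 0 < ε) (hρ : ε ^ 2 ≤ ρ) : coneFactor ε ρ = (√ρ)⁻¹ := by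
  rw [coneFactor, cut_of_ge (by positivity) (by linarith), one_mul]

theorem contDiffAt_tangentForm (k : Knot) (ε : ℝ) {z : C4} (hz : z ≠ 0) :
    ContDiffAt ℝ ∞ (tangentForm k ε) z := by
  have h1 : ContDiffAt ℝ ∞ (fun z : C4 => -ε * cut (ε ^ 2) (‖z‖ ^ 2)) z :=
    contDiffAt_const.mul ((contDiff_cut _).comp (contDiff_norm_sq ℂ)).contDiffAt
  have h2 : ContDiffAt ℝ ∞ (fun z : C4 => innerSL ℝ (k.tangentExt (footPoint z))) z :=
    (innerSL ℝ).contDiff.contDiffAt.comp z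
      (k.contDiff_tangentExt.contDiffAt.comp z (contDiffAt_footPoint hz))
  exact h1.smul (h2.clm_comp contDiffAt_const)

/-- The second cut-off is needed because the section `lineSection` may vanish off `L`. It is
inactive on `L`, where the squared length of the section is at least `1/2`. -/
theorem contDiffAt_frameForm (k : Knot) (ε : ℝ) {z : C4} (hz : z ≠ 0) :
    ContDiffAt ℝ ∞ (frameForm k ε) z := by
  have hs := contDiffAt_lineSection k hz
  have h1 : ContDiffAt ℝ ∞ (fun z : C4 => cut (ε ^ 2) (‖z‖ ^ 2)) z :=
    ((contDiff_cut _).comp (contDiff_norm_sq ℂ)).contDiffAt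
  have h2 : ContDiff ℝ ∞ fun y : ℝ => cut (1 / 4) y * y⁻¹ :=
    contDiff_cut_mul (by norm_num) fun y hy => contDiffAt_inv ℝ hy.ne'
  have h3 : ContDiffAt ℝ ∞ (fun z : C4 =>
      cut (1 / 4) (‖lineSection k z‖ ^ 2) * (‖lineSection k z‖ ^ 2)⁻¹) z :=
    h2.contDiffAt.comp z (hs.norm_sq ℂ)
  have h4 : ContDiffAt ℝ ∞ (fun z : C4 => imForm (lineSection k z)) z :=
    imForm.contDiff.contDiffAt.comp z hs
  exact (h1.mul h3).smul (h4.clm_comp (hs.fderiv_right (by simp)))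

theorem boundaryForm_of_lt (k : Knot) {ε : ℝ} (hε : 0 < ε) {z : C4} (hz : ‖z‖ < ε) :
    boundaryForm k ε z = 0 := by
  have : cut (ε ^ 2) (‖z‖ ^ 2) = 0 := cut_of_le (by positivity) (by gcongr)
  rw [boundaryForm, tangentForm, frameForm, this]
  simp

theorem boundaryForm_eventuallyEq (k : Knot) {ε : ℝ} (hε : 0 < ε) {z : C4} (hz : ‖z‖ < ε) :
    boundaryForm k ε =ᶠ[𝓝 z] fun _ => 0 := by
  filter_upwards [(isOpen_lt continuous_norm continuous_const).mem_nhds hz] with w hw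
  exact boundaryForm_of_lt k hε hw

theorem contDiff_boundaryForm (k : Knot) {ε : ℝ} (hε : 0 < ε) :
    ContDiff ℝ ∞ (boundaryForm k ε) := by
  rw [contDiff_iff_contDiffAt]
  intro z
  rcases lt_or_ge ‖z‖ ε with hz | hz
  · exact contDiffAt_const.congr_of_eventuallyEq (boundaryForm_eventuallyEq k hε hz)
  · have hz0 : z ≠ 0 := norm_pos_iff.1 (hε.trans_le hz)
    exact (contDiffAt_tangentForm k ε hz0).add
      ((contDiffAt_frameForm k ε hz0).const_smul (1 / 2 : ℝ))

theorem fderiv_lineSection_smul (k : Knot) {c : ℝ} (hc : 0 < c) (z : C4) :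
    fderiv ℝ (lineSection k) (c • z) = c⁻¹ • fderiv ℝ (lineSection k) z := by
  have h := fderiv_comp_smul (𝕜 := ℝ) (f := lineSection k) (x := z) c
  simp_rw [lineSection_smul k hc] at h
  rw [h]
  exact (inv_smul_smul₀ hc.ne' _).symm

/-- Both pieces are homogeneous outside radius `2ε`, where the cut-off in `‖z‖` is `1`: the
coefficients of `tangentForm` have degree `0`, and those of `frameForm` have degree `-1` because
they contain a derivative of the scale-invariant `lineSection`. -/
theorem exists_fderiv_boundaryForm_bound (k : Knot) {ε : ℝ} (hε : 0 < ε) :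
    ∃ C, 0 ≤ C ∧ ∀ z, ε ≤ ‖z‖ → ‖fderiv ℝ (boundaryForm k ε) z‖ ≤ C / ‖z‖ := by
  have hR : 0 < 2 * ε := by positivity
  have hcut : ∀ (z : C4) (c : ℝ), 2 * ε < ‖z‖ → 1 ≤ c →
      cut (ε ^ 2) (‖c • z‖ ^ 2) = cut (ε ^ 2) (‖z‖ ^ 2) := fun z c hz hc => by
    have h1 : 2 * ε < ‖c • z‖ := by
      rw [norm_smul, Real.norm_of_nonneg (by linarith)]
      nlinarith [norm_nonneg z]
    rw [cut_of_ge (by positivity) (by nlinarith), cut_of_ge (by positivity) (by nlinarith)]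
  have hone : (1 : ℕ∞ω) ≤ (∞ : ℕ∞ω) := by norm_cast
  obtain ⟨C₁, h₁, hC₁⟩ := exists_fderiv_bound (d := 0)
    (fun z hz => (contDiffAt_tangentForm k ε hz).of_le hone) hR hε fun z c hz hc => by
      rw [tangentForm, tangentForm, hcut z c hz hc, footPoint_smul (by linarith), pow_zero,
        one_smul]
  obtain ⟨C₂, h₂, hC₂⟩ := exists_fderiv_bound (d := 1)
    (fun z hz => (contDiffAt_frameForm k ε hz).of_le hone) hR hε fun z c hz hc => by
      have hc0 : 0 < c := by linarith
      rw [frameForm, frameForm, hcut z c hz hc, lineSection_smul k hc0,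
        fderiv_lineSection_smul k hc0, pow_one]
      ext X
      simp only [smul_apply, ContinuousLinearMap.comp_apply, map_smul, smul_eq_mul]
      ring
  refine ⟨C₁ + C₂, by positivity, fun z hz => ?_⟩
  have hz0 : z ≠ 0 := norm_pos_iff.1 (hε.trans_le hz)
  have hzp : 0 < ‖z‖ := norm_pos_iff.2 hz0
  have d₁ : DifferentiableAt ℝ (tangentForm k ε) z :=
    (contDiffAt_tangentForm k ε hz0).differentiableAt (by simp)
  have d₂ : DifferentiableAt ℝ (frameForm k ε) z :=
    (contDiffAt_frameForm k ε hz0).differentiableAt (by simp)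
  have h : fderiv ℝ (boundaryForm k ε) z =
      fderiv ℝ (tangentForm k ε) z + (1 / 2 : ℝ) • fderiv ℝ (frameForm k ε) z :=
    (d₁.hasFDerivAt.add (d₂.hasFDerivAt.const_smul (1 / 2 : ℝ))).fderiv
  rw [h, add_div]
  refine (norm_add_le _ _).trans (add_le_add (hC₁ z hz) ?_)
  rw [norm_smul]
  refine le_trans ?_ (hC₂ z hz)
  have : ‖(1 / 2 : ℝ)‖ ≤ 1 := by norm_num
  exact mul_le_of_le_one_left (norm_nonneg _) this

/-- On complex lines, the exterior derivative of the boundary correction is dominated by the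
conical Kähler form. -/
theorem exists_formDeriv_boundaryForm_le (k : Knot) {ε : ℝ} (hε : 0 < ε) :
    ∃ C, 0 ≤ C ∧ ∀ z Z : C4, formDeriv (boundaryForm k ε) z Z (Complex.I • Z) ≤
      C * formDeriv (coneForm ε) z Z (Complex.I • Z) := by
  obtain ⟨C, hC0, hC⟩ := exists_fderiv_boundaryForm_bound k hε
  -- One factor `2` comes from the antisymmetrisation in the exterior derivative, the other from the
  -- `1/2` in the lower bound for the conical form. For `‖z‖ < ε` the correction vanishes; beyond
  -- that `coneFactor` is exactly `1 / ‖z‖`.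
  refine ⟨4 * C, by positivity, fun z Z => ?_⟩
  have hpos := half_coneFactor_le_formDeriv hε z Z
  rcases lt_or_ge ‖z‖ ε with hz | hz
  · have h0 : formDeriv (boundaryForm k ε) z Z (Complex.I • Z) = 0 := by
      rw [formDeriv, (boundaryForm_eventuallyEq k hε hz).fderiv_eq]
      simp
    rw [h0]
    have := coneFactor_nonneg ε (‖z‖ ^ 2)
    exact mul_nonneg (by positivity) (le_trans (by positivity) hpos)
  · have hzp : 0 < ‖z‖ := hε.trans_le hz
    rw [coneFactor_eq hε (by gcongr), Real.sqrt_sq hzp.le] at hpos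
    have h1 := (le_abs_self _).trans
      (abs_formDeriv_le (boundaryForm k ε) z Z (Complex.I • Z))
    rw [norm_smul, Complex.norm_I, one_mul] at h1
    calc _ ≤ 2 * (C / ‖z‖) * (‖Z‖ * ‖Z‖) := h1.trans (by
          have := hC z hz
          gcongr)
      _ = 4 * C * (‖z‖⁻¹ / 2 * ‖Z‖ ^ 2) := by
          field_simp
          ring
      _ ≤ _ := by gcongr

/-! ### The one-forms on the boundary condition -/

theorem imForm_eq (z Z : C4) :
    imForm z Z = inner ℝ (rePart z) (imPart Z) - inner ℝ (imPart z) (rePart Z) := by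
  change (inner ℂ z Z).im = _
  simp only [PiLp.inner_apply, RCLike.inner_apply, Complex.im_sum, ← Finset.sum_sub_distrib]
  refine Finset.sum_congr rfl fun i _ => ?_
  simp [rePart, imPart, Complex.mul_im]
  ring

theorem rePart_eq_smul_footPoint {z : C4} (hz : z ≠ 0) :
    rePart z = (‖z‖ / √2) • footPoint z := by
  have : ‖z‖ ≠ 0 := norm_ne_zero_iff.2 hz
  rw [footPoint, smul_smul]
  field_simp
  simp

/-- With `z = |p| k + i p` the foot point moves with velocity `c k'`, so `Re z' = |p| c k' + |p|'
k`. Differentiating `⟨Re z, Im z⟩ = 0` turns the Liouville form into `-⟨p, Re z'⟩`, which equals `-ε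
|p| c` because `p · k = 0` and `p · k' = ε`. -/
theorem imForm_derivWithin {k : Knot} {ε : ℝ} (hε : 0 < ε) {z : ℝ → C4}
    (hz : DifferentiableOn ℝ z (Icc 0 1)) (hL : ∀ τ ∈ Icc (0 : ℝ) 1, ∃ t, IsConormal k ε t (z τ))
    {τ : ℝ} (hτ : τ ∈ Icc (0 : ℝ) 1) :
    ∃ t c : ℝ, IsConormal k ε t (z τ) ∧
      HasDerivWithinAt (fun r => footPoint (z r)) (c • k.tangent t) (Icc 0 1) τ ∧
      liouville (z τ) (derivWithin z (Icc 0 1) τ) = -ε * ‖imPart (z τ)‖ * c ∧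
      inner ℝ (k.tangent t) (rePart (derivWithin z (Icc 0 1) τ)) = ‖imPart (z τ)‖ * c := by
  obtain ⟨t, ht⟩ := hL τ hτ
  have h0 : z τ ≠ 0 := ht.ne_zero hε
  have hd : HasDerivWithinAt z (derivWithin z (Icc 0 1) τ) (Icc 0 1) τ :=
    (hz τ hτ).hasDerivWithinAt
  have hu : UniqueDiffWithinAt ℝ (Icc (0 : ℝ) 1) τ := uniqueDiffOn_Icc_zero_one τ hτ
  set z' := derivWithin z (Icc 0 1) τ
  have hx : HasDerivWithinAt (fun r => footPoint (z r)) (fderiv ℝ footPoint (z τ) z')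
      (Icc 0 1) τ :=
    ((contDiffAt_footPoint h0).differentiableAt (by simp)).hasFDerivAt.comp_hasDerivWithinAt τ hd
  obtain ⟨c, hc⟩ := k.exists_smul_tangent hx hu
    (fun r hr => by
      obtain ⟨s, hs⟩ := hL r hr
      exact ⟨s, (hs.footPoint_eq hε).symm⟩) hτ (ht.footPoint_eq hε)
  rw [hc] at hx
  have hn : DifferentiableWithinAt ℝ (fun r => ‖z r‖ / √2) (Icc 0 1) τ :=
    ((hd.differentiableWithinAt).norm ℝ h0).div_const _
  have ha : HasDerivWithinAt (fun r => rePart (z r)) (rePart z') (Icc 0 1) τ :=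
    rePart.hasFDerivAt.comp_hasDerivWithinAt τ hd
  have hb : HasDerivWithinAt (fun r => imPart (z r)) (imPart z') (Icc 0 1) τ :=
    imPart.hasFDerivAt.comp_hasDerivWithinAt τ hd
  have ha2 : HasDerivWithinAt (fun r => rePart (z r)) ((‖z τ‖ / √2) • (c • k.tangent t) +
      derivWithin (fun r => ‖z r‖ / √2) (Icc 0 1) τ • footPoint (z τ)) (Icc 0 1) τ := by
    refine (hn.hasDerivWithinAt.smul hx).congr (fun r hr => ?_) (rePart_eq_smul_footPoint h0)
    obtain ⟨s, hs⟩ := hL r hr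
    exact rePart_eq_smul_footPoint (hs.ne_zero hε)
  have ha' := hu.eq_deriv _ ha ha2
  have hnorm : ‖z τ‖ / √2 = ‖imPart (z τ)‖ := by
    rw [ht.norm_eq]
    field_simp
  rw [hnorm, ht.footPoint_eq hε] at ha'
  have hab : HasDerivWithinAt (fun r => inner ℝ (rePart (z r)) (imPart (z r)))
      (inner ℝ (rePart (z τ)) (imPart z') + inner ℝ (rePart z') (imPart (z τ))) (Icc 0 1) τ :=
    ha.inner ℝ hb
  have hab0 : HasDerivWithinAt (fun r => inner ℝ (rePart (z r)) (imPart (z r))) (0 : ℝ)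
      (Icc 0 1) τ := by
    have h : ∀ r ∈ Icc (0 : ℝ) 1, inner ℝ (rePart (z r)) (imPart (z r)) = 0 := fun r hr => by
      obtain ⟨s, hs⟩ := hL r hr
      rw [hs.re_eq, real_inner_smul_left, real_inner_comm, hs.inner_point, mul_zero]
    exact (hasDerivWithinAt_const τ _ (0 : ℝ)).congr h (h τ hτ)
  have hsum := hu.eq_deriv _ hab hab0
  have hT : inner ℝ (k.tangent t) (k.toFun t) = 0 := by rw [real_inner_comm, k.inner_tangent]
  refine ⟨t, c, ht, hx, ?_, ?_⟩
  · have h1 : inner ℝ (imPart (z τ)) (rePart z') = ‖imPart (z τ)‖ * c * ε := by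
      rw [ha', inner_add_right, real_inner_smul_right, real_inner_smul_right,
        real_inner_smul_right, ht.inner_tangent, ht.inner_point]
      ring
    change 1 / 2 * imForm (z τ) z' = _
    rw [imForm_eq, h1]
    rw [real_inner_comm] at h1
    rw [h1] at hsum
    linarith
  · rw [ha', inner_add_right, real_inner_smul_right, real_inner_smul_right,
      real_inner_smul_right, hT, real_inner_self_eq_norm_sq, k.norm_tangent]
    ring

/-- On `L` every cut-off is `1`. There `tangentForm` reproduces the Liouville form by
`imForm_derivWithin`, and `frameForm` is the pull-back of the connection form by `lineSection`. -/
theorem pathIntegral_boundaryForm {k : Knot} {ε : ℝ} (hε : 0 < ε) {z : ℝ → C4}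
    (hz : ContDiffOn ℝ ∞ z (Icc 0 1))
    (hL : ∀ τ ∈ Icc (0 : ℝ) 1, ∃ t, IsConormal k ε t (z τ)) :
    (1 / 2) * pathIntegral connForm (fun τ => lineSection k (z τ)) + pathIntegral liouville z -
      pathIntegral (boundaryForm k ε) z = 0 := by
  have hz1 : DifferentiableOn ℝ z (Icc 0 1) := hz.differentiableOn (by simp)
  have hz0 : ∀ τ ∈ Icc (0 : ℝ) 1, z τ ≠ 0 := fun τ hτ => by
    obtain ⟨t, ht⟩ := hL τ hτ
    exact ht.ne_zero hε
  have hs : ContDiffOn ℝ ∞ (fun τ => lineSection k (z τ)) (Icc 0 1) := fun τ hτ =>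
    (contDiffAt_lineSection k (hz0 τ hτ)).comp_contDiffWithinAt τ (hz τ hτ)
  have hsn : ∀ τ ∈ Icc (0 : ℝ) 1, 1 / 2 ≤ ‖lineSection k (z τ)‖ ^ 2 := fun τ hτ => by
    obtain ⟨t, ht⟩ := hL τ hτ
    exact ht.half_le_norm_lineSection hε
  have key : ∀ τ ∈ Icc (0 : ℝ) 1, boundaryForm k ε (z τ) (derivWithin z (Icc 0 1) τ) =
      (1 / 2) * connForm (lineSection k (z τ))
        (derivWithin (fun τ => lineSection k (z τ)) (Icc 0 1) τ) +
      liouville (z τ) (derivWithin z (Icc 0 1) τ) := fun τ hτ => by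
    obtain ⟨t, c, ht, hx, h1, h2⟩ := imForm_derivWithin hε hz1 hL hτ
    have hcut : cut (ε ^ 2) (‖z τ‖ ^ 2) = 1 := cut_of_ge (by positivity) (ht.le_norm_sq hε)
    have hcut2 : cut (1 / 4) (‖lineSection k (z τ)‖ ^ 2) = 1 :=
      cut_of_ge (by norm_num) (by linarith [hsn τ hτ])
    have hd : derivWithin (fun τ => lineSection k (z τ)) (Icc 0 1) τ =
        fderiv ℝ (lineSection k) (z τ) (derivWithin z (Icc 0 1) τ) :=
      (((contDiffAt_lineSection k (hz0 τ hτ)).differentiableAt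
        (by simp)).hasFDerivAt.comp_hasDerivWithinAt τ
          (hz1 τ hτ).hasDerivWithinAt).derivWithin (uniqueDiffOn_Icc_zero_one τ hτ)
    have ht1 : tangentForm k ε (z τ) (derivWithin z (Icc 0 1) τ) =
        liouville (z τ) (derivWithin z (Icc 0 1) τ) := by
      rw [h1, tangentForm, hcut, ht.footPoint_eq hε, k.tangentExt_apply]
      change -ε * 1 * inner ℝ (k.tangent t) (rePart (derivWithin z (Icc 0 1) τ)) = _
      rw [h2]
      ring
    have ht2 : frameForm k ε (z τ) (derivWithin z (Icc 0 1) τ) = connForm (lineSection k (z τ))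
        (derivWithin (fun τ => lineSection k (z τ)) (Icc 0 1) τ) := by
      rw [frameForm, hcut, hcut2, one_mul, one_mul, hd]
      rfl
    rw [← ht1, ← ht2, boundaryForm]
    change tangentForm k ε (z τ) _ + 1 / 2 * frameForm k ε (z τ) _ = _
    ring
  have hdz : ContinuousOn (derivWithin z (Icc 0 1)) (Icc 0 1) :=
    hz.continuousOn_derivWithin uniqueDiffOn_Icc_zero_one (by simp)
  have hds : ContinuousOn (derivWithin (fun τ => lineSection k (z τ)) (Icc 0 1)) (Icc 0 1) :=
    hs.continuousOn_derivWithin uniqueDiffOn_Icc_zero_one (by simp)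
  have i1 : IntervalIntegrable (fun τ => connForm (lineSection k (z τ))
        (derivWithin (fun τ => lineSection k (z τ)) (Icc 0 1) τ)) volume 0 1 := by
    refine ContinuousOn.intervalIntegrable ?_
    rw [uIcc_of_le zero_le_one]
    have h1 : ContinuousOn (fun τ => connForm (lineSection k (z τ))) (Icc 0 1) :=
      ((hs.continuousOn.norm.pow 2).inv₀ fun τ hτ => ne_of_gt
        (lt_of_lt_of_le (by norm_num) (hsn τ hτ))).smul
        (imForm.continuous.comp_continuousOn hs.continuousOn)
    exact h1.clm_apply hds
  have i2 : IntervalIntegrable (fun τ => liouville (z τ) (derivWithin z (Icc 0 1) τ))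
      volume 0 1 := by
    refine ContinuousOn.intervalIntegrable ?_
    rw [uIcc_of_le zero_le_one]
    exact (contDiff_liouville.continuous.comp_continuousOn hz.continuousOn).clm_apply hdz
  rw [sub_eq_zero]
  unfold pathIntegral
  rw [← intervalIntegral.integral_const_mul, ← intervalIntegral.integral_add (i1.const_mul _) i2]
  refine intervalIntegral.integral_congr fun τ hτ => ?_
  rw [uIcc_of_le zero_le_one] at hτ
  exact (key τ hτ).symm

/-- Division by `‖z‖ = √2 |p|` turns `-ε |p| c` into `-(ε / √2) c`. Here `c` is the speed of the
knot parameter, which is `length / 2π` times the imaginary part of the logarithmic derivative of the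
angle. -/
theorem pathIntegral_coneForm {k : Knot} {ε : ℝ} (hε : 0 < ε) {z : ℝ → C4}
    (hz : ContDiffOn ℝ ∞ z (Icc 0 1))
    (hL : ∀ τ ∈ Icc (0 : ℝ) 1, ∃ t, IsConormal k ε t (z τ)) :
    pathIntegral (coneForm ε) z = -(ε * k.length / (2 * Real.pi * √2)) *
      (logIncr fun τ => k.angleExt (footPoint (z τ))).im := by
  have hz1 : DifferentiableOn ℝ z (Icc 0 1) := hz.differentiableOn (by simp)
  have hz0 : ∀ τ ∈ Icc (0 : ℝ) 1, z τ ≠ 0 := fun τ hτ => by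
    obtain ⟨t, ht⟩ := hL τ hτ
    exact ht.ne_zero hε
  have hg : ContDiffOn ℝ ∞ (fun τ => k.angleExt (footPoint (z τ))) (Icc 0 1) := fun τ hτ =>
    k.contDiff_angleExt.contDiffAt.comp_contDiffWithinAt τ
      ((contDiffAt_footPoint (hz0 τ hτ)).comp_contDiffWithinAt τ (hz τ hτ))
  have hg0 : ∀ τ ∈ Icc (0 : ℝ) 1, k.angleExt (footPoint (z τ)) ≠ 0 := fun τ hτ => by
    obtain ⟨t, ht⟩ := hL τ hτ
    rw [ht.footPoint_eq hε, k.angleExt_apply]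
    exact k.angle_ne_zero t
  have hg1 : ContDiffOn ℝ 1 (fun τ => k.angleExt (footPoint (z τ))) (Icc 0 1) :=
    hg.of_le (by norm_cast)
  rw [logIncr_eq_integral hg1 hg0]
  have hi : IntervalIntegrable (fun τ => derivWithin (fun τ => k.angleExt (footPoint (z τ)))
      (Icc 0 1) τ / k.angleExt (footPoint (z τ))) volume 0 1 := by
    refine ContinuousOn.intervalIntegrable ?_
    rw [uIcc_of_le zero_le_one]
    exact (hg.continuousOn_derivWithin uniqueDiffOn_Icc_zero_one (by simp)).div
      hg.continuousOn hg0
  have him := Complex.imCLM.intervalIntegral_comp_comm hi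
  simp only [Complex.imCLM_apply] at him
  rw [← him, ← intervalIntegral.integral_const_mul]
  refine intervalIntegral.integral_congr fun τ hτ => ?_
  rw [uIcc_of_le zero_le_one] at hτ
  obtain ⟨t, c, ht, hx, h1, -⟩ := imForm_derivWithin hε hz1 hL hτ
  have hk : fderiv ℝ k.angleExt (k.toFun t) (k.tangent t) =
      ((2 * Real.pi / k.length : ℝ) : ℂ) * Complex.I * k.angle t := by
    have e1 : HasDerivAt (fun s => k.angleExt (k.toFun s))
        (fderiv ℝ k.angleExt (k.toFun t) (k.tangent t)) t :=
      (k.contDiff_angleExt.differentiable (by simp) _).hasFDerivAt.comp_hasDerivAt t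
        (k.hasDerivAt t)
    simp only [k.angleExt_apply] at e1
    exact e1.unique (k.hasDerivAt_angle t)
  have hd : derivWithin (fun τ => k.angleExt (footPoint (z τ))) (Icc 0 1) τ =
      c • (((2 * Real.pi / k.length : ℝ) : ℂ) * Complex.I * k.angle t) := by
    have e1 : HasDerivWithinAt (fun τ => k.angleExt (footPoint (z τ)))
        (fderiv ℝ k.angleExt (footPoint (z τ)) (c • k.tangent t)) (Icc 0 1) τ :=
      (k.contDiff_angleExt.differentiable (by simp) _).hasFDerivAt.comp_hasDerivWithinAt τ hx
    rw [e1.derivWithin (uniqueDiffOn_Icc_zero_one τ hτ), ht.footPoint_eq hε, map_smul, hk]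
  have hn := ht.norm_imPart_pos hε
  have hl : coneForm ε (z τ) (derivWithin z (Icc 0 1) τ) = -(ε / √2) * c := by
    change coneFactor ε (‖z τ‖ ^ 2) * liouville (z τ) (derivWithin z (Icc 0 1) τ) = _
    have := ht.le_norm_sq hε
    rw [h1, coneFactor_eq hε (by nlinarith), Real.sqrt_sq (norm_nonneg _), ht.norm_eq]
    field_simp
  have hq : (derivWithin (fun τ => k.angleExt (footPoint (z τ))) (Icc 0 1) τ /
      k.angleExt (footPoint (z τ))).im = c * (2 * Real.pi / k.length) := by
    have ha := k.angle_ne_zero t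
    rw [hd, ht.footPoint_eq hε, k.angleExt_apply, Complex.real_smul, ← mul_assoc, ← mul_assoc,
      mul_div_assoc, div_self ha, mul_one, ← Complex.ofReal_mul, Complex.im_ofReal_mul,
      Complex.I_im, mul_one]
  change coneForm ε (z τ) (derivWithin z (Icc 0 1) τ) = _ * Complex.im _
  rw [hl, hq]
  have := k.length_pos
  have := Real.pi_pos
  field_simp

/-! ### Singular cochains -/

section Cochains

variable {X : Type*} [TopologicalSpace X] {n : ℕ}

/-- The singular cochain with given values on simplices. -/
def cochain (φ : C(stdSimplex ℝ (Fin (n + 1)), X) → ℝ) : Chain n X →+ ℝ :=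
  Finsupp.liftAddHom fun σ => zmultiplesHom ℝ (φ σ)

theorem cochain_single (φ : C(stdSimplex ℝ (Fin (n + 1)), X) → ℝ) (σ) (m : ℤ) :
    cochain φ (Finsupp.single σ m) = m * φ σ := by
  simp [cochain]

theorem bdry_single (σ : C(stdSimplex ℝ (Fin (n + 2)), X)) :
    bdry n X (Finsupp.single σ 1) =
      ∑ i : Fin (n + 2), (-1 : ℤ) ^ (i : ℕ) • Finsupp.single (σ.comp (face n i)) 1 := by
  simp [bdry]

theorem cochain_bdry_single (φ : C(stdSimplex ℝ (Fin (n + 1)), X) → ℝ)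
    (σ : C(stdSimplex ℝ (Fin (n + 2)), X)) :
    cochain φ (bdry n X (Finsupp.single σ 1)) =
      ∑ i : Fin (n + 2), (-1) ^ (i : ℕ) * φ (σ.comp (face n i)) := by
  rw [bdry_single, map_sum]
  refine Finset.sum_congr rfl fun i _ => ?_
  rw [map_zsmul, cochain_single]
  simp

/-- Allows a cochain to be replaced by another one that agrees with it only on simplices in `A`,
although the simplices of an unreduced sum need not lie in `A` individually. -/
theorem cochain_congr {A : Set X} {φ ψ : C(stdSimplex ℝ (Fin (n + 1)), X) → ℝ}
    (h : ∀ σ, (∀ x, σ x ∈ A) → φ σ = ψ σ) {c : Chain n X} (hc : c ∈ chainsIn n A) :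
    cochain φ c = cochain ψ c := by
  have : chainsIn n A ≤ (cochain φ).eqLocus (cochain ψ) := by
    refine (AddSubgroup.closure_le _).2 ?_
    rintro _ ⟨σ, hσ, rfl⟩
    change cochain φ _ = cochain ψ _
    rw [cochain_single, cochain_single, h σ hσ]
  exact this hc

theorem cochain_eq_zero {A : Set X} {φ : C(stdSimplex ℝ (Fin (n + 1)), X) → ℝ}
    (h : ∀ σ, (∀ x, σ x ∈ A) → φ σ = 0) {c : Chain n X} (hc : c ∈ chainsIn n A) :
    cochain φ c = 0 := by
  have h0 : cochain (fun _ : C(stdSimplex ℝ (Fin (n + 1)), X) => (0 : ℝ)) = 0 := by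
    ext σ : 2
    simp [cochain_single]
  rw [cochain_congr (ψ := fun _ => 0) h hc, h0, AddMonoidHom.zero_apply]

theorem face_comp_face {i i' : Fin (n + 3)} {j j' : Fin (n + 2)}
    (h : ∀ a, i.succAbove (j.succAbove a) = i'.succAbove (j'.succAbove a)) :
    (face (n + 1) i).comp (face n j) = (face (n + 1) i').comp (face n j') := by
  ext x : 1
  change stdSimplex.map _ (stdSimplex.map _ x) = stdSimplex.map _ (stdSimplex.map _ x)
  rw [stdSimplex.map_comp_apply, stdSimplex.map_comp_apply]
  congr 1
  exact funext h

theorem bdry_bdry (c : Chain 3 X) : bdry 1 X (bdry 2 X c) = 0 := by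
  have h : (bdry 1 X).comp (bdry 2 X) = 0 := by
    ext σ : 2
    have h1 : (face 2 1).comp (face 1 0) = (face 2 0).comp (face 1 0) :=
      face_comp_face (by decide)
    have h2 : (face 2 2).comp (face 1 0) = (face 2 0).comp (face 1 1) :=
      face_comp_face (by decide)
    have h3 : (face 2 3).comp (face 1 0) = (face 2 0).comp (face 1 2) :=
      face_comp_face (by decide)
    have h4 : (face 2 2).comp (face 1 1) = (face 2 1).comp (face 1 1) :=
      face_comp_face (by decide)
    have h5 : (face 2 3).comp (face 1 1) = (face 2 1).comp (face 1 2) :=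
      face_comp_face (by decide)
    have h6 : (face 2 3).comp (face 1 2) = (face 2 2).comp (face 1 2) :=
      face_comp_face (by decide)
    have e4 : ∀ f : Fin (2 + 2) → Chain 1 X, ∑ i, f i = f 0 + f 1 + f 2 + f 3 :=
      Fin.sum_univ_four
    have e3 : ∀ f : Fin (1 + 2) → Chain 1 X, ∑ i, f i = f 0 + f 1 + f 2 := Fin.sum_univ_three
    simp only [AddMonoidHom.comp_apply, Finsupp.singleAddHom_apply, bdry_single, map_sum,
      map_zsmul]
    rw [e4]
    simp only [e3, ContinuousMap.comp_assoc, h1, h2, h3, h4, h5, h6]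
    simp
    abel
  exact DFunLike.congr_fun h c

end Cochains

/-! ### The edges of a singular triangle -/

/-- The parametrisation of the standard one-simplex by the unit interval. -/
def edge (τ : ℝ) : stdSimplex ℝ (Fin 2) :=
  stdSimplexHomeomorphUnitInterval.symm (projIcc 0 1 zero_le_one τ)

theorem continuous_edge : Continuous edge :=
  stdSimplexHomeomorphUnitInterval.symm.continuous.comp continuous_projIcc

theorem edge_apply_zero {τ : ℝ} (hτ : τ ∈ Icc (0 : ℝ) 1) : edge τ 0 = 1 - τ := by
  rw [edge, projIcc_of_mem _ hτ]
  rfl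

theorem edge_apply_one {τ : ℝ} (hτ : τ ∈ Icc (0 : ℝ) 1) : edge τ 1 = τ := by
  rw [edge, projIcc_of_mem _ hτ]
  rfl

theorem edge_zero : edge 0 = stdSimplex.vertex 0 := by
  ext i
  fin_cases i
  · simp [edge_apply_zero]
  · simp [edge_apply_one]

theorem edge_one : edge 1 = stdSimplex.vertex 1 := by
  ext i
  fin_cases i
  · simp [edge_apply_zero]
  · simp [edge_apply_one]

theorem face_vertex {n : ℕ} (i : Fin (n + 2)) (j : Fin (n + 1)) :
    face n i (stdSimplex.vertex j) = stdSimplex.vertex (i.succAbove j) :=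
  stdSimplex.map_vertex _ _

/-- The affine parametrisations of the edges of the standard triangle. -/
def edgeLine (i : Fin 3) (τ : ℝ) : ℝ × ℝ :=
  ![(1 - τ, τ), (0, τ), (τ, 0)] i

theorem face_edge (i : Fin 3) {τ : ℝ} (hτ : τ ∈ Icc (0 : ℝ) 1) :
    (face 1 i (edge τ) 1, face 1 i (edge τ) 2) = edgeLine i τ := by
  have h : ∀ a, face 1 i (edge τ) a = ∑ j : Fin 2, if i.succAbove j = a then edge τ j else 0 := by
    intro a
    change FunOnFinite.linearMap ℝ ℝ _ _ a = _
    rw [FunOnFinite.linearMap_apply_apply, Finset.sum_filter]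
  rw [h, h, Fin.sum_univ_two, Fin.sum_univ_two, edge_apply_zero hτ, edge_apply_one hτ]
  fin_cases i <;> simp [edgeLine, Fin.succAbove, Fin.ext_iff]

/-- The alternating sum of the logarithmic increments along the edges of a triangle vanishes. -/
theorem sum_logIncr_face {g : stdSimplex ℝ (Fin 3) → ℂ} (hg : Continuous g)
    (hg0 : ∀ x, g x ≠ 0) :
    ∑ i : Fin 3, (-1 : ℂ) ^ (i : ℕ) * logIncr (fun τ => g (face 1 i (edge τ))) = 0 := by
  have hext : ∀ x, Function.extend Subtype.val g 1 x.1 = g x := fun x =>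
    Subtype.val_injective.extend_apply _ _ _
  -- A logarithm on the whole triangle exists, so each increment is a difference of vertex values
  -- and the alternating sum telescopes.
  obtain ⟨G, hG, he⟩ := exists_continuousOn_log (isCompact_stdSimplex ℝ (Fin 3))
    (convex_stdSimplex ℝ (Fin 3)) ⟨_, (stdSimplex.vertex 0).2⟩
    (g := Function.extend Subtype.val g 1)
    (by
      rw [continuousOn_iff_continuous_domRestrict]
      convert hg using 1
      exact funext hext)
    (fun x hx => by
      rw [hext ⟨x, hx⟩]
      exact hg0 _)
  have hG' : Continuous fun x : stdSimplex ℝ (Fin 3) => G x.1 :=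
    continuousOn_iff_continuous_domRestrict.1 hG
  have hi : ∀ i : Fin 3, logIncr (fun τ => g (face 1 i (edge τ))) =
      G (stdSimplex.vertex (S := ℝ) (i.succAbove 1)).1 -
        G (stdSimplex.vertex (S := ℝ) (i.succAbove 0)).1 := fun i => by
    rw [logIncr_eq (G := fun τ => G (face 1 i (edge τ)).1)
      (hG'.comp ((face 1 i).continuous.comp continuous_edge)).continuousOn
      (fun x _ => (he _ (face 1 i (edge x)).2).trans (hext _)), edge_zero, edge_one, face_vertex,
      face_vertex]
  simp only [hi, Fin.sum_univ_three]
  have h1 : (0 : Fin 3).succAbove (0 : Fin 2) = 1 := by decide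
  have h2 : (0 : Fin 3).succAbove (1 : Fin 2) = 2 := by decide
  have h3 : (1 : Fin 3).succAbove (0 : Fin 2) = 0 := by decide
  have h4 : (1 : Fin 3).succAbove (1 : Fin 2) = 2 := by decide
  have h5 : (2 : Fin 3).succAbove (0 : Fin 2) = 0 := by decide
  have h6 : (2 : Fin 3).succAbove (1 : Fin 2) = 1 := by decide
  rw [h1, h2, h3, h4, h5, h6]
  simp

/-! ### Lifts to the tautological bundle -/

/-- A map to complex two-space which spans the lines of a map to the resolved conifold. -/
def IsLift {Y : Type*} (σ : Y → Resolved) (s : Y → C2) : Prop :=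
  ∀ y, s y ≠ 0 ∧ lineProj (σ y).base (s y) = s y

theorem IsLift.comp {Y Z : Type*} {σ : Y → Resolved} {s : Y → C2} (h : IsLift σ s) (f : Z → Y) :
    IsLift (σ ∘ f) (s ∘ f) := fun z => h (f z)

theorem lineProj_lineVec (l : CP1) : lineProj l (lineVec l) = lineVec l :=
  projOn_self (lineVec_ne_zero l)

theorem lineProj_lineProj (l : CP1) (w : C2) : lineProj l (lineProj l w) = lineProj l w :=
  projOn_projOn (lineVec_ne_zero l) w

theorem exists_lift {n : ℕ} (σ : C(stdSimplex ℝ (Fin (n + 1)), Resolved)) :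
    ∃ s : C(stdSimplex ℝ (Fin (n + 1)), C2), IsLift σ s := by
  let P : (Fin (n + 1) → ℝ) → C2 →L[ℝ] C2 :=
    Function.extend Subtype.val (fun x => lineProj (σ x).base) 0
  have hext : ∀ x : stdSimplex ℝ (Fin (n + 1)), P x.1 = lineProj (σ x).base := fun x =>
    Subtype.val_injective.extend_apply _ _ _
  obtain ⟨s, hs, hs0, hP, -⟩ := exists_section (isCompact_stdSimplex ℝ (Fin (n + 1)))
    (convex_stdSimplex ℝ (Fin (n + 1))) (stdSimplex.vertex (S := ℝ) (0 : Fin (n + 1))).2 (P := P)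
    (by
      rw [continuousOn_iff_continuous_domRestrict]
      have : Continuous fun x => lineProj (σ x).base :=
        continuous_lineProj.comp (continuous_base.comp σ.continuous)
      convert this using 1
      exact funext hext)
    (fun x hx w => by
      rw [hext ⟨x, hx⟩]
      exact lineProj_lineProj _ _)
    (lineVec_ne_zero (σ (stdSimplex.vertex 0)).base)
    (by
      rw [hext]
      exact lineProj_lineVec _)
  exact ⟨⟨fun x => s x.1, continuousOn_iff_continuous_domRestrict.1 hs⟩, fun x =>
    ⟨hs0 _ x.2, (hext x ▸ hP _ x.2)⟩⟩

theorem edge_apply (x : stdSimplex ℝ (Fin 2)) : edge (x 1) = x := by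
  have h : x 1 ∈ Icc (0 : ℝ) 1 := ⟨stdSimplex.zero_le x 1, stdSimplex.le_one x 1⟩
  have h1 := stdSimplex.add_eq_one x
  ext i
  fin_cases i
  · simp only [Fin.zero_eta, edge_apply_zero h]
    linarith
  · exact edge_apply_one h

/-- A singular one-simplex of the resolved conifold which is smooth. -/
def IsSmoothPath (γ : C(stdSimplex ℝ (Fin 2), Resolved)) : Prop :=
  ContDiffOn ℝ ∞ (fun τ => (γ (edge τ)).point) (Icc 0 1) ∧
    ContDiffOn ℝ ∞ (fun τ => lineProj (γ (edge τ)).base) (Icc 0 1)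

theorem exists_smooth_lift (γ : C(stdSimplex ℝ (Fin 2), Resolved)) :
    ∃ s : C(stdSimplex ℝ (Fin 2), C2), IsLift γ s ∧
      (IsSmoothPath γ → ContDiffOn ℝ ∞ (fun τ => s (edge τ)) (Icc 0 1)) := by
  have hc : Continuous fun τ => lineProj (γ (edge τ)).base :=
    continuous_lineProj.comp (continuous_base.comp (γ.continuous.comp continuous_edge))
  obtain ⟨s, hs, hs0, hP, hsm⟩ := exists_section (isCompact_Icc (a := (0 : ℝ)) (b := 1))
    (convex_Icc 0 1) (left_mem_Icc.2 zero_le_one) hc.continuousOn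
    (fun x _ w => lineProj_lineProj _ _) (lineVec_ne_zero (γ (edge 0)).base) (lineProj_lineVec _)
  have h : ∀ x : stdSimplex ℝ (Fin 2), x 1 ∈ Icc (0 : ℝ) 1 := fun x =>
    ⟨stdSimplex.zero_le x 1, stdSimplex.le_one x 1⟩
  refine ⟨⟨fun x => s (x 1), hs.comp_continuous
    ((continuous_apply 1).comp continuous_subtype_val) h⟩, fun x => ⟨hs0 _ (h x), ?_⟩, fun hγ => ?_⟩
  · have := hP _ (h x)
    rwa [edge_apply] at this
  · refine (hsm hγ.2).congr fun τ hτ => ?_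
    change s (edge τ 1) = s τ
    rw [edge_apply_one hτ]

/-! ### Standard lifts of paths -/

section Twist

variable (k : Knot) {ε : ℝ}

theorem IsConormal.lineSection_ne_zero {k : Knot} {t : ℝ} {z : C4} (h : IsConormal k ε t z)
    (hε : 0 < ε) : lineSection k z ≠ 0 := fun h0 => by
  have := h.half_le_norm_lineSection hε
  rw [h0, norm_zero] at this
  norm_num at this

theorem isLift_lineSection (hε : 0 < ε) {Y : Type*} {σ : Y → Resolved}
    (h : ∀ y, σ y ∈ conifoldTransition (shiftedConormal k ε)) :
    IsLift σ fun y => lineSection k (σ y).point := fun y => by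
  obtain ⟨t, ht⟩ := isConormal_of_mem (h y)
  exact ⟨ht.lineSection_ne_zero hε, lineProj_lineSection k (ht.ne_zero hε)⟩

theorem continuous_lineSection (hε : 0 < ε) {Y : Type*} [TopologicalSpace Y] {σ : Y → Resolved}
    (hσ : Continuous σ) (h : ∀ y, σ y ∈ conifoldTransition (shiftedConormal k ε)) :
    Continuous fun y => lineSection k (σ y).point := by
  refine continuous_iff_continuousAt.2 fun y => ?_
  obtain ⟨t, ht⟩ := isConormal_of_mem (h y)
  exact (contDiffAt_lineSection k (ht.ne_zero hε)).continuousAt.comp (f := fun y => (σ y).point)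
    (continuous_point.comp hσ).continuousAt

theorem contDiffOn_lineSection {z : ℝ → C4} (hε : 0 < ε) (hz : ContDiffOn ℝ ∞ z (Icc 0 1))
    (hL : ∀ τ ∈ Icc (0 : ℝ) 1, ∃ t, IsConormal k ε t (z τ)) :
    ContDiffOn ℝ ∞ (fun τ => lineSection k (z τ)) (Icc 0 1) := fun τ hτ => by
  obtain ⟨t, ht⟩ := hL τ hτ
  exact (contDiffAt_lineSection k (ht.ne_zero hε)).comp_contDiffWithinAt τ (hz τ hτ)

/-- Every path in the resolved conifold has a lift which is given by the frame of the knot if the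
path lies on the conifold transition, and which is smooth if the path is smooth. -/
theorem exists_edgeLift (hε : 0 < ε) (γ : C(stdSimplex ℝ (Fin 2), Resolved)) :
    ∃ s : C(stdSimplex ℝ (Fin 2), C2), IsLift γ s ∧
      ((∀ x, γ x ∈ conifoldTransition (shiftedConormal k ε)) →
        ∀ x, s x = lineSection k (γ x).point) ∧
      (IsSmoothPath γ → ContDiffOn ℝ ∞ (fun τ => s (edge τ)) (Icc 0 1)) := by
  by_cases h : ∀ x, γ x ∈ conifoldTransition (shiftedConormal k ε)
  · exact ⟨⟨_, continuous_lineSection k hε γ.continuous h⟩, isLift_lineSection k hε h,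
      fun _ x => rfl, fun hγ => contDiffOn_lineSection k hε hγ.1 fun τ _ =>
        isConormal_of_mem (h _)⟩
  · obtain ⟨s, hs, hsm⟩ := exists_smooth_lift γ
    exact ⟨s, hs, fun h' => absurd h' h, hsm⟩

/-- A lift of a path which is given by the frame of the knot if the path lies on the conifold
transition. -/
def edgeLift (hε : 0 < ε) (γ : C(stdSimplex ℝ (Fin 2), Resolved)) : C(stdSimplex ℝ (Fin 2), C2) :=
  (exists_edgeLift k hε γ).choose

theorem isLift_edgeLift (hε : 0 < ε) (γ : C(stdSimplex ℝ (Fin 2), Resolved)) :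
    IsLift γ (edgeLift k hε γ) :=
  (exists_edgeLift k hε γ).choose_spec.1

theorem edgeLift_of_mem (hε : 0 < ε) {γ : C(stdSimplex ℝ (Fin 2), Resolved)}
    (h : ∀ x, γ x ∈ conifoldTransition (shiftedConormal k ε)) (x : stdSimplex ℝ (Fin 2)) :
    edgeLift k hε γ x = lineSection k (γ x).point :=
  (exists_edgeLift k hε γ).choose_spec.2.1 h x

theorem contDiffOn_edgeLift (hε : 0 < ε) {γ : C(stdSimplex ℝ (Fin 2), Resolved)}
    (h : IsSmoothPath γ) :
    ContDiffOn ℝ ∞ (fun τ => edgeLift k hε γ (edge τ)) (Icc 0 1) :=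
  (exists_edgeLift k hε γ).choose_spec.2.2 h

end Twist

/-- The quotient of two collinear vectors. -/
def ratio (l s : C2) : ℂ := inner ℂ l s / (‖l‖ : ℂ) ^ 2

theorem ratio_smul {l : C2} (hl : l ≠ 0) (c : ℂ) : ratio l (c • l) = c := by
  have : (‖l‖ : ℂ) ^ 2 ≠ 0 := by simpa using hl
  rw [ratio, inner_smul_right, inner_self_eq_norm_sq_to_K]
  exact mul_div_cancel_right₀ _ this

theorem ratio_self {l : C2} (hl : l ≠ 0) : ratio l l = 1 := by
  simpa using ratio_smul hl 1

/-! ### Comparison of lifts by their relative argument -/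

section Ratio

variable {Y : Type*} {σ : Y → Resolved} {l s r : Y → C2}

theorem IsLift.eq_ratio_smul (hl : IsLift σ l) (hs : IsLift σ s) (y : Y) :
    s y = ratio (l y) (s y) • l y := by
  obtain ⟨c, hc⟩ := exists_eq_smul_of_lineProj (hl y).2 (hl y).1 (hs y).2
  rw [hc, ratio_smul (hl y).1]

theorem IsLift.ratio_ne_zero (hl : IsLift σ l) (hs : IsLift σ s) (y : Y) :
    ratio (l y) (s y) ≠ 0 := fun h => by
  have := hl.eq_ratio_smul hs y
  rw [h, zero_smul] at this
  exact (hs y).1 this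

theorem IsLift.ratio_mul (hl : IsLift σ l) (hs : IsLift σ s) (hr : IsLift σ r) (y : Y) :
    ratio (l y) (r y) = ratio (l y) (s y) * ratio (s y) (r y) := by
  obtain ⟨c, hc⟩ := exists_eq_smul_of_lineProj (hl y).2 (hl y).1 (hs y).2
  obtain ⟨d, hd⟩ := exists_eq_smul_of_lineProj (hs y).2 (hs y).1 (hr y).2
  rw [hd, ratio_smul (hs y).1, hc, ratio_smul (hl y).1, smul_smul, ratio_smul (hl y).1, mul_comm]

theorem IsLift.continuous_ratio [TopologicalSpace Y] (hl : IsLift σ l) (hlc : Continuous l)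
    (hsc : Continuous s) : Continuous fun y => ratio (l y) (s y) :=
  (hlc.inner hsc).div ((Complex.continuous_ofReal.comp hlc.norm).pow 2) fun y => by
    simpa using (hl y).1

/-- The total change of the relative argument of two lifts of a path. -/
def twist (l s : ℝ → C2) : ℝ := (logIncr fun τ => ratio (l τ) (s τ)).im

theorem twist_self {l : ℝ → C2} (h : ∀ τ, l τ ≠ 0) : twist l l = 0 := by
  rw [twist, logIncr_one fun τ _ => ratio_self (h τ), Complex.zero_im]

theorem twist_add {q : ℝ → Resolved} {l s r : ℝ → C2} (hl : IsLift q l) (hs : IsLift q s)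
    (hr : IsLift q r) (hlc : Continuous l) (hsc : Continuous s) (hrc : Continuous r) :
    twist l r = twist l s + twist s r := by
  rw [twist, twist, twist, ← Complex.add_im]
  congr 1
  exact logIncr_mul (hl.continuous_ratio hlc hsc).continuousOn
    (hs.continuous_ratio hsc hrc).continuousOn (fun x _ => hl.ratio_ne_zero hs x)
    (fun x _ => hs.ratio_ne_zero hr x) fun x _ => hl.ratio_mul hs hr x

end Ratio

/-! ### The relative degree of the tautological bundle -/

section Winding

variable (k : Knot) {ε : ℝ} (hε : 0 < ε)

/-- The change of the argument of a lift of a path relative to the standard lift. -/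
def twistCochain (p : C(stdSimplex ℝ (Fin 2), Resolved × C2)) : ℝ :=
  twist (fun τ => edgeLift k hε (ContinuousMap.fst.comp p) (edge τ)) fun τ => (p (edge τ)).2

/-- The total change of the argument of a lift of a triangle along the boundary, relative to the
standard lifts of the edges. -/
def triangleTwist (σ : C(stdSimplex ℝ (Fin 3), Resolved)) (s : C(stdSimplex ℝ (Fin 3), C2)) : ℝ :=
  cochain (twistCochain k hε) (bdry 1 _ (Finsupp.single (σ.prodMk s) 1))

theorem triangleTwist_eq (σ : C(stdSimplex ℝ (Fin 3), Resolved))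
    (s : C(stdSimplex ℝ (Fin 3), C2)) :
    triangleTwist k hε σ s = ∑ i : Fin 3, (-1) ^ (i : ℕ) *
      twist (fun τ => edgeLift k hε (σ.comp (face 1 i)) (edge τ))
        (fun τ => s (face 1 i (edge τ))) :=
  cochain_bdry_single _ _

/-- Two lifts differ by a nowhere vanishing function on the full triangle, whose logarithmic
increments along the boundary cancel by `sum_logIncr_face`. -/
theorem triangleTwist_eq_of_isLift {σ : C(stdSimplex ℝ (Fin 3), Resolved)}
    {s r : C(stdSimplex ℝ (Fin 3), C2)} (hs : IsLift σ s) (hr : IsLift σ r) :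
    triangleTwist k hε σ s = triangleTwist k hε σ r := by
  have h0 := congrArg Complex.im (sum_logIncr_face (hs.continuous_ratio s.continuous r.continuous)
    (hs.ratio_ne_zero hr))
  have hc : ∀ i : Fin 3, Continuous fun τ => face 1 i (edge τ) := fun i =>
    (face 1 i).continuous.comp continuous_edge
  have h1 : ∀ i : Fin 3, twist (fun τ => edgeLift k hε (σ.comp (face 1 i)) (edge τ))
        (fun τ => r (face 1 i (edge τ))) =
      twist (fun τ => edgeLift k hε (σ.comp (face 1 i)) (edge τ))
        (fun τ => s (face 1 i (edge τ))) +
      twist (fun τ => s (face 1 i (edge τ))) (fun τ => r (face 1 i (edge τ))) := fun i =>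
    twist_add ((isLift_edgeLift k hε (σ.comp (face 1 i))).comp edge)
      (hs.comp fun τ => face 1 i (edge τ)) (hr.comp fun τ => face 1 i (edge τ))
      ((edgeLift k hε (σ.comp (face 1 i))).continuous.comp continuous_edge)
      (s.continuous.comp (hc i)) (r.continuous.comp (hc i))
  rw [triangleTwist_eq, triangleTwist_eq]
  simp only [h1, Fin.sum_univ_three]
  rw [Fin.sum_univ_three] at h0
  have h2 : ∀ i : Fin 3, (logIncr fun τ => ratio (s (face 1 i (edge τ)))
    (r (face 1 i (edge τ)))).im =
      twist (fun τ => s (face 1 i (edge τ))) (fun τ => r (face 1 i (edge τ))) := fun i => rfl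
  simp [h2] at h0 ⊢
  linarith

/-- The relative degree of the tautological bundle on a triangle. -/
def windingCochain (σ : C(stdSimplex ℝ (Fin 3), Resolved)) : ℝ :=
  triangleTwist k hε σ (exists_lift σ).choose

theorem windingCochain_eq {σ : C(stdSimplex ℝ (Fin 3), Resolved)}
    {s : C(stdSimplex ℝ (Fin 3), C2)} (hs : IsLift σ s) :
    windingCochain k hε σ = triangleTwist k hε σ s :=
  triangleTwist_eq_of_isLift k hε (exists_lift σ).choose_spec hs

/-- A lift over the whole tetrahedron restricts to lifts of its faces. With these, `windingCochain`
is the coboundary of `twistCochain` on pairs of a simplex and a lift, so `bdry_bdry` applies. The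
standard lifts cause no trouble because they depend on the edge alone. -/
theorem cochain_windingCochain_bdry (c : Chain 3 Resolved) :
    cochain (windingCochain k hε) (bdry 2 Resolved c) = 0 := by
  have h : (cochain (windingCochain k hε)).comp (bdry 2 Resolved) = 0 := by
    ext σ : 2
    obtain ⟨s, hs⟩ := exists_lift σ
    have h1 := congrArg (cochain (twistCochain k hε))
      (bdry_bdry (Finsupp.single (σ.prodMk s) 1))
    rw [bdry_single, map_sum, map_sum, map_zero] at h1
    change cochain (windingCochain k hε) (bdry 2 Resolved (Finsupp.single σ 1)) = 0
    rw [cochain_bdry_single, ← h1]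
    refine Finset.sum_congr rfl fun i _ => ?_
    have hi : windingCochain k hε (σ.comp (face 2 i)) = cochain (twistCochain k hε)
        (bdry 1 _ (Finsupp.single ((σ.prodMk s).comp (face 2 i)) 1)) :=
      windingCochain_eq k hε (σ := σ.comp (face 2 i)) (s := s.comp (face 2 i))
        (hs.comp (face 2 i))
    rw [map_zsmul, map_zsmul, hi]
    simp
  exact DFunLike.congr_fun h c

/-- On `L` the section `lineSection` lifts the triangle and coincides with the standard lifts of its
edges, so nothing twists. -/
theorem windingCochain_of_mem {σ : C(stdSimplex ℝ (Fin 3), Resolved)}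
    (h : ∀ x, σ x ∈ conifoldTransition (shiftedConormal k ε)) : windingCochain k hε σ = 0 := by
  rw [windingCochain_eq k hε (s := ⟨_, continuous_lineSection k hε σ.continuous h⟩)
    (isLift_lineSection k hε h), triangleTwist_eq]
  refine Finset.sum_eq_zero fun i _ => ?_
  have h1 : (fun τ => edgeLift k hε (σ.comp (face 1 i)) (edge τ)) =
      fun τ => lineSection k (σ (face 1 i (edge τ))).point :=
    funext fun τ => edgeLift_of_mem k hε (γ := σ.comp (face 1 i)) (fun x => h _) _
  rw [h1]
  exact mul_eq_zero_of_right _ (twist_self fun τ => ((isLift_lineSection k hε h) _).1)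

end Winding

/-! ### The length of the projection of the boundary to the knot -/

section Angle

variable (k : Knot) (ε : ℝ)

/-- The integral of the conical Liouville form over a path on the conifold transition. -/
def angleCochain (γ : C(stdSimplex ℝ (Fin 2), Resolved)) : ℝ :=
  open Classical in
  if ∀ x, γ x ∈ conifoldTransition (shiftedConormal k ε) then
    -(ε * k.length / (2 * Real.pi * √2)) *
      (logIncr fun τ => k.angleExt (footPoint (γ (edge τ)).point)).im
  else 0

/-- On a triangle in `L` the angle is a nowhere vanishing function, so its increments along the
boundary cancel. This expresses that `dt` is closed on `L`. -/
theorem cochain_angleCochain_bdry (hε : 0 < ε) {c : Chain 2 Resolved}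
    (hc : c ∈ chainsIn 2 (conifoldTransition (shiftedConormal k ε))) :
    cochain (angleCochain k ε) (bdry 1 Resolved c) = 0 := by
  have : chainsIn 2 (conifoldTransition (shiftedConormal k ε)) ≤
      ((cochain (angleCochain k ε)).comp (bdry 1 Resolved)).ker := by
    refine (AddSubgroup.closure_le _).2 ?_
    rintro _ ⟨σ, hσ, rfl⟩
    change cochain (angleCochain k ε) (bdry 1 Resolved (Finsupp.single σ 1)) = 0
    have hg : Continuous fun x => k.angleExt (footPoint (σ x).point) := by
      refine k.contDiff_angleExt.continuous.comp (continuous_iff_continuousAt.2 fun x => ?_)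
      obtain ⟨t, ht⟩ := isConormal_of_mem (hσ x)
      exact (contDiffAt_footPoint (ht.ne_zero hε)).continuousAt.comp (f := fun y => (σ y).point)
        (continuous_point.comp σ.continuous).continuousAt
    have hg0 : ∀ x, k.angleExt (footPoint (σ x).point) ≠ 0 := fun x => by
      obtain ⟨t, ht⟩ := isConormal_of_mem (hσ x)
      rw [ht.footPoint_eq hε, k.angleExt_apply]
      exact k.angle_ne_zero t
    have h0 := congrArg Complex.im (sum_logIncr_face hg hg0)
    have h1 : ∀ i : Fin 3, angleCochain k ε (σ.comp (face 1 i)) =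
        -(ε * k.length / (2 * Real.pi * √2)) *
          (logIncr fun τ => k.angleExt (footPoint (σ (face 1 i (edge τ))).point)).im := fun i =>
      if_pos fun x => hσ _
    have h2 := cochain_bdry_single (angleCochain k ε) σ
    rw [h2]
    change ∑ i : Fin 3, _ = _
    simp only [h1, Fin.sum_univ_three] at h0 ⊢
    simp at h0 ⊢
    linear_combination -(ε * k.length / (2 * Real.pi * √2)) * h0
  exact this hc

/-- A homomorphism on two-chains which vanishes on relative boundaries. -/
def topologicalArea {ε : ℝ} (hε : 0 < ε) (C : ℝ) : Chain 2 Resolved →+ ℝ :=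
  (AddMonoidHom.mulLeft (1 / 2 : ℝ)).comp (cochain (windingCochain k hε)) +
    (AddMonoidHom.mulLeft C).comp ((cochain (angleCochain k ε)).comp (bdry 1 Resolved))

theorem topologicalArea_apply {ε : ℝ} (hε : 0 < ε) (C : ℝ) (c : Chain 2 Resolved) :
    topologicalArea k hε C c = 1 / 2 * cochain (windingCochain k hε) c +
      C * cochain (angleCochain k ε) (bdry 1 Resolved c) := rfl

/-- Boundaries are killed by the cocycle property and `bdry_bdry`, chains in `L` by the vanishing of
both terms there. -/
theorem topologicalArea_eq_zero {ε : ℝ} (hε : 0 < ε) (C : ℝ) {c : Chain 2 Resolved}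
    (hc : c ∈ relBoundaries 1 (conifoldTransition (shiftedConormal k ε))) :
    topologicalArea k hε C c = 0 := by
  obtain ⟨_, ⟨d, rfl⟩, a, ha, rfl⟩ := AddSubgroup.mem_sup.1 hc
  rw [topologicalArea_apply, map_add, map_add, map_add, cochain_windingCochain_bdry, bdry_bdry,
    map_zero, cochain_angleCochain_bdry k ε hε ha,
    cochain_eq_zero (fun σ hσ => windingCochain_of_mem k hε hσ) ha]
  ring

end Angle

/-! ### Smooth triangles -/

theorem contDiffAt_connForm {s : C2} (hs : s ≠ 0) : ContDiffAt ℝ ∞ connForm s :=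
  (((contDiff_norm_sq ℂ).contDiffAt).inv (by simpa using hs)).smul imForm.contDiff.contDiffAt

theorem continuousOn_connForm_derivWithin {l : ℝ → C2} (hl : ContDiffOn ℝ ∞ l (Icc 0 1))
    (hl0 : ∀ τ ∈ Icc (0 : ℝ) 1, l τ ≠ 0) :
    ContinuousOn (fun τ => connForm (l τ) (derivWithin l (Icc 0 1) τ)) (Icc 0 1) := by
  refine ContinuousOn.clm_apply (fun τ hτ => ?_)
    (hl.continuousOn_derivWithin uniqueDiffOn_Icc_zero_one (by simp))
  exact (contDiffAt_connForm (hl0 τ hτ)).continuousAt.comp_continuousWithinAt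
    (hl.continuousOn τ hτ)

/-- The integrals of the connection form over two lifts of a path differ by the change of their
relative argument. -/
theorem pathIntegral_connForm {q : ℝ → Resolved} {l s : ℝ → C2} (hl : IsLift q l)
    (hs : IsLift q s) (hls : ContDiffOn ℝ ∞ l (Icc 0 1)) (hss : ContDiffOn ℝ ∞ s (Icc 0 1)) :
    pathIntegral connForm s = pathIntegral connForm l + twist l s := by
  have hg : ContDiffOn ℝ ∞ (fun τ => ratio (l τ) (s τ)) (Icc 0 1) := by
    refine (hls.inner ℂ hss).mul (((Complex.ofRealCLM.contDiff.comp_contDiffOn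
      (hls.norm ℂ fun τ _ => (hl τ).1)).pow 2).inv fun τ _ => ?_)
    simpa using (hl τ).1
  have hg0 : ∀ τ, ratio (l τ) (s τ) ≠ 0 := hl.ratio_ne_zero hs
  rw [twist, logIncr_eq_integral (hg.of_le (by norm_cast)) fun τ _ => hg0 τ]
  have hi : IntervalIntegrable (fun τ => derivWithin (fun τ => ratio (l τ) (s τ))
      (Icc 0 1) τ / ratio (l τ) (s τ)) volume 0 1 := by
    refine ContinuousOn.intervalIntegrable ?_
    rw [uIcc_of_le zero_le_one]
    exact (hg.continuousOn_derivWithin uniqueDiffOn_Icc_zero_one (by simp)).div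
      hg.continuousOn fun τ _ => hg0 τ
  have hi2 : IntervalIntegrable (fun τ => connForm (l τ) (derivWithin l (Icc 0 1) τ))
      volume 0 1 := by
    refine ContinuousOn.intervalIntegrable ?_
    rw [uIcc_of_le zero_le_one]
    exact continuousOn_connForm_derivWithin hls fun τ _ => (hl τ).1
  have hi3 : IntervalIntegrable (fun τ => (derivWithin (fun τ => ratio (l τ) (s τ))
      (Icc 0 1) τ / ratio (l τ) (s τ)).im) volume 0 1 :=
    ⟨Complex.imCLM.integrable_comp hi.1, Complex.imCLM.integrable_comp hi.2⟩
  have him := Complex.imCLM.intervalIntegral_comp_comm hi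
  simp only [Complex.imCLM_apply] at him
  rw [← him, pathIntegral, pathIntegral, ← intervalIntegral.integral_add hi2 hi3]
  refine intervalIntegral.integral_congr fun τ hτ => ?_
  rw [uIcc_of_le zero_le_one] at hτ
  have hu : UniqueDiffWithinAt ℝ (Icc (0 : ℝ) 1) τ := uniqueDiffOn_Icc_zero_one τ hτ
  have hd : derivWithin s (Icc 0 1) τ = ratio (l τ) (s τ) • derivWithin l (Icc 0 1) τ +
      derivWithin (fun τ => ratio (l τ) (s τ)) (Icc 0 1) τ • l τ := by
    have h1 : HasDerivWithinAt (fun τ => ratio (l τ) (s τ) • l τ)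
        (ratio (l τ) (s τ) • derivWithin l (Icc 0 1) τ +
          derivWithin (fun τ => ratio (l τ) (s τ)) (Icc 0 1) τ • l τ) (Icc 0 1) τ :=
      ((hg.differentiableOn (by simp) τ hτ).hasDerivWithinAt).smul
        ((hls.differentiableOn (by simp) τ hτ).hasDerivWithinAt)
    exact (h1.congr (fun τ _ => hl.eq_ratio_smul hs τ) (hl.eq_ratio_smul hs τ)).derivWithin hu
  have hs' := hl.eq_ratio_smul hs τ
  have hl0 : ‖l τ‖ ≠ 0 := norm_ne_zero_iff.2 (hl τ).1
  have hg0' := hg0 τ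
  generalize derivWithin (fun τ => ratio (l τ) (s τ)) (Icc 0 1) τ = g' at hd
  generalize ratio (l τ) (s τ) = g at hd hs' hg0'
  generalize derivWithin l (Icc 0 1) τ = l' at hd
  rw [hd, hs']
  change (‖g • l τ‖ ^ 2)⁻¹ * (inner ℂ (g • l τ) (g • l' + g' • l τ)).im =
    (‖l τ‖ ^ 2)⁻¹ * (inner ℂ (l τ) l').im + (g' / g).im
  -- From `s = g l`, the factor `‖g‖²` cancels against `‖s‖²`, and the derivative of `g` contributes
  -- exactly `Im (g' / g)`.
  have e : inner ℂ (g • l τ) (g • l' + g' • l τ) =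
      ((‖g‖ ^ 2 : ℝ) : ℂ) * (inner ℂ (l τ) l') + ((‖g‖ ^ 2 * ‖l τ‖ ^ 2 : ℝ) : ℂ) * (g' / g) := by
    have h1 : (((‖g‖ ^ 2 : ℝ)) : ℂ) = starRingEnd ℂ g * g := by
      rw [mul_comm, Complex.mul_conj, Complex.normSq_eq_norm_sq]
    rw [Complex.ofReal_mul, h1, inner_smul_left, inner_add_right, inner_smul_right,
      inner_smul_right, inner_self_eq_norm_sq_to_K]
    simp only [Complex.coe_algebraMap, Complex.ofReal_pow]
    field_simp
  have hgn : ‖g‖ ≠ 0 := norm_ne_zero_iff.2 hg0'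
  rw [e, Complex.add_im, Complex.im_ofReal_mul, Complex.im_ofReal_mul, norm_smul]
  field_simp

theorem contDiff_edgeLine (i : Fin 3) : ContDiff ℝ ∞ (edgeLine i) := by
  fin_cases i
  · exact (contDiff_const.sub contDiff_id).prodMk contDiff_id
  · exact contDiff_const.prodMk contDiff_id
  · exact contDiff_id.prodMk contDiff_const

theorem edgeLine_mem (i : Fin 3) {τ : ℝ} (hτ : τ ∈ Icc (0 : ℝ) 1) :
    edgeLine i τ ∈ closedTriangle := by
  obtain ⟨h0, h1⟩ := hτ
  fin_cases i <;> simp [edgeLine, closedTriangle, h0, h1]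

theorem coord_mem_closedTriangle (x : stdSimplex ℝ (Fin 3)) : (x 1, x 2) ∈ closedTriangle := by
  have h := stdSimplex.sum_eq_one x
  rw [Fin.sum_univ_three] at h
  have h0 := stdSimplex.zero_le x 0
  exact ⟨stdSimplex.zero_le x 1, stdSimplex.zero_le x 2, by simp only; linarith⟩

/-- Stokes' theorem, with the boundary as a sum over the edges. -/
theorem integral_formDeriv_eq_sum {E : Type*} [NormedAddCommGroup E] [NormedSpace ℝ E]
    {A : E → E →L[ℝ] ℝ} {z : ℝ × ℝ → E} (hz : ContDiffOn ℝ ∞ z closedTriangle)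
    (hA : ∀ y ∈ closedTriangle, ContDiffAt ℝ ∞ A (z y)) :
    ∫ y in openTriangle, formDeriv A (z y) (fderiv ℝ z y (1, 0)) (fderiv ℝ z y (0, 1)) =
      ∑ i : Fin 3, (-1) ^ (i : ℕ) * pathIntegral A fun τ => z (edgeLine i τ) := by
  rw [(integral_formDeriv hz hA).2, Fin.sum_univ_three]
  simp [edgeLine]
  ring

/-- A singular triangle in the resolved conifold which is smooth up to the boundary. -/
structure IsSmoothTriangle (σ : C(stdSimplex ℝ (Fin 3), Resolved)) (h : ℝ × ℝ → Resolved) :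
    Prop where
  eq : ∀ x, σ x = h (x 1, x 2)
  point : ContDiffOn ℝ ∞ (fun y => (h y).point) closedTriangle
  base : ContDiffOn ℝ ∞ (fun y => lineProj (h y).base) closedTriangle

namespace IsSmoothTriangle

variable {σ : C(stdSimplex ℝ (Fin 3), Resolved)} {h : ℝ × ℝ → Resolved}

theorem comp_face_edge (H : IsSmoothTriangle σ h) (i : Fin 3) {τ : ℝ}
    (hτ : τ ∈ Icc (0 : ℝ) 1) : σ (face 1 i (edge τ)) = h (edgeLine i τ) := by
  rw [H.eq, face_edge i hτ]

theorem isSmoothPath (H : IsSmoothTriangle σ h) (i : Fin 3) :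
    IsSmoothPath (σ.comp (face 1 i)) := by
  have hm : MapsTo (edgeLine i) (Icc 0 1) closedTriangle := fun τ hτ => edgeLine_mem i hτ
  refine ⟨(H.point.comp (contDiff_edgeLine i).contDiffOn hm).congr fun τ hτ => ?_,
    (H.base.comp (contDiff_edgeLine i).contDiffOn hm).congr fun τ hτ => ?_⟩
  · exact congrArg Resolved.point (H.comp_face_edge i hτ)
  · exact congrArg (fun q => lineProj (Resolved.base q)) (H.comp_face_edge i hτ)

theorem exists_lift (H : IsSmoothTriangle σ h) :
    ∃ s : ℝ × ℝ → C2, ContDiffOn ℝ ∞ s closedTriangle ∧ (∀ y ∈ closedTriangle, s y ≠ 0) ∧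
      ∀ y ∈ closedTriangle, lineProj (h y).base (s y) = s y := by
  have h0 : (0 : ℝ × ℝ) ∈ closedTriangle := by simp [closedTriangle]
  obtain ⟨s, -, hs0, hP, hsm⟩ := exists_section isCompact_closedTriangle convex_closedTriangle h0
    H.base.continuousOn (fun x _ w => lineProj_lineProj _ _) (lineVec_ne_zero (h 0).base)
    (lineProj_lineVec _)
  exact ⟨s, hsm H.base, hs0, hP⟩

end IsSmoothTriangle

/-! ### Boundary terms of Stokes' theorem as cochains on edges -/

section TriangleCochains

variable (k : Knot) {ε : ℝ} (hε : 0 < ε)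

/-- The boundary term of the area. -/
def boundaryCochain (γ : C(stdSimplex ℝ (Fin 2), Resolved)) : ℝ :=
  open Classical in
  if IsSmoothPath γ then
    1 / 2 * pathIntegral connForm (fun τ => edgeLift k hε γ (edge τ)) +
      pathIntegral liouville (fun τ => (γ (edge τ)).point) -
      pathIntegral (boundaryForm k ε) fun τ => (γ (edge τ)).point
  else 0

/-- The standard lift of a path in `L` is `lineSection`, which is the case covered by
`pathIntegral_boundaryForm`. Paths that are not smooth have the value `0` by definition. -/
theorem boundaryCochain_of_mem {γ : C(stdSimplex ℝ (Fin 2), Resolved)}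
    (h : ∀ x, γ x ∈ conifoldTransition (shiftedConormal k ε)) : boundaryCochain k hε γ = 0 := by
  rw [boundaryCochain]
  split_ifs with hγ
  · have h1 : (fun τ => edgeLift k hε γ (edge τ)) =
        fun τ => lineSection k (γ (edge τ)).point := funext fun τ => edgeLift_of_mem k hε h _
    rw [h1]
    exact pathIntegral_boundaryForm hε hγ.1 fun τ _ => isConormal_of_mem (h _)
  · rfl

/-- The integral of the conical Liouville form. -/
def coneCochain (k : Knot) (ε : ℝ) (γ : C(stdSimplex ℝ (Fin 2), Resolved)) : ℝ :=
  open Classical in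
  if IsSmoothPath γ then pathIntegral (coneForm ε) fun τ => (γ (edge τ)).point
  else angleCochain k ε γ

/-- Replaces an integral, meaningful for smooth edges only, by a topological quantity defined for
every continuous path in `L`. The default value of `coneCochain` is chosen so that this holds for
paths which are not smooth as well. -/
theorem coneCochain_of_mem (hε : 0 < ε) {γ : C(stdSimplex ℝ (Fin 2), Resolved)}
    (h : ∀ x, γ x ∈ conifoldTransition (shiftedConormal k ε)) :
    coneCochain k ε γ = angleCochain k ε γ := by
  rw [coneCochain]
  split_ifs with hγ
  · rw [pathIntegral_coneForm hε hγ.1 fun τ _ => isConormal_of_mem (h _), angleCochain, if_pos h]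
  · rfl

variable {σ : C(stdSimplex ℝ (Fin 3), Resolved)} {h : ℝ × ℝ → Resolved} {s : ℝ × ℝ → C2}

theorem IsSmoothTriangle.integral_coneForm (H : IsSmoothTriangle σ h) (hε : 0 < ε) :
    ∫ y in openTriangle, formDeriv (coneForm ε) (h y).point
        (fderiv ℝ (fun y => (h y).point) y (1, 0)) (fderiv ℝ (fun y => (h y).point) y (0, 1)) =
      cochain (coneCochain k ε) (bdry 1 Resolved (Finsupp.single σ 1)) := by
  rw [integral_formDeriv_eq_sum (z := fun y => (h y).point) H.point
    fun y _ => (contDiff_coneForm hε).contDiffAt]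
  refine Eq.trans ?_ (cochain_bdry_single (coneCochain k ε) σ).symm
  refine Finset.sum_congr rfl fun i _ => ?_
  rw [coneCochain, if_pos (H.isSmoothPath i)]
  congr 1
  refine pathIntegral_congr (fun τ hτ => ?_) fun _ _ => rfl
  exact congrArg Resolved.point (H.comp_face_edge i hτ).symm

/-- Stokes' theorem with a smooth lift `s` of the triangle. On each edge `s` is compared with the
standard lift: by `pathIntegral_connForm` the discrepancy is the twist, and the twists add up to
`windingCochain`. What remains depends on the edges only. -/
theorem IsSmoothTriangle.integral_boundaryForm (H : IsSmoothTriangle σ h)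
    (hs : ContDiffOn ℝ ∞ s closedTriangle) (hs0 : ∀ y ∈ closedTriangle, s y ≠ 0)
    (hsP : ∀ y ∈ closedTriangle, lineProj (h y).base (s y) = s y) :
    1 / 2 * (∫ y in openTriangle, formDeriv connForm (s y)
        (fderiv ℝ s y (1, 0)) (fderiv ℝ s y (0, 1))) +
      (∫ y in openTriangle, formDeriv liouville (h y).point
        (fderiv ℝ (fun y => (h y).point) y (1, 0)) (fderiv ℝ (fun y => (h y).point) y (0, 1))) -
      (∫ y in openTriangle, formDeriv (boundaryForm k ε) (h y).point
        (fderiv ℝ (fun y => (h y).point) y (1, 0)) (fderiv ℝ (fun y => (h y).point) y (0, 1))) =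
      1 / 2 * windingCochain k hε σ +
        cochain (boundaryCochain k hε) (bdry 1 Resolved (Finsupp.single σ 1)) := by
  let r : C(stdSimplex ℝ (Fin 3), C2) := ⟨fun x => s (x 1, x 2),
    hs.continuousOn.comp_continuous
      (((continuous_apply 1).comp continuous_subtype_val).prodMk
        ((continuous_apply 2).comp continuous_subtype_val)) coord_mem_closedTriangle⟩
  have hr : IsLift σ r := fun x => ⟨hs0 _ (coord_mem_closedTriangle x), by
    rw [H.eq]
    exact hsP _ (coord_mem_closedTriangle x)⟩
  have hre : ∀ i, EqOn (fun τ => s (edgeLine i τ)) (fun τ => r (face 1 i (edge τ)))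
      (Icc 0 1) := fun i τ hτ => by
    change _ = s (face 1 i (edge τ) 1, face 1 i (edge τ) 2)
    rw [face_edge i hτ]
  have hrs : ∀ i, ContDiffOn ℝ ∞ (fun τ => r (face 1 i (edge τ))) (Icc 0 1) := fun i =>
    (hs.comp (contDiff_edgeLine i).contDiffOn fun τ hτ => edgeLine_mem i hτ).congr
      fun τ hτ => (hre i hτ).symm
  have hpe : ∀ i, EqOn (fun τ => (h (edgeLine i τ)).point)
      (fun τ => ((σ.comp (face 1 i)) (edge τ)).point) (Icc 0 1) := fun i τ hτ =>
    congrArg Resolved.point (H.comp_face_edge i hτ).symm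
  have hc : ∀ i : Fin 3, pathIntegral connForm (fun τ => r (face 1 i (edge τ))) =
      pathIntegral connForm (fun τ => edgeLift k hε (σ.comp (face 1 i)) (edge τ)) +
        twist (fun τ => edgeLift k hε (σ.comp (face 1 i)) (edge τ))
          (fun τ => r (face 1 i (edge τ))) := fun i =>
    pathIntegral_connForm ((isLift_edgeLift k hε (σ.comp (face 1 i))).comp edge)
      (hr.comp fun τ => face 1 i (edge τ)) (contDiffOn_edgeLift k hε (H.isSmoothPath i)) (hrs i)
  rw [integral_formDeriv_eq_sum hs fun y hy => contDiffAt_connForm (hs0 y hy),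
    integral_formDeriv_eq_sum (z := fun y => (h y).point) H.point
      fun y _ => contDiff_liouville.contDiffAt,
    integral_formDeriv_eq_sum (z := fun y => (h y).point) H.point
      fun y _ => (contDiff_boundaryForm k hε).contDiffAt,
    windingCochain_eq k hε hr, triangleTwist_eq]
  have hb := cochain_bdry_single (boundaryCochain k hε) σ
  rw [hb, Finset.mul_sum, Finset.mul_sum, ← Finset.sum_add_distrib, ← Finset.sum_sub_distrib]
  change _ = _ + ∑ i : Fin 3, _
  rw [← Finset.sum_add_distrib]
  refine Finset.sum_congr rfl fun i _ => ?_
  rw [boundaryCochain, if_pos (H.isSmoothPath i), pathIntegral_congr (hre i) fun _ _ => rfl,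
    pathIntegral_congr (A := liouville) (hpe i) fun _ _ => rfl,
    pathIntegral_congr (A := boundaryForm k ε) (hpe i) fun _ _ => rfl,
    hc i]
  ring

end TriangleCochains

/-! ### Triangles of pseudoholomorphic curves -/

section Curve

variable {S : Type*} [TopologicalSpace S] [ChartedSpace HalfPlane S]
  {E : Type*} [NormedAddCommGroup E] [NormedSpace ℂ E]

theorem IsHolomorphicAt.curveDeriv_eq {F : S → E} {p : S} (h : IsHolomorphicAt F p) (a : ℂ) :
    curveDeriv F p a = a • curveDeriv F p 1 := by
  have h1 : curveDeriv F p (Complex.I * 1) = Complex.I • curveDeriv F p 1 := h.2 1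
  have h2 : a = a.re • (1 : ℂ) + a.im • (Complex.I * 1) := by
    apply Complex.ext <;> simp
  conv_lhs => rw [h2]
  rw [map_add, map_smul, map_smul, h1]
  conv_rhs => rw [← Complex.re_add_im a, add_smul, mul_smul]
  simp

/-- The chain rule for a pseudoholomorphic curve composed with a smooth triangle. -/
theorem IsHolomorphicAt.fderiv_comp {F : S → E} {g : ℝ × ℝ → S} {y : ℝ × ℝ}
    (h : IsHolomorphicAt F (g y)) (hg : ContMDiffAt 𝓘(ℝ, ℝ × ℝ) realModel ∞ g y) (a : ℝ × ℝ) :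
    fderiv ℝ (fun x => F (g x)) y a = surfDeriv g y a • curveDeriv F (g y) 1 := by
  have h1 : MDifferentiableAt realModel 𝓘(ℝ, E) F (g y) := h.1.mdifferentiableAt (by simp)
  have h2 : MDifferentiableAt 𝓘(ℝ, ℝ × ℝ) realModel g y := hg.mdifferentiableAt (by simp)
  have h3 := mfderiv_comp y h1 h2
  rw [mfderiv_eq_fderiv] at h3
  rw [← h.curveDeriv_eq]
  exact DFunLike.congr_fun h3 a

theorem IsHolomorphicAt.contDiffWithinAt_comp {F : S → E} {g : ℝ × ℝ → S} {y : ℝ × ℝ}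
    {D : Set (ℝ × ℝ)} (h : IsHolomorphicAt F (g y))
    (hg : ContMDiffWithinAt 𝓘(ℝ, ℝ × ℝ) realModel ∞ g D y) :
    ContDiffWithinAt ℝ ∞ (fun x => F (g x)) D y :=
  contMDiffWithinAt_iff_contDiffWithinAt.1 (h.1.comp_contMDiffWithinAt y hg)

end Curve

/-- The condition is the nonvanishing of a diagonal entry of the projector, which is continuous; the
chosen representative of a line need not vary continuously. -/
theorem isOpen_vCoord_ne_zero : IsOpen {l : CP1 | vCoord l ≠ 0} := by
  have h : ∀ l : CP1, lineProj l (EuclideanSpace.single 1 1) 1 =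
      (‖lineVec l‖ ^ 2)⁻¹ • (starRingEnd ℂ (vCoord l) * vCoord l) := fun l => by
    rw [lineProj, projOn_apply, EuclideanSpace.inner_single_right, lineVec_one]
    simp [lineVec_one]
  have hc : Continuous fun l : CP1 => lineProj l (EuclideanSpace.single 1 1) 1 :=
    (EuclideanSpace.proj (𝕜 := ℂ) (1 : Fin 2)).continuous.comp
      (continuous_lineProj.clm_apply continuous_const)
  have he : {l : CP1 | vCoord l ≠ 0} = {l | lineProj l (EuclideanSpace.single 1 1) 1 ≠ 0} := by
    ext l
    have := lineVec_ne_zero l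
    simp [h, this]
  rw [he]
  exact isOpen_ne_fun hc continuous_const

theorem isOpen_uCoord_ne_zero : IsOpen {l : CP1 | uCoord l ≠ 0} := by
  have h : ∀ l : CP1, lineProj l (EuclideanSpace.single 0 1) 0 =
      (‖lineVec l‖ ^ 2)⁻¹ • (starRingEnd ℂ (uCoord l) * uCoord l) := fun l => by
    rw [lineProj, projOn_apply, EuclideanSpace.inner_single_right, lineVec_zero]
    simp [lineVec_zero]
  have hc : Continuous fun l : CP1 => lineProj l (EuclideanSpace.single 0 1) 0 :=
    (EuclideanSpace.proj (𝕜 := ℂ) (0 : Fin 2)).continuous.comp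
      (continuous_lineProj.clm_apply continuous_const)
  have he : {l : CP1 | uCoord l ≠ 0} = {l | lineProj l (EuclideanSpace.single 0 1) 0 ≠ 0} := by
    ext l
    have := lineVec_ne_zero l
    simp [h, this]
  rw [he]
  exact isOpen_ne_fun hc continuous_const

theorem uCoord_ne_zero_of_vCoord_eq_zero {l : CP1} (h : vCoord l = 0) : uCoord l ≠ 0 := fun h' =>
  lineVec_ne_zero l <| by
    ext i
    fin_cases i
    · exact h'
    · exact h

theorem contDiff_vec_left : ContDiff ℝ ∞ fun ζ : ℂ => (!₂[ζ, 1] : C2) := by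
  refine contDiff_piLp' 2 fun i => ?_
  fin_cases i
  · exact contDiff_id
  · exact contDiff_const

theorem contDiff_vec_right : ContDiff ℝ ∞ fun ζ : ℂ => (!₂[1, ζ] : C2) := by
  refine contDiff_piLp' 2 fun i => ?_
  fin_cases i
  · exact contDiff_const
  · exact contDiff_id

/-! ### Smoothness of the triangles of a pseudoholomorphic curve -/

section Triangle

variable {S : Type*} [TopologicalSpace S] [ChartedSpace HalfPlane S] {f : C(S, Resolved)}

theorem IsPseudoholomorphic.contDiffOn_lineProj (hf : IsPseudoholomorphic f) {g : ℝ × ℝ → S}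
    (hg : ContMDiffOn 𝓘(ℝ, ℝ × ℝ) realModel ∞ g closedTriangle) :
    ContDiffOn ℝ ∞ (fun y => lineProj (f (g y)).base) closedTriangle := fun y hy => by
  have hb : ContinuousWithinAt (fun y => (f (g y)).base) closedTriangle y :=
    (continuous_base.comp f.continuous).continuousAt.comp_continuousWithinAt
      (hg y hy).continuousWithinAt
  by_cases hv : vCoord (f (g y)).base = 0
  · have hu := uCoord_ne_zero_of_vCoord_eq_zero hv
    have h1 := (hf.base_v _ hu).contDiffWithinAt_comp (hg y hy)
    have hne : (!₂[1, affV (f (g y)).base] : C2) ≠ 0 := fun h => by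
      simpa using congrArg (fun w : C2 => w 0) h
    have h2 : ContDiffWithinAt ℝ ∞ (fun y => projOn !₂[1, affV (f (g y)).base]) closedTriangle y :=
      ContDiffAt.comp_contDiffWithinAt (g := projOn) (f := fun y => !₂[1, affV (f (g y)).base]) y
        (contDiffAt_projOn hne) (contDiff_vec_right.contDiffAt.comp_contDiffWithinAt y h1)
    refine h2.congr_of_eventuallyEq ?_ (lineProj_of_uCoord_ne_zero hu)
    filter_upwards [hb.eventually (isOpen_uCoord_ne_zero.mem_nhds hu)] with x hx
    exact lineProj_of_uCoord_ne_zero hx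
  · have h1 := (hf.base_u _ hv).contDiffWithinAt_comp (hg y hy)
    have hne : (!₂[affU (f (g y)).base, 1] : C2) ≠ 0 := fun h => by
      simpa using congrArg (fun w : C2 => w 1) h
    have h2 : ContDiffWithinAt ℝ ∞ (fun y => projOn !₂[affU (f (g y)).base, 1]) closedTriangle y :=
      ContDiffAt.comp_contDiffWithinAt (g := projOn) (f := fun y => !₂[affU (f (g y)).base, 1]) y
        (contDiffAt_projOn hne) (contDiff_vec_left.contDiffAt.comp_contDiffWithinAt y h1)
    refine h2.congr_of_eventuallyEq ?_ (lineProj_of_vCoord_ne_zero hv)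
    filter_upwards [hb.eventually (isOpen_vCoord_ne_zero.mem_nhds hv)] with x hx
    exact lineProj_of_vCoord_ne_zero hx

theorem IsPseudoholomorphic.isSmoothTriangle (hf : IsPseudoholomorphic f) (T : Triangulation S)
    (i : Fin T.card) : IsSmoothTriangle (f.comp (T.simplex i)) (f ∘ T.param i) where
  eq x := congrArg f (T.simplex_eq i x)
  point y hy := (hf.point _).contDiffWithinAt_comp (T.smooth i y hy)
  base := hf.contDiffOn_lineProj (T.smooth i)

end Triangle

/-- The exterior derivative of the connection form. -/
theorem formDeriv_connForm {s : C2} (hs : s ≠ 0) (X Y : C2) :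
    formDeriv connForm s X Y = 2 / ‖s‖ ^ 4 *
      (starRingEnd ℂ (s 0 * X 1 - s 1 * X 0) * (s 0 * Y 1 - s 1 * Y 0)).im := by
  have h0 : ‖s‖ ^ 2 ≠ 0 := by simpa using hs
  have h1 : HasFDerivAt (fun s : C2 => (‖s‖ ^ 2)⁻¹)
      (-(‖s‖ ^ 2 ^ 2)⁻¹ • (2 • (innerSL ℝ s : C2 →L[ℝ] ℝ))) s := by
    have h2 : HasFDerivAt (fun s : C2 => ‖s‖ ^ 2) (2 • (innerSL ℝ s : C2 →L[ℝ] ℝ)) s :=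
      (hasFDerivAt_id s).norm_sq
    have h3 := (hasDerivAt_inv h0).comp_hasFDerivAt s h2
    refine h3.congr_fderiv ?_
    norm_num [← pow_mul]
  have hd : DifferentiableAt ℝ (fun s : C2 => imForm s) s := imForm.differentiableAt
  have h2 := formDeriv_smul h1.differentiableAt hd X Y
  change formDeriv (fun s => (‖s‖ ^ 2)⁻¹ • imForm s) s X Y = _
  rw [h2, h1.fderiv, formDeriv_imForm]
  have hre : ∀ X : C2, innerSL ℝ s X = (inner ℂ s X).re := fun X => by
    simp [PiLp.inner_apply, Complex.inner]
  have hf : ∀ X : C2, (-(‖s‖ ^ 2 ^ 2)⁻¹ • (2 • (innerSL ℝ s : C2 →L[ℝ] ℝ))) X =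
      -(‖s‖ ^ 2 ^ 2)⁻¹ * (2 * (inner ℂ s X).re) := fun X => by
    rw [← hre, two_mul, two_smul]
    rfl
  have hn : ‖s‖ ^ 2 = (starRingEnd ℂ (s 0) * s 0 + starRingEnd ℂ (s 1) * s 1).re := by
    rw [EuclideanSpace.norm_sq_eq, Fin.sum_univ_two, Complex.sq_norm, Complex.sq_norm]
    simp [Complex.normSq_apply]
  rw [hf, hf, imForm_apply, imForm_apply]
  -- The exponent parses as `2 ^ (2 ^ 1)`-style right association, that is `‖s‖ ^ (2 ^ 2)`, hence
  -- the conversion to `‖s‖ ^ 4`.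
  have e : ‖s‖ ^ 2 ^ 2 = ‖s‖ ^ 4 := by norm_num
  have e4 : ‖s‖ ^ 4 = (‖s‖ ^ 2) ^ 2 := by ring
  rw [e, e4]
  simp only [PiLp.inner_apply, RCLike.inner_apply, Fin.sum_univ_two]
  field_simp
  rw [hn]
  simp only [Complex.add_re, Complex.add_im, Complex.sub_re, Complex.sub_im, Complex.mul_re,
    Complex.mul_im, Complex.conj_re, Complex.conj_im]
  ring

/-! ### The area density of a pseudoholomorphic curve -/

/-- For `s = (ζ s₁, s₁)` the determinant of `s` with a tangent vector is `-s₁²` times the derivative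
of `ζ`. The derivatives of `s₁` drop out, and half the curvature is the Fubini–Study form in the
coordinate `ζ`. -/
theorem formDeriv_connForm_of_left {s X Y : C2} {ζ p q : ℂ} (h0 : s ≠ 0) (hs : s 0 = ζ * s 1)
    (hX : X 0 = p * s 1 + ζ * X 1) (hY : Y 0 = q * s 1 + ζ * Y 1) :
    1 / 2 * formDeriv connForm s X Y =
      (starRingEnd ℂ p * q).im / (1 + ‖ζ‖ ^ 2) ^ 2 := by
  have hn : ‖s‖ ^ 2 = ‖s 1‖ ^ 2 * (1 + ‖ζ‖ ^ 2) := by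
    rw [EuclideanSpace.norm_sq_eq, Fin.sum_univ_two, hs, norm_mul]
    ring
  have h1 : ‖s 1‖ ≠ 0 := fun h => by
    rw [h] at hn
    apply h0
    simpa using hn
  have e4 : ‖s‖ ^ 4 = (‖s‖ ^ 2) ^ 2 := by ring
  have e1 : ∀ (Z : C2) (r : ℂ), Z 0 = r * s 1 + ζ * Z 1 → s 0 * Z 1 - s 1 * Z 0 = -(s 1 ^ 2 * r) :=
    fun Z r h => by
      rw [hs, h]
      ring
  have e2 : starRingEnd ℂ (-(s 1 ^ 2 * p)) * -(s 1 ^ 2 * q) =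
      ((‖s 1‖ ^ 4 : ℝ) : ℂ) * (starRingEnd ℂ p * q) := by
    have h2 : (((‖s 1‖ ^ 2 : ℝ)) : ℂ) = starRingEnd ℂ (s 1) * s 1 := by
      rw [mul_comm, Complex.mul_conj, Complex.normSq_eq_norm_sq]
    have h3 : ((‖s 1‖ ^ 4 : ℝ) : ℂ) = ((‖s 1‖ ^ 2 : ℝ) : ℂ) ^ 2 := by
      rw [← Complex.ofReal_pow]
      ring_nf
    rw [h3, h2, map_neg, map_mul, map_pow]
    ring
  have hp : (0 : ℝ) < 1 + ‖ζ‖ ^ 2 := by positivity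
  rw [formDeriv_connForm h0, e1 X p hX, e1 Y q hY, e2, Complex.im_ofReal_mul, e4, hn]
  field_simp

theorem formDeriv_connForm_of_right {s X Y : C2} {ζ p q : ℂ} (h0 : s ≠ 0) (hs : s 1 = ζ * s 0)
    (hX : X 1 = p * s 0 + ζ * X 0) (hY : Y 1 = q * s 0 + ζ * Y 0) :
    1 / 2 * formDeriv connForm s X Y =
      (starRingEnd ℂ p * q).im / (1 + ‖ζ‖ ^ 2) ^ 2 := by
  have hn : ‖s‖ ^ 2 = ‖s 0‖ ^ 2 * (1 + ‖ζ‖ ^ 2) := by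
    rw [EuclideanSpace.norm_sq_eq, Fin.sum_univ_two, hs, norm_mul]
    ring
  have h1 : ‖s 0‖ ≠ 0 := fun h => by
    rw [h] at hn
    apply h0
    simpa using hn
  have e4 : ‖s‖ ^ 4 = (‖s‖ ^ 2) ^ 2 := by ring
  have e1 : ∀ (Z : C2) (r : ℂ), Z 1 = r * s 0 + ζ * Z 0 → s 0 * Z 1 - s 1 * Z 0 = s 0 ^ 2 * r :=
    fun Z r h => by
      rw [hs, h]
      ring
  have e2 : starRingEnd ℂ (s 0 ^ 2 * p) * (s 0 ^ 2 * q) =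
      ((‖s 0‖ ^ 4 : ℝ) : ℂ) * (starRingEnd ℂ p * q) := by
    have h2 : (((‖s 0‖ ^ 2 : ℝ)) : ℂ) = starRingEnd ℂ (s 0) * s 0 := by
      rw [mul_comm, Complex.mul_conj, Complex.normSq_eq_norm_sq]
    have h3 : ((‖s 0‖ ^ 4 : ℝ) : ℂ) = ((‖s 0‖ ^ 2 : ℝ) : ℂ) ^ 2 := by
      rw [← Complex.ofReal_pow]
      ring_nf
    rw [h3, h2, map_mul, map_pow]
    ring
  have hp : (0 : ℝ) < 1 + ‖ζ‖ ^ 2 := by positivity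
  rw [formDeriv_connForm h0, e1 X p hX, e1 Y q hY, e2, Complex.im_ofReal_mul, e4, hn]
  field_simp

theorem eq_affU_mul {l : CP1} {w : C2} (h : lineProj l w = w) (hv : vCoord l ≠ 0) :
    w 0 = affU l * w 1 := by
  obtain ⟨c, rfl⟩ := exists_eq_smul_lineVec h
  simp only [PiLp.smul_apply, lineVec_zero, lineVec_one, affU, smul_eq_mul]
  field_simp

theorem eq_affV_mul {l : CP1} {w : C2} (h : lineProj l w = w) (hu : uCoord l ≠ 0) :
    w 1 = affV l * w 0 := by
  obtain ⟨c, rfl⟩ := exists_eq_smul_lineVec h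
  simp only [PiLp.smul_apply, lineVec_zero, lineVec_one, affV, smul_eq_mul]
  field_simp

theorem fderiv_coord_eq {s : ℝ × ℝ → C2} {ζ : ℝ × ℝ → ℂ} {y : ℝ × ℝ} {i j : Fin 2}
    (hs : DifferentiableAt ℝ s y) (hζ : DifferentiableAt ℝ ζ y)
    (h : ∀ᶠ x in 𝓝 y, s x i = ζ x * s x j) (a : ℝ × ℝ) :
    fderiv ℝ s y a i = fderiv ℝ ζ y a * s y j + ζ y * fderiv ℝ s y a j := by
  have hc : ∀ i : Fin 2, HasFDerivAt (fun x => s x i)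
      (((EuclideanSpace.proj (𝕜 := ℂ) i).restrictScalars ℝ).comp (fderiv ℝ s y)) y := fun i =>
    ((EuclideanSpace.proj (𝕜 := ℂ) i).restrictScalars ℝ).hasFDerivAt.comp y hs.hasFDerivAt
  have h1 := (hc i).unique (((hζ.hasFDerivAt.mul (hc j)).congr_of_eventuallyEq h))
  have h2 := DFunLike.congr_fun h1 a
  change fderiv ℝ s y a i = ζ y * fderiv ℝ s y a j + s y j * fderiv ℝ ζ y a at h2
  rw [h2]
  ring

section Density

variable {S : Type*} [TopologicalSpace S] [ChartedSpace HalfPlane S] {f : C(S, Resolved)}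

/-- At each point the area form and the Kähler form of a pseudoholomorphic curve agree up to the
orientation of the parametrisation. -/
theorem IsPseudoholomorphic.exists_areaDensity_eq (hf : IsPseudoholomorphic f) {g : ℝ × ℝ → S}
    (hg : ContMDiffOn 𝓘(ℝ, ℝ × ℝ) realModel ∞ g closedTriangle) {s : ℝ × ℝ → C2}
    (hs : ContDiffOn ℝ ∞ s closedTriangle) (hs0 : ∀ y ∈ closedTriangle, s y ≠ 0)
    (hsP : ∀ y ∈ closedTriangle, lineProj (f (g y)).base (s y) = s y) {y : ℝ × ℝ}
    (hy : y ∈ openTriangle) :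
    areaDensity (f ∘ g) y * surfJacobian g y = |surfJacobian g y| *
      (1 / 2 * formDeriv connForm (s y) (fderiv ℝ s y (1, 0)) (fderiv ℝ s y (0, 1)) +
        formDeriv liouville (f (g y)).point (fderiv ℝ (fun y => (f (g y)).point) y (1, 0))
          (fderiv ℝ (fun y => (f (g y)).point) y (0, 1))) := by
  have hn := mem_nhds_closedTriangle hy
  have hyc := openTriangle_subset_closedTriangle hy
  have hgy : ContMDiffAt 𝓘(ℝ, ℝ × ℝ) realModel ∞ g y := (hg y hyc).contMDiffAt hn
  have hsy : DifferentiableAt ℝ s y := ((hs y hyc).contDiffAt hn).differentiableAt (by simp)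
  have hP := (hf.point (g y)).fderiv_comp hgy
  have hbc : ContinuousAt (fun y => (f (g y)).base) y :=
    ContinuousAt.comp (g := fun p => (f p).base) (continuous_base.comp f.continuous).continuousAt
      hgy.continuousAt
  -- `Φ` is the squared Fubini–Study length of the derivative of the curve. By holomorphy it
  -- controls both the pulled-back metric and the pulled-back curvature, whichever affine coordinate
  -- is used.
  obtain ⟨Φ, hΦ0, hΦ1, hΦ2⟩ : ∃ Φ : ℝ, 0 ≤ Φ ∧
      (∀ a b, fubiniStudyPullback (fun x => ((f ∘ g) x).base) y a b =
        (starRingEnd ℂ (surfDeriv g y a) * surfDeriv g y b).re * Φ) ∧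
      1 / 2 * formDeriv connForm (s y) (fderiv ℝ s y (1, 0)) (fderiv ℝ s y (0, 1)) =
        surfJacobian g y * Φ := by
    have key : ∀ a b c : ℂ, (starRingEnd ℂ (a • c) * b • c) =
        ((‖c‖ ^ 2 : ℝ) : ℂ) * (starRingEnd ℂ a * b) := fun a b c => by
      have h2 : (((‖c‖ ^ 2 : ℝ)) : ℂ) = starRingEnd ℂ c * c := by
        rw [mul_comm, Complex.mul_conj, Complex.normSq_eq_norm_sq]
      rw [h2, smul_eq_mul, smul_eq_mul, map_mul]
      ring
    have key2 : ∀ a b c : ℂ, (a • c * starRingEnd ℂ (b • c)).re =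
        (starRingEnd ℂ a * b).re * ‖c‖ ^ 2 := fun a b c => by
      have h2 : a • c * starRingEnd ℂ (b • c) = starRingEnd ℂ (starRingEnd ℂ (a • c) * b • c) := by
        rw [map_mul, Complex.conj_conj]
      rw [h2, Complex.conj_re, key, Complex.re_ofReal_mul, mul_comm]
    by_cases hv : vCoord (f (g y)).base = 0
    · have hu := uCoord_ne_zero_of_vCoord_eq_zero hv
      have hB := (hf.base_v (g y) hu).fderiv_comp hgy
      have hd : DifferentiableAt ℝ (fun x => affV (f (g x)).base) y :=
        (((hf.base_v (g y) hu).contDiffWithinAt_comp (hg y hyc)).contDiffAt hn).differentiableAt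
          (by simp)
      have he : ∀ᶠ x in 𝓝 y, s x 1 = affV (f (g x)).base * s x 0 := by
        filter_upwards [hn, hbc.eventually (isOpen_uCoord_ne_zero.mem_nhds hu)] with x hx hxu
        exact eq_affV_mul (hsP x hx) hxu
      refine ⟨‖curveDeriv (fun q => affV (f q).base) (g y) 1‖ ^ 2 /
        (1 + ‖affV (f (g y)).base‖ ^ 2) ^ 2, by positivity, fun a b => ?_, ?_⟩
      · rw [fubiniStudyPullback, if_neg (by simpa using hv)]
        change (fderiv ℝ (fun x => affV (f (g x)).base) y a *
          starRingEnd ℂ (fderiv ℝ (fun x => affV (f (g x)).base) y b)).re /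
            (1 + ‖affV (f (g y)).base‖ ^ 2) ^ 2 = _
        rw [hB, hB, key2]
        ring
      · rw [formDeriv_connForm_of_right (hs0 y hyc) he.self_of_nhds
          (fderiv_coord_eq hsy hd he _) (fderiv_coord_eq hsy hd he _), hB, hB, key,
          Complex.im_ofReal_mul, surfJacobian]
        ring
    · have hB := (hf.base_u (g y) hv).fderiv_comp hgy
      have hd : DifferentiableAt ℝ (fun x => affU (f (g x)).base) y :=
        (((hf.base_u (g y) hv).contDiffWithinAt_comp (hg y hyc)).contDiffAt hn).differentiableAt
          (by simp)
      have he : ∀ᶠ x in 𝓝 y, s x 0 = affU (f (g x)).base * s x 1 := by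
        filter_upwards [hn, hbc.eventually (isOpen_vCoord_ne_zero.mem_nhds hv)] with x hx hxv
        exact eq_affU_mul (hsP x hx) hxv
      refine ⟨‖curveDeriv (fun q => affU (f q).base) (g y) 1‖ ^ 2 /
        (1 + ‖affU (f (g y)).base‖ ^ 2) ^ 2, by positivity, fun a b => ?_, ?_⟩
      · rw [fubiniStudyPullback, if_pos (show vCoord ((f ∘ g) y).base ≠ 0 from hv)]
        change (fderiv ℝ (fun x => affU (f (g x)).base) y a *
          starRingEnd ℂ (fderiv ℝ (fun x => affU (f (g x)).base) y b)).re /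
            (1 + ‖affU (f (g y)).base‖ ^ 2) ^ 2 = _
        rw [hB, hB, key2]
        ring
      · rw [formDeriv_connForm_of_left (hs0 y hyc) he.self_of_nhds
          (fderiv_coord_eq hsy hd he _) (fderiv_coord_eq hsy hd he _), hB, hB, key,
          Complex.im_ofReal_mul, surfJacobian]
        ring
  set Z := curveDeriv (fun q => (f q).point) (g y) 1
  have hinner : ∀ a b, inner ℂ (fderiv ℝ (fun y => (f (g y)).point) y a)
      (fderiv ℝ (fun y => (f (g y)).point) y b) =
        ((‖Z‖ ^ 2 : ℝ) : ℂ) * (starRingEnd ℂ (surfDeriv g y a) * surfDeriv g y b) := fun a b => by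
    rw [hP, hP, inner_smul_left, inner_smul_right, inner_self_eq_norm_sq_to_K]
    simp only [Complex.coe_algebraMap, Complex.ofReal_pow]
    ring
  have hm : ∀ a b, metricPullback (f ∘ g) y a b =
      (starRingEnd ℂ (surfDeriv g y a) * surfDeriv g y b).re * (Φ + ‖Z‖ ^ 2) := fun a b => by
    rw [metricPullback, hΦ1]
    change _ + (inner ℂ (fderiv ℝ (fun y => (f (g y)).point) y a)
      (fderiv ℝ (fun y => (f (g y)).point) y b)).re = _
    rw [hinner, Complex.re_ofReal_mul]
    ring
  have hsq : areaDensity (f ∘ g) y = |surfJacobian g y| * (Φ + ‖Z‖ ^ 2) := by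
    have hG : 0 ≤ Φ + ‖Z‖ ^ 2 := by positivity
    -- The pulled-back metric is conformal to that of the surface, so its Gram determinant is a
    -- perfect square.
    have e : metricPullback (f ∘ g) y (1, 0) (1, 0) * metricPullback (f ∘ g) y (0, 1) (0, 1) -
        metricPullback (f ∘ g) y (1, 0) (0, 1) ^ 2 =
          (surfJacobian g y * (Φ + ‖Z‖ ^ 2)) ^ 2 := by
      rw [hm, hm, hm, surfJacobian]
      simp only [Complex.mul_re, Complex.mul_im, Complex.conj_re, Complex.conj_im]
      ring
    rw [areaDensity, e, Real.sqrt_sq_eq_abs, abs_mul, abs_of_nonneg hG]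
  rw [hsq, hΦ2, formDeriv_liouville, hinner, Complex.im_ofReal_mul]
  change _ = _ * (_ + ‖Z‖ ^ 2 * surfJacobian g y)
  ring

theorem areaDensity_nonneg (h : ℝ × ℝ → Resolved) (y : ℝ × ℝ) : 0 ≤ areaDensity h y :=
  Real.sqrt_nonneg _

theorem IsPseudoholomorphic.formDeriv_point (hf : IsPseudoholomorphic f) {g : ℝ × ℝ → S}
    (hg : ContMDiffOn 𝓘(ℝ, ℝ × ℝ) realModel ∞ g closedTriangle) (A : C4 → C4 →L[ℝ] ℝ)
    {y : ℝ × ℝ} (hy : y ∈ openTriangle) :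
    formDeriv A (f (g y)).point (fderiv ℝ (fun y => (f (g y)).point) y (1, 0))
      (fderiv ℝ (fun y => (f (g y)).point) y (0, 1)) =
      surfJacobian g y * formDeriv A (f (g y)).point (curveDeriv (fun q => (f q).point) (g y) 1)
        (Complex.I • curveDeriv (fun q => (f q).point) (g y) 1) := by
  have hP := (hf.point (g y)).fderiv_comp
    ((hg y (openTriangle_subset_closedTriangle hy)).contMDiffAt (mem_nhds_closedTriangle hy))
  rw [hP, hP, formDeriv_line]
  rfl

end Density

/-- The area of a triangle of a pseudoholomorphic curve. -/
theorem IsPseudoholomorphic.lintegral_areaDensity_le {S : Type*} [TopologicalSpace S]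
    [ChartedSpace HalfPlane S] {f : C(S, Resolved)} (hf : IsPseudoholomorphic f) (k : Knot)
    {ε C : ℝ} (hε : 0 < ε) (hC : ∀ z Z : C4, formDeriv (boundaryForm k ε) z Z (Complex.I • Z) ≤
      C * formDeriv (coneForm ε) z Z (Complex.I • Z)) (T : Triangulation S) (i : Fin T.card) :
    ∃ a : ℝ, 0 ≤ a ∧
      ∫⁻ y in openTriangle, ENNReal.ofReal (areaDensity (f ∘ T.param i) y) ≤ ENNReal.ofReal a ∧
      a = ((T.sign i : ℤ) : ℝ) * (1 / 2 * windingCochain k hε (f.comp (T.simplex i)) +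
        cochain (boundaryCochain k hε)
          (bdry 1 Resolved (Finsupp.single (f.comp (T.simplex i)) 1)) +
        C * cochain (coneCochain k ε)
          (bdry 1 Resolved (Finsupp.single (f.comp (T.simplex i)) 1))) := by
  have H := hf.isSmoothTriangle T i
  obtain ⟨s, hs, hs0, hsP⟩ := H.exists_lift
  have hg := T.smooth i
  set g := T.param i
  set e : ℝ := ((T.sign i : ℤ) : ℝ) with he
  set D : (C4 → C4 →L[ℝ] ℝ) → ℝ × ℝ → ℝ := fun A y =>
    formDeriv A (f (g y)).point (fderiv ℝ (fun y => (f (g y)).point) y (1, 0))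
      (fderiv ℝ (fun y => (f (g y)).point) y (0, 1)) with hD
  set Dc : ℝ × ℝ → ℝ := fun y =>
    formDeriv connForm (s y) (fderiv ℝ s y (1, 0)) (fderiv ℝ s y (0, 1)) with hDc
  have hi : ∀ {A : C4 → C4 →L[ℝ] ℝ}, ContDiff ℝ ∞ A → IntegrableOn (D A) openTriangle := fun hA =>
    (integral_formDeriv (z := fun y => (f (g y)).point) H.point
      fun y _ => hA.contDiffAt).1
  have hic : IntegrableOn Dc openTriangle :=
    (integral_formDeriv hs fun y hy => contDiffAt_connForm (hs0 y hy)).1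
  have h1 := hi contDiff_liouville
  have h2 := hi (contDiff_boundaryForm k hε)
  have h3 := hi (contDiff_coneForm hε)
  have i1 : IntegrableOn (fun y => 1 / 2 * Dc y) openTriangle := hic.const_mul _
  have i2 : IntegrableOn (fun y => 1 / 2 * Dc y + D liouville y) openTriangle := i1.add h1
  have i3 : IntegrableOn (fun y => 1 / 2 * Dc y + D liouville y - D (boundaryForm k ε) y)
      openTriangle := i2.sub h2
  have i4 : IntegrableOn (fun y => C * D (coneForm ε) y) openTriangle := h3.const_mul _
  have hint : IntegrableOn (fun y => e * (1 / 2 * Dc y + D liouville y - D (boundaryForm k ε) y +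
      C * D (coneForm ε) y)) openTriangle :=
    (i3.add i4).const_mul e
  -- The sign makes `e` times the Jacobian positive, so the area density is `e` times the
  -- pulled-back Kähler form. The correction subtracted from it is at most the conical term that is
  -- added.
  have hle : ∀ y ∈ openTriangle, areaDensity (f ∘ g) y ≤ e * (1 / 2 * Dc y + D liouville y -
      D (boundaryForm k ε) y + C * D (coneForm ε) y) := fun y hy => by
    have hJ : 0 < e * surfJacobian g y := T.sign_jacobian i y hy
    have hee : e = 1 ∨ e = -1 := by
      rcases Int.units_eq_one_or (T.sign i) with h | h <;> simp [he, h]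
    have hJ0 : surfJacobian g y ≠ 0 := by
      rintro h
      simp [h] at hJ
    have habs : |surfJacobian g y| = e * surfJacobian g y := by
      rcases hee with h | h <;> rw [h] at hJ ⊢
      · rw [one_mul] at hJ ⊢
        exact abs_of_pos hJ
      · rw [neg_one_mul] at hJ ⊢
        exact abs_of_neg (neg_pos.1 hJ)
    have ha := hf.exists_areaDensity_eq hg hs hs0 hsP hy
    rw [habs] at ha
    have ha' : areaDensity (f ∘ g) y = e * (1 / 2 * Dc y + D liouville y) := by
      apply mul_right_cancel₀ hJ0
      rw [ha]
      ring
    have hb := hf.formDeriv_point hg (boundaryForm k ε) hy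
    have hc := hf.formDeriv_point hg (coneForm ε) hy
    have hbc := mul_le_mul_of_nonneg_left (hC (f (g y)).point
      (curveDeriv (fun q => (f q).point) (g y) 1)) hJ.le
    have hb' : D (boundaryForm k ε) y = _ := hb
    have hc' : D (coneForm ε) y = _ := hc
    rw [ha', hb', hc']
    linarith
  have hnn : 0 ≤ᵐ[volume.restrict openTriangle] fun y => e * (1 / 2 * Dc y + D liouville y -
      D (boundaryForm k ε) y + C * D (coneForm ε) y) :=
    (ae_restrict_iff' isOpen_openTriangle.measurableSet).2 (.of_forall fun y hy =>
      (areaDensity_nonneg _ _).trans (hle y hy))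
  refine ⟨∫ y in openTriangle, e * (1 / 2 * Dc y + D liouville y -
      D (boundaryForm k ε) y + C * D (coneForm ε) y), integral_nonneg_of_ae hnn, ?_, ?_⟩
  · rw [ofReal_integral_eq_lintegral_ofReal hint hnn]
    exact setLIntegral_mono_ae' isOpen_openTriangle.measurableSet
      (.of_forall fun y hy => ENNReal.ofReal_le_ofReal (hle y hy))
  · have hb := H.integral_boundaryForm k hε hs hs0 hsP
    have hc := H.integral_coneForm k hε
    rw [integral_const_mul, integral_add i3 i4, integral_sub i2 h2, integral_add i1 h1,
      integral_const_mul, integral_const_mul, ← hb, ← hc]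
    rfl

/-- The area of a pseudoholomorphic curve is bounded by a homological quantity. -/
theorem IsPseudoholomorphic.area_le {S : Type*} [TopologicalSpace S]
    [ChartedSpace HalfPlane S] {f : C(S, Resolved)} (hf : IsPseudoholomorphic f) (k : Knot)
    {ε C : ℝ} (hε : 0 < ε) (hC : ∀ z Z : C4, formDeriv (boundaryForm k ε) z Z (Complex.I • Z) ≤
      C * formDeriv (coneForm ε) z Z (Complex.I • Z))
    (hL : MapsTo f (realModel.boundary S) (conifoldTransition (shiftedConormal k ε)))
    (T : Triangulation S) :
    area f T ≤ ENNReal.ofReal (topologicalArea k hε C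
      (pushChain 2 f (∑ i, Finsupp.single (T.simplex i) (T.sign i : ℤ)))) := by
  choose a ha0 hle ha using hf.lintegral_areaDensity_le k hε hC T
  refine (Finset.sum_le_sum fun i _ => hle i).trans ?_
  rw [← ENNReal.ofReal_sum_of_nonneg fun i _ => ha0 i]
  refine (congrArg ENNReal.ofReal ?_).le
  have hpush : pushChain 2 f (∑ i, Finsupp.single (T.simplex i) (T.sign i : ℤ)) =
      ∑ i, (T.sign i : ℤ) • Finsupp.single (f.comp (T.simplex i)) 1 := by
    rw [map_sum]
    exact Finset.sum_congr rfl fun i _ => by simp [pushChain]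
  -- Only the total boundary is a chain in `L`; interior edges cancel in the sum. Hence the edge
  -- cochains may be replaced by their values on `L` only after summation.
  have hmem : bdry 1 Resolved (∑ i, (T.sign i : ℤ) • Finsupp.single (f.comp (T.simplex i)) 1) ∈
      chainsIn 1 (conifoldTransition (shiftedConormal k ε)) := by
    rw [← hpush, bdry_pushChain]
    exact pushChain_mem_chainsIn 1 f hL T.isRelCycle
  have hsum : ∀ (φ : Chain 2 Resolved →+ ℝ), φ (∑ i, (T.sign i : ℤ) •
      Finsupp.single (f.comp (T.simplex i)) 1) =
        ∑ i, ((T.sign i : ℤ) : ℝ) * φ (Finsupp.single (f.comp (T.simplex i)) 1) := fun φ => by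
    rw [map_sum]
    exact Finset.sum_congr rfl fun i _ => by rw [map_zsmul, zsmul_eq_mul]
  have hb := cochain_eq_zero (fun γ hγ => boundaryCochain_of_mem k hε hγ) hmem
  have hc := cochain_congr (fun γ hγ => coneCochain_of_mem k hε hγ) hmem
  rw [hpush, topologicalArea_apply, ← hc, hsum]
  have hb' := (hsum ((cochain (boundaryCochain k hε)).comp (bdry 1 Resolved))).symm.trans hb
  have hc' := hsum ((cochain (coneCochain k ε)).comp (bdry 1 Resolved))
  simp only [AddMonoidHom.comp_apply] at hb' hc'
  -- The zero total of `boundaryCochain` is inserted on the right, after which the two sides agree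
  -- triangle by triangle.
  rw [hc', Finset.sum_congr rfl fun i _ => ha i, ← sub_eq_zero, ← hb', Finset.mul_sum,
    Finset.mul_sum, ← Finset.sum_add_distrib, ← Finset.sum_sub_distrib]
  refine Finset.sum_congr rfl fun i _ => ?_
  rw [cochain_single]
  push_cast
  ring

end Conifold

end

/-! ### The area bound -/

theorem lemma14 (k : Conifold.Knot) (ε : ℝ) (hε : 0 < ε)
    (β : Conifold.H2 Conifold.Resolved
      (Conifold.conifoldTransition (Conifold.shiftedConormal k ε))) :
    ∃ A : ℝ, ∀ (S : Type*) [TopologicalSpace S] [T2Space S] [CompactSpace S]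
      [ChartedSpace Conifold.HalfPlane S] [IsManifold Conifold.cxModel ∞ S]
      (f : C(S, Conifold.Resolved)), Conifold.IsPseudoholomorphic f →
      ∀ (hf : MapsTo f (Conifold.realModel.boundary S)
          (Conifold.conifoldTransition (Conifold.shiftedConormal k ε)))
        (T : Conifold.Triangulation S),
        Conifold.H2.map f hf T.fundamentalClass = β →
          Conifold.area f T ≤ ENNReal.ofReal A := by
  obtain ⟨C, -, hC⟩ := Conifold.exists_formDeriv_boundaryForm_le k hε
  obtain ⟨c, rfl⟩ := QuotientAddGroup.mk_surjective β
  -- The bound is the value on any representative of `β`. The pushed-forward fundamental cycle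
  -- differs from it by a relative boundary, on which `topologicalArea` vanishes.
  refine ⟨Conifold.topologicalArea k hε C c, fun S _ _ _ _ _ f hJ hf T hβ => ?_⟩
  refine (hJ.area_le k hε hC hf T).trans (le_of_eq (congrArg ENNReal.ofReal ?_))
  have hβ' : (QuotientAddGroup.mk (Conifold.pushCycles 1 f hf ⟨_, T.isRelCycle⟩) :
      Conifold.H2 Conifold.Resolved
        (Conifold.conifoldTransition (Conifold.shiftedConormal k ε))) =
      QuotientAddGroup.mk c := hβ
  have hmem := QuotientAddGroup.eq.1 hβ'
  have h := Conifold.topologicalArea_eq_zero k hε C hmem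
  rw [map_add, map_neg, map_add, map_neg, neg_add_eq_zero] at h
  exact h
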